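/- **Order book.** Fix $K,\bar M\in\mathbb N$, a horizon $T>0$, and boundary volumes $a_\infty,b_\infty\in\mathbb N\setminus\{0\}$; tick and order size are $1$. A state is $z=(x,y,\underline a,\underline b,\underline{na},\underline{nb},\underline{ra},\underline{rb},pa,pb)\in E:=\mathbb R\times\mathbb Z\times\mathbb N^K\times\mathbb N^K\times(\mathbb Z^{\bar M})^4\times\mathbb R\times\mathbb R$: the market maker's cash $x$ and inventory $y$; the numbers $a_i$ (resp. $b_i$) of shares offered (resp. bid) by the other participants $i$ ticks away from the best bid $pb$ (resp. best ask $pa$), $1\le i\le K$, all limits beyond the $K$-th one containing $a_\infty$ (resp. $b_\infty$) shares; the distance $ra_j$ (resp. $rb_j$) of the market maker's $j$-th sell (resp. buy) order from $pb$ (resp. $pa$), and its rank $na_j$ (resp. $nb_j$) in its queue, both being $-1$ if the order is not placed. Let $a_0$ be the least $i\le K$ with $a_i>0$ ($K+1$ if there is none), $|\underline a|+|\underline b|$ the total number of shares in the frame, and $|z|$ the Euclidean norm of $z$. The set $A_z$ of admissible actions consists of all $(\underline{ra}',\underline{rb}')$ with entries in $\{-1\}\cup\{a_0,\dots,K\}$.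 For $c\in A_z$, $\varphi^c(z)$ is the state after the market maker has moved her orders to the positions $c$: unmoved orders keep their place in the queue, the other ones are withdrawn and, if placed again, go to the end of their new queue. There are $4K+2$ types of events $e$: buy and sell market orders, and limit and cancel orders of the other participants at each of the $K$ limits of each side. A market order executes the first order in the queue at the best limit; if it belongs to the market maker, her cash and inventory change by $(+pa,-1)$ on the ask side and by $(-pb,+1)$ on the bid side. A limit order joins the end of its queue. A cancellation removes one of the other participants' orders of its queue, chosen uniformly (nothing happens if there is none). Ranks are updated according to the FIFO rule. When the best limit of a side moves by some ticks, so does the corresponding price, and the opposite side is re-indexed, vacant limits of the frame being filled with the boundary volume, and orders of the market maker that leave the frame being cancelled. The event $e$ has intensity $\lambda_e(\underline a,\underline b)\ge0$, independent of the market maker, and for some constants $\lambda^L,\lambda^C,\lambda^M$, $$\sum_i\lambda_{L_i^\pm}\le\lambda^L(|\underline a|+|\underline b|),\qquad \sum_i\lambda_{C_i^\pm}\le\lambda^C(|\underline a|+|\underline b|),\qquad \lambda_{M^+}+\lambda_{M^-}\le\lambda^M(|\underline a|+|\underline b|).$$ Let $\lambda(z)=\sum_e\lambda_e(\underline a,\underline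 b)$, and let $Q'(\cdot\mid z,c)$ be the law of the state right after the next event when the decision $c$ is taken in $z$ (the event is $e$ with probability $\lambda_e/\lambda$ and is applied to $\varphi^c(z)$). **Rewards.** The measurable running reward $f$ and terminal reward $g$ satisfy $|f(z,c)|\le c_5(1+|z|^2)$ for $z\in E$, $c\in A_z$, and $|g(z)|\le c_6(1+|z|^2)$ for $z\in E$. **Market making problem.** A strategy $\alpha$ chooses, at the initial time $T_0=t$ and at each jump time $T_n$, an action in $A_{Z_n}$ depending measurably on $(T_0,Z_0,\dots,T_n,Z_n)$, where $Z_n$ is the state reached at $T_n$; it is kept until the next jump, and $Z_s=\varphi^{\alpha_s}(Z_n)$ for $s\in[T_n,T_{n+1})$. Given the history, $T_{n+1}-T_n$ is exponential with parameter $\lambda(Z_n)$ ($T_{n+1}=\infty$ if $\lambda(Z_n)=0$) and, independently, $Z_{n+1}$ has law $Q'(\cdot\mid Z_n,\alpha_{T_n})$. For $(t,z)\in[0,T]\times E$, $$V(t,z)=\sup_\alpha\mathbb E^\alpha_{t,z}\Big[\int_t^Tf(Z_s,\alpha_s)\,ds+g(Z_T)\Big].$$ **Markov decision process.** For $(t,z)\in[0,T]\times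 E$ and $c\in A_z$ let $$r(t,z,c)=f(\varphi^c(z),c)\,\frac{1-e^{-\lambda(z)(T-t)}}{\lambda(z)}+e^{-\lambda(z)(T-t)}g(\varphi^c(z))$$ (the fraction is $T-t$ if $\lambda(z)=0$) and $$Q(B\times C\mid t,z,c)=\lambda(z)\int_0^{T-t}e^{-\lambda(z)s}\mathbf 1_B(t+s)\,Q'(C\mid z,c)\,ds,$$ the remaining mass $e^{-\lambda(z)(T-t)}$ being sent to a cemetery with zero reward. A policy is a sequence $(f_n)_{n\ge0}$ of measurable functions on $[0,T]\times E$ with $f_n(t,z)\in A_z$, and $$V_\infty(t,z)=\sup_{(f_n)}\mathbb E^{(f_n)}_{t,z}\Big[\sum_{n\ge0}r(T_n,Z_n,f_n(T_n,Z_n))\Big],\qquad(\mathcal Tv)(t,z)=\sup_{c\in A_z}\Big\{r(t,z,c)+\int v\,dQ(\cdot\mid t,z,c)\Big\}.$$ **Weighted space.** Let $\Lambda=(4K+2)\sup\lambda_e(\underline a,\underline b)/(|\underline a|+|\underline b|)$, the supremum being over all $e$ and all $(\underline a,\underline b)$ (with $0/0=0$). For $\gamma_0>0$ let $b(t,z)=(1+|z|^2)\,e^{\gamma(z)(T-t)}$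 with $\gamma(z)=\gamma_0(4K+2)\Lambda(1+|\underline a|+|\underline b|)$, and let $\mathbb B_b$ be the set of measurable $v:[0,T]\times E\to\mathbb R$ with $\|v\|_b=\sup_{(t,z)}|v(t,z)|/b(t,z)<\infty$. **Theorem.** For every $\gamma_0>0$, $\mathcal T$ has exactly one fixed point $v$ in $\mathbb B_b$. All the expectations above are well defined (the random variables being integrable, and $\mathbb E\sum_n|r(T_n,Z_n,f_n(T_n,Z_n))|<\infty$), the two suprema are finite, and $v=V_\infty=V$. There is a maximizer of $\mathcal T$ at $v$, i.e. a measurable $f^*$ with $f^*(t,z)\in A_z$ that attains the supremum in $(\mathcal Tv)(t,z)$ for all $(t,z)$; and for every such $f^*$ the stationary policy $(f^*,f^*,\dots)$ is optimal, for the Markov decision process and for the market making problem. -/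

import Mathlib

open MeasureTheory ProbabilityTheory
open scoped ENNReal NNReal

namespace LOB

/-! ## The order book -/

/-- One side (ask or bid) of the order book, as seen in the moving frame of `K` limits.
* `vol i` is the number of shares of the general participants `i + 1` ticks away from the best
  opposite price (`i = 0, …, K - 1`);
* `pos j` is the distance, in ticks, of the `j`-th order of the market maker from the best opposite
  price, `-1` if that order is not placed;
* `rank j` is the rank of this order in its queue (the first order in the queue has rank `1`), `-1`
  if it is not placed. -/
@[ext]
structure Side (K M : ℕ) where
  vol : Fin K → ℕ
  pos : Fin M → ℤ
  rank : Fin M → ℤ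

/-- The state `z` of the controlled order book: cash, inventory, the two sides and the best ask and
bid prices of the general participants. The tick size and the order size are `1`. -/
@[ext]
structure Book (K M : ℕ) where
  x : ℝ
  y : ℤ
  ask : Side K M
  bid : Side K M
  pa : ℝ
  pb : ℝ

/-- A decision: the positions of the sell orders and of the buy orders, `-1` for "not placed". -/
abbrev Action (M : ℕ) : Type := (Fin M → ℤ) × (Fin M → ℤ)

inductive BookSide
  | ask
  | bid

/-- The orders that the general participants may send to a given side of the book. The index
`i` stands for the limit `i + 1` ticks away from the best opposite price. -/
inductive Order (K : ℕ)
  | market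
  | limit (i : Fin K)
  | cancel (i : Fin K)

/-- The `4 K + 2` types of exogenous events. `(ask, market)` is a buy market order (it consumes the
ask side), `(bid, market)` a sell market order, `(ask, limit i)` a sell limit order, … -/
abbrev Event (K : ℕ) : Type := BookSide × Order K

def BookSide.equivBool : BookSide ≃ Bool where
  toFun s := match s with
    | .ask => true
    | .bid => false
  invFun b := match b with
    | true => .ask
    | false => .bid
  left_inv s := by cases s <;> rfl
  right_inv b := by cases b <;> rfl

def Order.equivSum (K : ℕ) : Order K ≃ Unit ⊕ (Fin K ⊕ Fin K) where
  toFun o := match o with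
    | .market => .inl ()
    | .limit i => .inr (.inl i)
    | .cancel i => .inr (.inr i)
  invFun o := match o with
    | .inl _ => .market
    | .inr (.inl i) => .limit i
    | .inr (.inr i) => .cancel i
  left_inv o := by cases o <;> rfl
  right_inv o := by rcases o with _ | _ | _ <;> rfl

instance : Fintype BookSide := Fintype.ofEquiv _ BookSide.equivBool.symm

instance (K : ℕ) : Fintype (Order K) := Fintype.ofEquiv _ (Order.equivSum K).symm

/-- The index of the first non-empty limit, between `1` and `K`; it is `K + 1` if the `K` limits
of the frame are empty (beyond the frame all limits are filled by the boundary condition). -/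
def best {K : ℕ} (v : Fin K → ℕ) : ℕ :=
  Nat.find (p := fun n => (∃ i : Fin K, n = (i : ℕ) + 1 ∧ 0 < v i) ∨ n = K + 1) ⟨K + 1, Or.inr rfl⟩

/-- The number of shares `l` ticks away from the best opposite price: `0` for `l ≤ 0`, the boundary
value `vinf` beyond the `K`-th limit. -/
def volAt {K : ℕ} (v : Fin K → ℕ) (vinf : ℕ) (l : ℤ) : ℕ :=
  if l ≤ 0 then 0 else if h : (l - 1).toNat < K then v ⟨(l - 1).toNat, h⟩ else vinf

namespace Side

variable {K M : ℕ}

/-- Re-indexing of a side when the best opposite price moves away by `d` ticks (comes closer by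
`-d` ticks if `d < 0`). The orders of the market maker that leave the frame are cancelled. -/
def shift (s : Side K M) (vinf : ℕ) (d : ℤ) : Side K M where
  vol i := volAt s.vol vinf ((i : ℤ) + 1 - d)
  pos j := if s.pos j ≠ -1 ∧ 1 ≤ s.pos j + d ∧ s.pos j + d ≤ K then s.pos j + d else -1
  rank j := if s.pos j ≠ -1 ∧ 1 ≤ s.pos j + d ∧ s.pos j + d ≤ K then s.rank j else -1

/-- A limit order of a general participant joins the end of the queue at limit `i + 1`. -/
def limitOrder (s : Side K M) (i : Fin K) : Side K M :=
  { s with vol := fun k => if k = i then s.vol k + 1 else s.vol k }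

/-- The number of orders of general participants in front of the `j`-th order of the market maker
in its queue. -/
def ahead (s : Side K M) (j : Fin M) : ℤ :=
  s.rank j - 1 - (Finset.univ.filter fun k => s.pos k = s.pos j ∧ s.rank k < s.rank j).card

/-- Cancellation of the order number `u` (`u = 0, 1, …`, counted from the front, among the general
participants' orders only) of the queue at limit `i + 1`. -/
def cancelOrder (s : Side K M) (i : Fin K) (u : ℕ) : Side K M :=
  if s.vol i = 0 then s else
    { vol := fun k => if k = i then s.vol k - 1 else s.vol k
      pos := s.pos
      rank := fun j => if s.pos j = (i : ℤ) + 1 ∧ (u : ℤ) < s.ahead j then s.rank j - 1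
        else s.rank j }

/-- The orders of the market maker that are executed by an incoming market order: those which are
first in the queue at the best limit. -/
def filled (s : Side K M) : Finset (Fin M) :=
  Finset.univ.filter fun j => s.pos j = best s.vol ∧ s.rank j = 1

/-- A market order executes the first order of the queue at the best limit. -/
def marketOrder (s : Side K M) : Side K M where
  vol k := if s.filled = ∅ ∧ (k : ℕ) + 1 = best s.vol then s.vol k - 1 else s.vol k
  pos j := if j ∈ s.filled then -1 else s.pos j
  rank j := if j ∈ s.filled then -1 else if s.pos j = best s.vol then s.rank j - 1 else s.rank j

/-- The market maker's `j`-th order stays in its queue under the decision `c`. -/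
def kept (s : Side K M) (c : Fin M → ℤ) (j : Fin M) : Prop := c j = s.pos j

instance (s : Side K M) (c : Fin M → ℤ) (j : Fin M) : Decidable (s.kept c j) :=
  inferInstanceAs (Decidable (c j = s.pos j))

/-- The market maker moves her orders to the positions `c`. An order whose position does not change
keeps its place in the queue (and advances when another order of hers in front of it is
withdrawn); the other ones are withdrawn, and sent to the end of the queue at their new position,
in the order of their indices. -/
def place (s : Side K M) (c : Fin M → ℤ) : Side K M where
  vol := s.vol
  pos := c
  rank j :=
    if c j = -1 then -1
    else if s.kept c j then
      s.rank j - (Finset.univ.filter fun k =>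
        ¬ s.kept c k ∧ s.pos k = s.pos j ∧ s.rank k < s.rank j).card
    else
      volAt s.vol 0 (c j) + (Finset.univ.filter fun k => c k = c j ∧ s.kept c k).card
        + (Finset.univ.filter fun k => c k = c j ∧ ¬ s.kept c k ∧ k < j).card + 1

end Side

/-- `|a| + |b|`: the total number of shares in the frame. -/
def size {K : ℕ} (a b : Fin K → ℕ) : ℕ := ∑ i, a i + ∑ i, b i

namespace Book

variable {K M : ℕ}

/-- `φ^c(z)`, the state of the book right after the decision `c`. -/
def place (c : Action M) (z : Book K M) : Book K M :=
  { z with ask := z.ask.place c.1, bid := z.bid.place c.2 }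

/-- `A_z`: each order is not placed, or is placed between the best limit and the limit `K`
(the market maker does not enter the spread). The spread is `best z.ask.vol`. -/
def admissible (z : Book K M) : Set (Action M) :=
  {c | (∀ j, c.1 j = -1 ∨ ((best z.ask.vol : ℤ) ≤ c.1 j ∧ c.1 j ≤ K)) ∧
    (∀ j, c.2 j = -1 ∨ ((best z.ask.vol : ℤ) ≤ c.2 j ∧ c.2 j ≤ K))}

/-- `|z|²`, the square of the Euclidean norm of the vector of all the coordinates of `z`. -/
noncomputable def normSq (z : Book K M) : ℝ :=
  z.x ^ 2 + (z.y : ℝ) ^ 2 + z.pa ^ 2 + z.pb ^ 2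
    + ∑ i, ((z.ask.vol i : ℝ) ^ 2 + (z.bid.vol i : ℝ) ^ 2)
    + ∑ j, ((z.ask.pos j : ℝ) ^ 2 + (z.bid.pos j : ℝ) ^ 2
        + (z.ask.rank j : ℝ) ^ 2 + (z.bid.rank j : ℝ) ^ 2)

/-- The side `s` of the book becomes `new`, and `n` orders of the market maker have been executed on
this side. If the best limit of the side has moved by `d` ticks, so does the best price of this
side, and the opposite side is re-indexed. -/
noncomputable def react (ainf binf : ℕ) (z : Book K M) (s : BookSide) (new : Side K M) (n : ℕ) :
    Book K M :=
  match s with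
  | .ask =>
    let d : ℤ := (best new.vol : ℤ) - best z.ask.vol
    { x := z.x + n * z.pa, y := z.y - n, ask := new, bid := z.bid.shift binf d,
      pa := z.pa + d, pb := z.pb }
  | .bid =>
    let d : ℤ := (best new.vol : ℤ) - best z.bid.vol
    { x := z.x - n * z.pb, y := z.y + n, ask := z.ask.shift ainf d, bid := new,
      pa := z.pa, pb := z.pb - d }

def side (z : Book K M) (s : BookSide) : Side K M :=
  match s with
  | .ask => z.ask
  | .bid => z.bid

/-- The state of the book after the event `e`; the mark `u` is used by the cancellations only
(rank of the cancelled order among those of the general participants). -/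
noncomputable def jump (ainf binf : ℕ) (e : Event K) (u : ℕ) (z : Book K M) : Book K M :=
  match e.2 with
  | .market => z.react ainf binf e.1 (z.side e.1).marketOrder (z.side e.1).filled.card
  | .limit i => z.react ainf binf e.1 ((z.side e.1).limitOrder i) 0
  | .cancel i => z.react ainf binf e.1 ((z.side e.1).cancelOrder i u) 0

/-- The number of possible marks of the event `e`: a cancellation concerns one of the orders of the
general participants in the queue. -/
def marks (e : Event K) (z : Book K M) : ℕ :=
  match e.2 with
  | .market => 1
  | .limit _ => 1
  | .cancel i => max 1 ((z.side e.1).vol i)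

end Book

/-! ## Measurable structure: the Borel `σ`-algebra of `ℝ³ × (countable discrete space)` -/

section Measurable

variable {K M : ℕ}

instance : MeasurableSpace (Side K M) := ⊤

instance : DiscreteMeasurableSpace (Side K M) := ⟨fun _ => trivial⟩

instance : Countable (Side K M) :=
  Function.Injective.countable
    (f := fun s : Side K M => (s.vol, s.pos, s.rank)) (by
      intro s t h
      simp only [Prod.mk.injEq] at h
      exact Side.ext h.1 h.2.1 h.2.2)

def Book.equivProd (K M : ℕ) : Book K M ≃ (ℝ × ℝ × ℝ) × (ℤ × Side K M × Side K M) where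
  toFun z := ((z.x, z.pa, z.pb), (z.y, z.ask, z.bid))
  invFun q := ⟨q.1.1, q.2.1, q.2.2.1, q.2.2.2, q.1.2.1, q.1.2.2⟩
  left_inv _ := rfl
  right_inv _ := rfl

instance : MeasurableSpace (Book K M) := MeasurableSpace.comap (Book.equivProd K M) inferInstance

def Book.measurableEquivProd (K M : ℕ) :
    Book K M ≃ᵐ (ℝ × ℝ × ℝ) × (ℤ × Side K M × Side K M) where
  toEquiv := Book.equivProd K M
  measurable_toFun := comap_measurable _
  measurable_invFun := by
    rintro _ ⟨t, ht, rfl⟩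
    simpa [← Set.preimage_comp] using ht

/-- Measurability on the state space can be checked with the discrete coordinates frozen. -/
theorem measurable_of_fibers {β : Type*} [MeasurableSpace β] {F : Book K M → β}
    (h : ∀ (y : ℤ) (a b : Side K M),
      Measurable fun q : ℝ × ℝ × ℝ => F ⟨q.1, y, a, b, q.2.1, q.2.2⟩) : Measurable F := by
  have h1 : Measurable (F ∘ (Book.measurableEquivProd K M).symm) :=
    measurable_from_prod_countable_left fun d => h d.1 d.2.1 d.2.2
  have h2 := h1.comp (Book.measurableEquivProd K M).measurable
  simpa [Function.comp_assoc] using h2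

theorem measurable_mk (y : ℤ) (a b : Side K M) {α : Type*} [MeasurableSpace α] {x p q : α → ℝ}
    (hx : Measurable x) (hp : Measurable p) (hq : Measurable q) :
    Measurable fun w => (⟨x w, y, a, b, p w, q w⟩ : Book K M) :=
  (Book.measurableEquivProd K M).symm.measurable.comp
    (f := fun w => ((x w, p w, q w), (y, a, b)))
    ((hx.prodMk (hp.prodMk hq)).prodMk measurable_const)

end Measurable

/-! ## The model -/

/-- The data of the market making problem: horizon, boundary conditions of the book, intensities of
the exogenous events (functions of the numbers of shares on the ask and bid sides), running and
terminal rewards. -/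
structure Model (K M : ℕ) where
  T : ℝ
  ainf : ℕ
  binf : ℕ
  lam : Event K → (Fin K → ℕ) → (Fin K → ℕ) → ℝ≥0
  f : Book K M → Action M → ℝ
  g : Book K M → ℝ

namespace Model

variable {K M : ℕ} (m : Model K M)

/-- The intensities are at most linear in `|a| + |b|`. -/
def LinearIntensities : Prop :=
  ∃ cL cC cM : ℝ, ∀ a b : Fin K → ℕ,
    (∀ s, ∑ i, (m.lam (s, .limit i) a b : ℝ) ≤ cL * size a b) ∧
    (∀ s, ∑ i, (m.lam (s, .cancel i) a b : ℝ) ≤ cC * size a b) ∧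
    ((m.lam (.ask, .market) a b : ℝ) + m.lam (.bid, .market) a b ≤ cM * size a b)

/-- The running and terminal rewards have at most quadratic growth in the state, uniformly in the
control. -/
def QuadraticRewards : Prop :=
  (∃ c, 0 < c ∧ ∀ z, ∀ a ∈ z.admissible, |m.f z a| ≤ c * (1 + z.normSq)) ∧
    ∃ c, 0 < c ∧ ∀ z, |m.g z| ≤ c * (1 + z.normSq)

/-- The total intensity `λ(z)` of the exogenous events. -/
noncomputable def rate (z : Book K M) : ℝ≥0 := ∑ e : Event K, m.lam e z.ask.vol z.bid.vol

/-- `Q'(· | z, c)`: the law of the state right after the next event, when the decision `c` is taken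
in the state `z`. The event `e` has probability `λ_e(z) / λ(z)`, and a cancellation concerns each of
the orders of the general participants in the queue with the same probability. -/
noncomputable def jumpGoal (z : Book K M) (c : Action M) : Measure (Book K M) :=
  ∑ e : Event K, ((m.lam e z.ask.vol z.bid.vol / m.rate z : ℝ≥0) : ℝ≥0∞) •
    ∑ u ∈ Finset.range ((z.place c).marks e),
      (((z.place c).marks e : ℝ≥0∞))⁻¹ • Measure.dirac ((z.place c).jump m.ainf m.binf e u)

/-- The state space `[0,T] × E` of the Markov decision process. -/
abbrev TState : Type := Set.Icc (0 : ℝ) m.T × Book K M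

/-- The law of the next jump time, restricted to `[0,T]`: density `λ e^{-λ(u-t)}` on `(t,T]`. -/
noncomputable def jumpTime (p : m.TState) : Measure (Set.Icc (0 : ℝ) m.T) :=
  (Measure.comap ((↑) : Set.Icc (0 : ℝ) m.T → ℝ) volume).withDensity fun u =>
    if p.1 < u then
      ENNReal.ofReal (m.rate p.2 * Real.exp (-(m.rate p.2 * ((u : ℝ) - p.1)))) else 0

/-- The transition kernel `Q(· | t, z, c)` on `[0,T] × E`. Its total mass is the probability that a
jump occurs before the horizon. -/
noncomputable def Q (p : m.TState) (c : Action M) : Measure m.TState :=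
  (m.jumpTime p).prod (m.jumpGoal p.2 c)

/-- `[0,T] × E` and a cemetery point, reached when no further jump occurs before the horizon. -/
abbrev XState : Type := m.TState ⊕ Unit

/-- One step of the chain: from `(t,z)` with decision `c`, jump according to `Q(· | t,z,c)`; with the
remaining probability `e^{-λ(z)(T-t)}` there is no jump before `T`. -/
noncomputable def step (p : m.TState) (c : Action M) : Measure m.XState :=
  (m.Q p c).map Sum.inl +
    ENNReal.ofReal (Real.exp (-(m.rate p.2 * (m.T - p.1)))) • Measure.dirac (Sum.inr ())

noncomputable def stepX (x : m.XState) (c : Action M) : Measure m.XState :=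
  match x with
  | .inl p => m.step p c
  | .inr _ => Measure.dirac (Sum.inr ())

/-! ### `stepX` is a Markov kernel -/

theorem measurable_rate : Measurable m.rate :=
  measurable_of_fibers fun y a b =>
    (measurable_const : Measurable fun _ => m.rate (⟨0, y, a, b, 0, 0⟩ : Book K M))

theorem measurable_jump (e : Event K) (u : ℕ) :
    Measurable fun z : Book K M => z.jump m.ainf m.binf e u := by
  refine measurable_of_fibers fun y a b => ?_
  rcases e with ⟨s, o⟩
  rcases s with _ | _ <;> rcases o with _ | i | i <;>
  · simp only [Book.jump, Book.react, Book.side]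
    apply measurable_mk <;> fun_prop

theorem measurable_place (c : Action M) : Measurable fun z : Book K M => z.place c := by
  refine measurable_of_fibers fun y a b => ?_
  simp only [Book.place]
  apply measurable_mk <;> fun_prop

theorem measurable_jumpGoal :
    Measurable fun q : m.TState × Action M => m.jumpGoal q.1.2 q.2 := by
  refine measurable_from_prod_countable_left fun c => ?_
  have h : Measurable fun z : Book K M => m.jumpGoal z c := by
    refine Measure.measurable_of_measurable_coe _ fun s hs => ?_
    refine measurable_of_fibers fun y a b => ?_
    have h1 : ∀ e u, Measurable fun q : ℝ × ℝ × ℝ =>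
        Measure.dirac (((⟨q.1, y, a, b, q.2.1, q.2.2⟩ : Book K M).place c).jump
          m.ainf m.binf e u) s := fun e u =>
      (Measure.measurable_coe hs).comp (Measure.measurable_dirac.comp
        ((m.measurable_jump e u).comp ((measurable_place c).comp
          (measurable_mk y a b (by fun_prop) (by fun_prop) (by fun_prop)))))
    have h2 : ∀ (e : Event K) (q : ℝ × ℝ × ℝ),
        ((⟨q.1, y, a, b, q.2.1, q.2.2⟩ : Book K M).place c).marks e =
          ((⟨0, y, a, b, 0, 0⟩ : Book K M).place c).marks e := by
      rintro ⟨_ | _, _ | _ | _⟩ q <;> rfl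
    have h3 : ∀ q : ℝ × ℝ × ℝ, m.rate (⟨q.1, y, a, b, q.2.1, q.2.2⟩ : Book K M) =
        m.rate (⟨0, y, a, b, 0, 0⟩ : Book K M) := fun _ => rfl
    simp only [jumpGoal, Measure.coe_finsetSum, Finset.sum_apply, Measure.smul_apply, smul_eq_mul,
      h2, h3]
    fun_prop (disch := exact h1 _ _)
  exact h.comp measurable_snd

instance : IsFiniteMeasure (Measure.comap ((↑) : Set.Icc (0 : ℝ) m.T → ℝ) volume) := by
  refine ⟨?_⟩
  rw [(MeasurableEmbedding.subtype_coe measurableSet_Icc).comap_apply, Set.image_univ,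
    Subtype.range_coe_subtype]
  exact measure_Icc_lt_top

theorem measurable_jumpTime : Measurable fun q : m.TState × Action M => m.jumpTime q.1 := by
  have hd : Measurable (Function.uncurry fun (p : m.TState) (u : Set.Icc (0 : ℝ) m.T) =>
      if p.1 < u then
        ENNReal.ofReal (m.rate p.2 * Real.exp (-(m.rate p.2 * ((u : ℝ) - p.1)))) else 0) := by
    have hr : Measurable fun q : m.TState × Set.Icc (0 : ℝ) m.T => (m.rate q.1.2 : ℝ) :=
      (m.measurable_rate.comp (measurable_snd.comp measurable_fst)).coe_nnreal_real
    refine Measurable.ite (measurableSet_lt (by fun_prop) (by fun_prop)) ?_ measurable_const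
    fun_prop
  have h : Measurable m.jumpTime := by
    refine Measure.measurable_of_measurable_coe _ fun s hs => ?_
    simp only [jumpTime, withDensity_apply _ hs]
    exact hd.lintegral_prod_right'
  exact h.comp measurable_fst

theorem jumpGoal_univ (z : Book K M) (c : Action M) (h : m.rate z ≠ 0) :
    m.jumpGoal z c Set.univ = 1 := by
  have hm : ∀ e, (((z.place c).marks e : ℕ) : ℝ≥0∞) ≠ 0 := by
    rintro ⟨_ | _, _ | _ | i⟩ <;> simp [Book.marks]
  have h1 : ∀ e : Event K, (((z.place c).marks e : ℕ) : ℝ≥0∞) *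
      (((z.place c).marks e : ℕ) : ℝ≥0∞)⁻¹ = 1 := fun e =>
    ENNReal.mul_inv_cancel (hm e) (ENNReal.natCast_ne_top _)
  simp only [jumpGoal, Measure.coe_finsetSum, Finset.sum_apply, Measure.smul_apply, smul_eq_mul,
    measure_univ, mul_one, Finset.sum_const, Finset.card_range, nsmul_eq_mul, h1]
  rw [← ENNReal.ofNNReal_finsetSum, ← Finset.sum_div]
  simp only [ENNReal.coe_eq_one]
  exact div_self h

theorem jumpTime_univ (p : m.TState) :
    m.jumpTime p Set.univ = ENNReal.ofReal (1 - Real.exp (-(m.rate p.2 * (m.T - p.1)))) := by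
  obtain ⟨⟨t, ht0, htT⟩, z⟩ := p
  generalize hl : (m.rate z : ℝ) = l
  have hl0 : 0 ≤ l := hl ▸ (m.rate z).2
  have hc : Continuous fun u : ℝ => l * Real.exp (-(l * (u - t))) := by fun_prop
  have h1 : ∫ u in t..m.T, l * Real.exp (-(l * (u - t))) = 1 - Real.exp (-(l * (m.T - t))) := by
    rw [intervalIntegral.integral_eq_sub_of_hasDerivAt
      (f := fun u => - Real.exp (-(l * (u - t)))) _ (hc.intervalIntegrable _ _)]
    · simp only [sub_self, mul_zero, neg_zero, Real.exp_zero]; ring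
    · intro u _
      have h : HasDerivAt (fun u => -(l * (u - t))) (-(l * 1)) u :=
        (((hasDerivAt_id u).sub_const t).const_mul l).neg
      have h' : HasDerivAt (fun u => -Real.exp (-(l * (u - t))))
        (-(Real.exp (-(l * (u - t))) * -(l * 1))) u := h.exp.neg
      exact h'.congr_deriv (by ring)
  have h2 : ∀ u : ℝ, (if t < u then ENNReal.ofReal (l * Real.exp (-(l * (u - t)))) else 0) =
      (Set.Ioi t).indicator (fun u => ENNReal.ofReal (l * Real.exp (-(l * (u - t))))) u := by
    intro u; simp [Set.indicator_apply]
  have h3 : Set.Icc 0 m.T ∩ Set.Ioi t = Set.Ioc t m.T := by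
    ext u; simp only [Set.mem_inter_iff, Set.mem_Icc, Set.mem_Ioi, Set.mem_Ioc]
    constructor
    · rintro ⟨⟨_, h⟩, h'⟩; exact ⟨h', h⟩
    · rintro ⟨h', h⟩; exact ⟨⟨ht0.trans h'.le, h⟩, h'⟩
  rw [jumpTime, withDensity_apply _ MeasurableSet.univ, Measure.restrict_univ]
  simp only [hl, ← Subtype.coe_lt_coe]
  rw [lintegral_subtype_comap measurableSet_Icc
    (fun u : ℝ => if t < u then ENNReal.ofReal (l * Real.exp (-(l * (u - t)))) else 0)]
  simp only [h2]
  rw [setLIntegral_indicator measurableSet_Ioi, Set.inter_comm, h3, ← h1,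
    intervalIntegral.integral_of_le htT, ofReal_integral_eq_lintegral_ofReal]
  · exact (hc.integrableOn_Icc).mono_set Set.Ioc_subset_Icc_self
  · exact Filter.Eventually.of_forall fun u => mul_nonneg hl0 (Real.exp_pos _).le

theorem jumpGoal_univ_le (z : Book K M) (c : Action M) : m.jumpGoal z c Set.univ ≤ 1 := by
  by_cases h : m.rate z = 0
  · simp [jumpGoal, h]
  · exact (m.jumpGoal_univ z c h).le

theorem jumpTime_univ_le (p : m.TState) : m.jumpTime p Set.univ ≤ 1 := by
  rw [jumpTime_univ, ← ENNReal.ofReal_one]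
  exact ENNReal.ofReal_le_ofReal (by linarith [Real.exp_pos (-(m.rate p.2 * (m.T - p.1)))])

instance (z : Book K M) (c : Action M) : IsFiniteMeasure (m.jumpGoal z c) :=
  ⟨(m.jumpGoal_univ_le z c).trans_lt ENNReal.one_lt_top⟩

instance (p : m.TState) : IsFiniteMeasure (m.jumpTime p) :=
  ⟨(m.jumpTime_univ_le p).trans_lt ENNReal.one_lt_top⟩

theorem measurable_Q : Measurable fun q : m.TState × Action M => m.Q q.1 q.2 := by
  let k₁ : Kernel (m.TState × Action M) (Set.Icc (0 : ℝ) m.T) := ⟨_, m.measurable_jumpTime⟩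
  let k₂ : Kernel (m.TState × Action M) (Book K M) := ⟨_, m.measurable_jumpGoal⟩
  have : IsFiniteKernel k₁ := ⟨1, ENNReal.one_lt_top, fun q => m.jumpTime_univ_le q.1⟩
  have : IsFiniteKernel k₂ := ⟨1, ENNReal.one_lt_top, fun q => m.jumpGoal_univ_le q.1.2 q.2⟩
  have h := (k₁ ×ₖ k₂).measurable
  convert h using 2 with q
  rw [Kernel.prod_apply]
  rfl

theorem measurable_stepX : Measurable fun q : m.XState × Action M => m.stepX q.1 q.2 := by
  have h : Measurable (Sum.elim (fun q : m.TState × Action M => m.step q.1 q.2)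
      (fun _ : Unit × Action M => (Measure.dirac (Sum.inr ()) : Measure m.XState))) := by
    refine Measurable.sumElim ?_ measurable_const
    refine Measure.measurable_of_measurable_coe _ fun s hs => ?_
    have hr : Measurable fun q : m.TState × Action M => (m.rate q.1.2 : ℝ) :=
      (m.measurable_rate.comp (measurable_snd.comp measurable_fst)).coe_nnreal_real
    simp only [step, Measure.add_apply, Measure.smul_apply, smul_eq_mul,
      Measure.map_apply measurable_inl hs]
    refine Measurable.add ?_ ?_
    · exact (Measure.measurable_coe (measurable_inl hs)).comp m.measurable_Q
    · fun_prop
  have h2 := h.comp (MeasurableEquiv.sumProdDistrib m.TState Unit (Action M)).measurable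
  convert h2 using 1
  funext ⟨x, c⟩
  rcases x with p | u <;> rfl

theorem isProbabilityMeasure_stepX (x : m.XState) (c : Action M) :
    IsProbabilityMeasure (m.stepX x c) := by
  rcases x with p | u
  · refine ⟨?_⟩
    simp only [stepX, step, Measure.add_apply, Measure.smul_apply, smul_eq_mul,
      Measure.map_apply measurable_inl MeasurableSet.univ, Set.preimage_univ, measure_univ, mul_one,
      Q]
    rw [← Set.univ_prod_univ, Measure.prod_prod]
    have hT : 0 ≤ m.T - p.1 := sub_nonneg.2 p.1.2.2
    by_cases h : m.rate p.2 = 0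
    · simp [jumpGoal, h]
    · rw [m.jumpGoal_univ _ _ h, mul_one, jumpTime_univ, ← ENNReal.ofReal_add]
      · simp
      · simp only [sub_nonneg, Real.exp_le_one_iff, neg_nonpos]
        positivity
      · positivity
  · exact inferInstanceAs (IsProbabilityMeasure (Measure.dirac _))

/-! ## Strategies and the controlled process -/

/-- The histories `(T₀, Z₀, …, Tₙ, Zₙ)`. -/
abbrev Hist (n : ℕ) : Type := Finset.Iic n → m.XState

/-- An admissible strategy of the market maker: the decision taken at the `n`-th jump time, and kept
until the next one, is an admissible action that depends measurably on the history up to then. -/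
structure Strategy where
  act : ∀ n, m.Hist n → Action M
  measurable_act : ∀ n, Measurable (act n)
  admissible : ∀ n (h : m.Hist n) (p : m.TState),
    h ⟨n, Finset.mem_Iic.2 le_rfl⟩ = Sum.inl p → act n h ∈ p.2.admissible

/-- A decision function `f : [0,T] × E → A`. -/
structure DecisionRule where
  act : m.TState → Action M
  measurable_act : Measurable act
  admissible : ∀ p, act p ∈ p.2.admissible

/-- A policy of the Markov decision process: a sequence `(f₀, f₁, …)` of decision functions. -/
abbrev Policy : Type := ℕ → m.DecisionRule

/-- The strategy given by a policy: the decision at the `n`-th jump is `fₙ(Tₙ, Zₙ)`. (The value at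
the cemetery plays no role.) -/
def Policy.toStrategy {m : Model K M} (F : m.Policy) : m.Strategy where
  act n h := Sum.elim (F n).act (fun _ => (fun _ => -1, fun _ => -1))
    (h ⟨n, Finset.mem_Iic.2 le_rfl⟩)
  measurable_act n :=
    (Measurable.sumElim (F n).measurable_act measurable_const).comp (measurable_pi_apply _)
  admissible n h p hp := by
    simp only [hp, Sum.elim_inl]
    exact (F n).admissible p

/-- The conditional law of the `(n+1)`-th state given the history. -/
noncomputable def kernel (π : m.Strategy) (n : ℕ) : Kernel (m.Hist n) m.XState where
  toFun h := m.stepX (h ⟨n, Finset.mem_Iic.2 le_rfl⟩) (π.act n h)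
  measurable' := m.measurable_stepX.comp
    (f := fun h : m.Hist n => (h ⟨n, Finset.mem_Iic.2 le_rfl⟩, π.act n h))
    ((measurable_pi_apply _).prodMk (π.measurable_act n))

instance (π : m.Strategy) (n : ℕ) : IsMarkovKernel (m.kernel π n) :=
  ⟨fun _ => m.isProbabilityMeasure_stepX _ _⟩

/-- The law, under the strategy `π`, of the sequence `(Tₙ, Zₙ)` of the jump times and states of the
order book started at `p = (t,z)` (with value the cemetery if there are less than `n` jumps up to
`T`). -/
noncomputable def law (π : m.Strategy) (p : m.TState) : Measure (ℕ → m.XState) :=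
  Kernel.traj (X := fun _ => m.XState) (m.kernel π) 0 (fun _ => Sum.inl p)

/-! ## The market making problem in continuous time -/

/-- The number of jumps up to the time `s`: the first `n` such that the `(n+1)`-th jump, if there is
any, is after `s`. -/
noncomputable def jumpCount (ω : ℕ → m.XState) (s : ℝ) : ℕ :=
  sInf {n | ∀ q : m.TState, ω (n + 1) = Sum.inl q → s < q.1}

/-- The decision in force at the time `s`. -/
noncomputable def control (π : m.Strategy) (ω : ℕ → m.XState) (s : ℝ) : Action M :=
  π.act (m.jumpCount ω s) fun i => ω i

/-- `k` evaluated at the state `Z_s = φ^{α_s}(Z_n)`, `n` being the number of jumps up to `s`. -/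
noncomputable def evalAt (π : m.Strategy) (ω : ℕ → m.XState) (s : ℝ) (k : Book K M → ℝ) : ℝ :=
  match ω (m.jumpCount ω s) with
  | .inl q => k (q.2.place (m.control π ω s))
  | .inr _ => 0

/-- `∫ₜᵀ f(Z_s, α_s) ds + g(Z_T)`. -/
noncomputable def gain (π : m.Strategy) (p : m.TState) (ω : ℕ → m.XState) : ℝ :=
  (∫ s in (p.1 : ℝ)..m.T, m.evalAt π ω s fun z => m.f z (m.control π ω s))
    + m.evalAt π ω m.T m.g

/-- The expected gain of the strategy `π` from `p = (t,z)`. -/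
noncomputable def expectedGain (π : m.Strategy) (p : m.TState) : ℝ :=
  ∫ ω, m.gain π p ω ∂(m.law π p)

/-- The value function `V` of the market making problem. -/
noncomputable def V (p : m.TState) : ℝ := ⨆ π : m.Strategy, m.expectedGain π p

/-! ## The Markov decision process -/

/-- `(1 - e^{-λτ}) / λ`, read as `τ` for `λ = 0`: the mean of `min(τ, S)` for `S` exponential. -/
noncomputable def meanSojourn (l τ : ℝ) : ℝ :=
  if l = 0 then τ else 1 / l - Real.exp (-(l * τ)) / l

/-- The one-stage reward `r(t,z,c)`. -/
noncomputable def r (p : m.TState) (c : Action M) : ℝ :=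
  m.f (p.2.place c) c * meanSojourn (m.rate p.2) (m.T - p.1)
    + Real.exp (-(m.rate p.2 * (m.T - p.1))) * m.g (p.2.place c)

/-- The reward `r(Tₙ, Zₙ, fₙ(Tₙ, Zₙ))`, zero when the horizon has been reached before. -/
noncomputable def stageReward (F : m.Policy) (n : ℕ) (ω : ℕ → m.XState) : ℝ :=
  Sum.elim (fun q => m.r q ((F n).act q)) (fun _ => 0) (ω n)

/-- The cumulated reward functional of the policy `F`. -/
noncomputable def mdpReward (F : m.Policy) (p : m.TState) : ℝ :=
  ∫ ω, ∑' n, m.stageReward F n ω ∂(m.law F.toStrategy p)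

/-- The value function `V_∞` of the Markov decision process. -/
noncomputable def Vinf (p : m.TState) : ℝ := ⨆ F : m.Policy, m.mdpReward F p

/-- `r(t,z,c) + ∫ v dQ(· | t,z,c)`. -/
noncomputable def actionValue (v : m.TState → ℝ) (p : m.TState) (c : Action M) : ℝ :=
  m.r p c + ∫ q, v q ∂(m.Q p c)

/-- The maximal reward operator. -/
noncomputable def bellman (v : m.TState → ℝ) (p : m.TState) : ℝ :=
  ⨆ c : p.2.admissible, m.actionValue v p c

/-- `f` is a maximizer of the maximal reward operator at `v`. -/
def IsMaximizer (v : m.TState → ℝ) (F : m.DecisionRule) : Prop :=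
  ∀ p, m.actionValue v p (F.act p) = m.bellman v p

/-! ## The weighted norm -/

/-- `Λ`, `4 K + 2` times the supremum of the intensities divided by `|a| + |b|`. -/
noncomputable def Lam : ℝ :=
  (4 * K + 2) * ⨆ q : Event K × (Fin K → ℕ) × (Fin K → ℕ),
    (m.lam q.1 q.2.1 q.2.2 : ℝ) / size q.2.1 q.2.2

/-- The bounding function `b(t,z) = (1 + |z|²) e^{γ(z)(T-t)}` with
`γ(z) = γ₀ (4 K + 2) Λ (1 + |a| + |b|)`. -/
noncomputable def bound (γ₀ : ℝ) (p : m.TState) : ℝ :=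
  (1 + p.2.normSq) * Real.exp
    (γ₀ * (4 * K + 2) * m.Lam * (1 + size p.2.ask.vol p.2.bid.vol) * (m.T - p.1))

/-- The measurable functions with finite weighted supremum norm. -/
def weightedSpace (γ₀ : ℝ) : Set (m.TState → ℝ) :=
  {v | Measurable v ∧ BddAbove (Set.range fun p => |v p| / m.bound γ₀ p)}

end Model

end LOB

namespace LOB

/-! ## One-step growth of the order book -/

section Growth

variable {K M : ℕ}

/-! The intensities are unbounded, so everything rests on a good weight. One decision followed by
one event moves prices, inventory and number of shares by at most a constant, cash by a multiple of
the prices, and ranks by at most the number of shares plus a constant (`Book.Near`). This triangular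
structure gives, for each ε > 0, a quadratic function `Book.growth`, comparable to 1 + |z|², that no
step multiplies by more than 1 + ε (`Book.exists_growth_le`).

Multiply it by e^{ρ(t)(1 + |a| + |b|)} with ρ decreasing in time. Jumps occur at rate at most Λ(|a|
+ |b|), and the decay of the exponent while waiting for a jump compensates both the factor 1 + ε and
the shares added by the jump. An integration in the jump time (`Model.lintegral_weight_le`) makes
this precise; with ρ the solution of a linear differential equation and ε small, the weight W
contracts by 1/(1 + ε) and stays below a multiple of b, whatever γ₀ (`Model.exists_isLyapunov`). The
maximal reward operator is then a contraction for the norm weighted by W, which yields a fixed point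
v in a space contained in 𝔹_b.

The contraction for W does not give uniqueness in all of 𝔹_b, since only W ≤ D b is known.
Uniqueness is proved backwards in time: on slabs whose length does not depend on the slab, a steeper
exponent gives a contraction by 1/2, and the kernel only looks forward, so agreement after θ
propagates to times before θ (`Model.eq_of_bellman_eq_of_lt`).

Verification is telescoping. Under any strategy, E v(Tₙ, Zₙ) tends to zero geometrically because E
W(Tₙ, Zₙ) ≤ κⁿ W, so total rewards are at most v, with equality for maximizers; these exist
measurably because the admissible sets are finite and the action space is countable.
History-dependent strategies are covered by the same computation. Since W ≥ 1, summability of E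
W(Tₙ, Zₙ) also shows that almost surely only finitely many jumps occur before T. Pathwise, the
continuous-time gain is then a sum over the intervals between jumps, whose conditional means are the
one-stage rewards r (`Model.integral_cost`). Hence both problems have value v. -/

theorem best_le (v : Fin K → ℕ) : best v ≤ K + 1 := Nat.find_min' _ (Or.inr rfl)

theorem one_le_best (v : Fin K → ℕ) : 1 ≤ best v := by
  rcases Nat.find_spec (p := fun n => (∃ i : Fin K, n = (i : ℕ) + 1 ∧ 0 < v i) ∨ n = K + 1)
    ⟨K + 1, Or.inr rfl⟩ with ⟨i, hi, -⟩ | h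
  · exact Nat.succ_le_of_lt (by rw [best, hi]; omega)
  · exact Nat.succ_le_of_lt (by rw [best, h]; omega)

theorem abs_best_sub_best_le (v w : Fin K → ℕ) : |(best v : ℤ) - best w| ≤ K := by
  have h1 := best_le v
  have h2 := best_le w
  have h3 := one_le_best v
  have h4 := one_le_best w
  rw [abs_le]
  omega

/-- Writing the entry as a sum of indicators over the old limits makes it possible to exchange sums
when a whole side is shifted. -/
theorem volAt_le (v : Fin K → ℕ) (vinf : ℕ) (l : ℤ) :
    volAt v vinf l ≤ vinf + ∑ k : Fin K, if (k : ℤ) + 1 = l then v k else 0 := by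
  unfold volAt
  split_ifs with h1 h2
  · exact Nat.zero_le _
  · have h3 : (((l - 1).toNat : ℕ) : ℤ) + 1 = l := by omega
    have := Finset.single_le_sum (f := fun k : Fin K => if (k : ℤ) + 1 = l then v k else 0)
      (fun _ _ => Nat.zero_le _) (Finset.mem_univ ⟨(l - 1).toNat, h2⟩)
    simp only [h3, if_true] at this
    omega
  · omega

theorem volAt_zero_le (v : Fin K → ℕ) (l : ℤ) : volAt v 0 l ≤ ∑ k, v k := by
  refine (volAt_le v 0 l).trans ?_
  rw [zero_add]
  refine Finset.sum_le_sum fun k _ => ?_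
  split_ifs <;> simp

/-- A shift is injective, so each old limit is counted at most once; every vacant limit contributes
at most the boundary volume. -/
theorem sum_volAt_le (v : Fin K → ℕ) (vinf : ℕ) (d : ℤ) :
    ∑ i : Fin K, volAt v vinf ((i : ℤ) + 1 - d) ≤ K * vinf + ∑ k, v k := by
  refine (Finset.sum_le_sum fun i _ => volAt_le v vinf _).trans ?_
  rw [Finset.sum_add_distrib, Finset.sum_comm]
  simp only [Finset.sum_const, Finset.card_univ, Fintype.card_fin, smul_eq_mul]
  gcongr with k
  rw [← Finset.sum_filter, Finset.sum_const, smul_eq_mul]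
  refine (Nat.mul_le_mul_right _ (?_ : _ ≤ 1)).trans_eq (one_mul _)
  refine Finset.card_le_one.2 fun i hi j hj => ?_
  simp only [Finset.mem_filter, Finset.mem_univ, true_and] at hi hj
  ext
  omega

theorem card_filter_fin_le (P : Fin M → Prop) [DecidablePred P] :
    (Finset.univ.filter P).card ≤ M :=
  (Finset.card_le_univ _).trans_eq (Fintype.card_fin M)

namespace Side

/-- The side `t` results from `s` by an order of a general participant: one more share at most,
orders of the market maker kept or withdrawn, and ranks changed by at most one. -/
structure Close (s t : Side K M) : Prop where
  vol : ∑ i, t.vol i ≤ ∑ i, s.vol i + 1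
  pos : ∀ j, t.pos j = s.pos j ∨ t.pos j = -1
  rank : ∀ j, |t.rank j| ≤ |s.rank j| + 1

theorem close_limitOrder (s : Side K M) (i : Fin K) : s.Close (s.limitOrder i) where
  vol := by
    have : ∀ k, (s.limitOrder i).vol k = s.vol k + if k = i then 1 else 0 := fun k => by
      simp only [limitOrder]; split_ifs <;> rfl
    simp [this, Finset.sum_add_distrib]
  pos j := Or.inl rfl
  rank j := by simp [limitOrder]

theorem close_cancelOrder (s : Side K M) (i : Fin K) (u : ℕ) : s.Close (s.cancelOrder i u) := by
  unfold cancelOrder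
  split_ifs with h
  · exact ⟨by omega, fun j => Or.inl rfl, fun j => by omega⟩
  · refine ⟨Nat.le_succ_of_le (Finset.sum_le_sum fun k _ => ?_), fun j => Or.inl rfl, fun j => ?_⟩
    · dsimp only; split_ifs <;> omega
    · dsimp only; split_ifs <;> grind

theorem close_marketOrder (s : Side K M) : s.Close s.marketOrder where
  vol := by
    refine Nat.le_succ_of_le (Finset.sum_le_sum fun k _ => ?_)
    simp only [marketOrder]; split_ifs <;> omega
  pos j := by simp only [marketOrder]; split_ifs <;> simp
  rank j := by simp only [marketOrder]; split_ifs <;> grind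

theorem shift_pos (s : Side K M) (vinf : ℕ) (d : ℤ) (j : Fin M) :
    |(s.shift vinf d).pos j| ≤ K + 1 := by
  simp only [shift]
  split_ifs with h
  · rw [abs_le]; omega
  · simp

theorem shift_rank (s : Side K M) (vinf : ℕ) (d : ℤ) (j : Fin M) :
    |(s.shift vinf d).rank j| ≤ |s.rank j| + 1 := by
  simp only [shift]
  split_ifs <;> grind

/-- A kept order moves up by at most `M` places. A moved one stands behind the volume of its limit
and at most `2 * M` orders of the market maker. -/
theorem place_rank (s : Side K M) (c : Fin M → ℤ) (j : Fin M) :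
    |(s.place c).rank j| ≤ |s.rank j| + ∑ i, s.vol i + (2 * M + 1) := by
  have h0 := abs_nonneg (s.rank j)
  simp only [place]
  split_ifs with h1 h2
  · simp only [abs_neg, abs_one]; omega
  · have h3 := card_filter_fin_le
      fun k => ¬ s.kept c k ∧ s.pos k = s.pos j ∧ s.rank k < s.rank j
    grind
  · have h3 := card_filter_fin_le fun k => c k = c j ∧ s.kept c k
    have h4 := card_filter_fin_le fun k => c k = c j ∧ ¬ s.kept c k ∧ k < j
    have h5 := volAt_zero_le s.vol (c j)
    rw [abs_of_nonneg (by positivity)]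
    omega

end Side

/-! ### Increment bounds for the whole book -/

namespace Book

/-- `|a| + |b|` as a real number. -/
noncomputable def shares (z : Book K M) : ℝ := size z.ask.vol z.bid.vol

theorem shares_nonneg (z : Book K M) : 0 ≤ z.shares := Nat.cast_nonneg _

/-- The growth of a state by at most one step of the dynamics, up to the constant `B`. -/
structure Near (B : ℝ) (z w : Book K M) : Prop where
  pa : |w.pa| ≤ |z.pa| + B
  pb : |w.pb| ≤ |z.pb| + B
  y : |(w.y : ℝ)| ≤ |(z.y : ℝ)| + B
  shares : w.shares ≤ z.shares + B
  x : |w.x| ≤ |z.x| + B * (|z.pa| + |z.pb|)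
  ask_pos : ∀ j, |(w.ask.pos j : ℝ)| ≤ B
  bid_pos : ∀ j, |(w.bid.pos j : ℝ)| ≤ B
  ask_rank : ∀ j, |(w.ask.rank j : ℝ)| ≤ |(z.ask.rank j : ℝ)| + z.shares + B
  bid_rank : ∀ j, |(w.bid.rank j : ℝ)| ≤ |(z.bid.rank j : ℝ)| + z.shares + B

theorem abs_admissible_le (z : Book K M) {c : Action M} (hc : c ∈ z.admissible) :
    (∀ j, |c.1 j| ≤ (K : ℤ) + 1) ∧ ∀ j, |c.2 j| ≤ (K : ℤ) + 1 := by
  have h1 := one_le_best z.ask.vol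
  refine ⟨fun j => ?_, fun j => ?_⟩
  · rcases hc.1 j with h | h <;> rw [abs_le] <;> omega
  · rcases hc.2 j with h | h <;> rw [abs_le] <;> omega

theorem place_ask_rank_le (z : Book K M) (c : Action M) (j : Fin M) :
    (|(z.place c).ask.rank j| : ℤ) ≤ |z.ask.rank j| + size z.ask.vol z.bid.vol + (2 * M + 1) := by
  have h := z.ask.place_rank c.1 j
  have h1 : (0 : ℤ) ≤ ∑ i, (z.bid.vol i : ℤ) := Finset.sum_nonneg fun _ _ => by positivity
  simp only [size, Nat.cast_add, Nat.cast_sum, place] at h ⊢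
  omega

theorem place_bid_rank_le (z : Book K M) (c : Action M) (j : Fin M) :
    (|(z.place c).bid.rank j| : ℤ) ≤ |z.bid.rank j| + size z.ask.vol z.bid.vol + (2 * M + 1) := by
  have h := z.bid.place_rank c.2 j
  have h1 : (0 : ℤ) ≤ ∑ i, (z.ask.vol i : ℤ) := Finset.sum_nonneg fun _ _ => by positivity
  simp only [size, Nat.cast_add, Nat.cast_sum, place] at h ⊢
  omega

/-- The decision overwrites all positions by admissible ones, which is why the bounds on positions
in `Near` do not involve the old state. -/
theorem near_place (z : Book K M) {c : Action M} (hc : c ∈ z.admissible) {B : ℝ}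
    (hB : (K : ℝ) + 2 * M + 1 ≤ B) : Near B z (z.place c) := by
  have hK : (0 : ℝ) ≤ K := Nat.cast_nonneg _
  have hM : (0 : ℝ) ≤ M := Nat.cast_nonneg _
  have hB0 : 0 ≤ B := by linarith
  obtain ⟨h1, h2⟩ := z.abs_admissible_le hc
  refine ⟨?_, ?_, ?_, ?_, ?_, fun j => ?_, fun j => ?_, fun j => ?_, fun j => ?_⟩
  · simpa [place] using hB0
  · simpa [place] using hB0
  · simpa [place] using hB0
  · simpa [place, Book.shares, Side.place] using hB0
  · simp only [place, le_add_iff_nonneg_right]; positivity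
  · have : (|(c.1 j : ℝ)|) ≤ K + 1 := by exact_mod_cast h1 j
    exact this.trans (by linarith)
  · have : (|(c.2 j : ℝ)|) ≤ K + 1 := by exact_mod_cast h2 j
    exact this.trans (by linarith)
  · have : |((z.place c).ask.rank j : ℝ)| ≤ |(z.ask.rank j : ℝ)| + z.shares + (2 * M + 1) := by
      unfold Book.shares
      exact_mod_cast z.place_ask_rank_le c j
    linarith
  · have : |((z.place c).bid.rank j : ℝ)| ≤ |(z.bid.rank j : ℝ)| + z.shares + (2 * M + 1) := by
      unfold Book.shares
      exact_mod_cast z.place_bid_rank_le c j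
    linarith

/-- In `B`, the term `K * (ainf + binf)` pays for refilling the frame, `K` for the move of the best
limit, and the multiple of `M` for executed orders and changes of ranks. -/
theorem near_react_place (ainf binf : ℕ) (z : Book K M) {c : Action M} (hc : c ∈ z.admissible)
    (s : BookSide) (new : Side K M) (n : ℕ) (hn : n ≤ M) (hnew : ((z.place c).side s).Close new)
    {B : ℝ} (hB : (K : ℝ) * (ainf + binf) + K + 2 * M + 2 ≤ B) :
    Near B z ((z.place c).react ainf binf s new n) := by
  have hK : (0 : ℝ) ≤ K := Nat.cast_nonneg _
  have hM : (0 : ℝ) ≤ M := Nat.cast_nonneg _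
  have ha : (0 : ℝ) ≤ K * ainf := by positivity
  have hb : (0 : ℝ) ≤ K * binf := by positivity
  have hn' : (n : ℝ) ≤ M := by exact_mod_cast hn
  have hn0 : (0 : ℝ) ≤ n := Nat.cast_nonneg _
  rw [mul_add] at hB
  have hB0 : 0 ≤ B := by linarith
  obtain ⟨h1, h2⟩ := z.abs_admissible_le hc
  have hpos : ∀ t : Side K M, (∀ j, |t.pos j| ≤ (K : ℤ) + 1) → ∀ j, |(t.pos j : ℝ)| ≤ B :=
    fun t ht j => by
      have : (|(t.pos j : ℝ)|) ≤ K + 1 := by exact_mod_cast ht j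
      linarith
  -- The decision costs `2 * M + 1` and the event one more.
  have hrank : ∀ t u : Side K M, (∀ j, |t.rank j| ≤
      |u.rank j| + size z.ask.vol z.bid.vol + (2 * M + 2)) →
      ∀ j, |(t.rank j : ℝ)| ≤ |(u.rank j : ℝ)| + z.shares + B := fun t u ht j => by
    have : |(t.rank j : ℝ)| ≤ |(u.rank j : ℝ)| + z.shares + (2 * M + 2) := by
      unfold Book.shares
      exact_mod_cast ht j
    linarith
  have hcash : ∀ p : ℝ, (n : ℝ) * |p| ≤ B * |p| := fun p => by gcongr; linarith
  have hpa := mul_nonneg hB0 (abs_nonneg z.pa)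
  have hpb := mul_nonneg hB0 (abs_nonneg z.pb)
  rcases s with _ | _
  · have hd : |((best new.vol : ℤ) - best (z.place c).ask.vol : ℝ)| ≤ K := by
      exact_mod_cast abs_best_sub_best_le new.vol (z.place c).ask.vol
    refine ⟨?_, ?_, ?_, ?_, ?_, hpos _ fun j => ?_, hpos _ fun j => ?_,
      hrank _ _ fun j => ?_, hrank _ _ fun j => ?_⟩
    · simp only [react, place] at hd ⊢
      push_cast at hd ⊢
      exact (abs_add_le _ _).trans (by linarith)
    · simpa [react, place] using hB0
    · simp only [react, place]
      push_cast
      refine (abs_sub _ _).trans ?_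
      rw [abs_of_nonneg hn0]; linarith
    · have e1 := hnew.vol
      have e2 := sum_volAt_le z.bid.vol binf ((best new.vol : ℤ) - best (z.place c).ask.vol)
      have e3 : size new.vol (((z.place c).bid.shift binf
          ((best new.vol : ℤ) - best (z.place c).ask.vol)).vol) ≤
          size z.ask.vol z.bid.vol + (1 + K * binf) := by
        simp only [size, Side.shift, place, side, Side.place] at e1 e2 ⊢
        omega
      have e4 : ((size new.vol (((z.place c).bid.shift binf
          ((best new.vol : ℤ) - best (z.place c).ask.vol)).vol) : ℕ) : ℝ) ≤
          size z.ask.vol z.bid.vol + (1 + K * binf) := by exact_mod_cast e3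
      refine e4.trans ?_
      unfold Book.shares
      linarith
    · simp only [react, place]
      refine (abs_add_le _ _).trans ?_
      rw [abs_mul, abs_of_nonneg hn0, mul_add]
      linarith [hcash z.pa]
    · rcases hnew.pos j with h | h
      · simp only [react, h, side]; exact h1 j
      · simp only [react, h]; simp
    · exact Side.shift_pos _ _ _ j
    · have e1 := hnew.rank j
      have e2 := z.place_ask_rank_le c j
      simp only [react, side] at e1 ⊢
      linarith
    · have e1 := (z.place c).bid.shift_rank binf
        ((best new.vol : ℤ) - best (z.place c).ask.vol) j
      have e2 := z.place_bid_rank_le c j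
      simp only [react] at e1 ⊢
      linarith
  · have hd : |((best new.vol : ℤ) - best (z.place c).bid.vol : ℝ)| ≤ K := by
      exact_mod_cast abs_best_sub_best_le new.vol (z.place c).bid.vol
    refine ⟨?_, ?_, ?_, ?_, ?_, hpos _ fun j => ?_, hpos _ fun j => ?_,
      hrank _ _ fun j => ?_, hrank _ _ fun j => ?_⟩
    · simpa [react, place] using hB0
    · simp only [react, place] at hd ⊢
      push_cast at hd ⊢
      exact (abs_sub _ _).trans (by linarith)
    · simp only [react, place]
      push_cast
      refine (abs_add_le _ _).trans ?_
      rw [abs_of_nonneg hn0]; linarith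
    · have e1 := hnew.vol
      have e2 := sum_volAt_le z.ask.vol ainf ((best new.vol : ℤ) - best (z.place c).bid.vol)
      have e3 : size (((z.place c).ask.shift ainf
          ((best new.vol : ℤ) - best (z.place c).bid.vol)).vol) new.vol ≤
          size z.ask.vol z.bid.vol + (1 + K * ainf) := by
        simp only [size, Side.shift, place, side, Side.place] at e1 e2 ⊢
        omega
      have e4 : ((size (((z.place c).ask.shift ainf
          ((best new.vol : ℤ) - best (z.place c).bid.vol)).vol) new.vol : ℕ) : ℝ) ≤
          size z.ask.vol z.bid.vol + (1 + K * ainf) := by exact_mod_cast e3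
      refine e4.trans ?_
      unfold Book.shares
      linarith
    · simp only [react, place]
      refine (abs_sub _ _).trans ?_
      rw [abs_mul, abs_of_nonneg hn0, mul_add]
      linarith [hcash z.pb]
    · exact Side.shift_pos _ _ _ j
    · rcases hnew.pos j with h | h
      · simp only [react, h, side]; exact h2 j
      · simp only [react, h]; simp
    · have e1 := (z.place c).ask.shift_rank ainf
        ((best new.vol : ℤ) - best (z.place c).bid.vol) j
      have e2 := z.place_ask_rank_le c j
      simp only [react] at e1 ⊢
      linarith
    · have e1 := hnew.rank j
      have e2 := z.place_bid_rank_le c j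
      simp only [react, side] at e1 ⊢
      linarith

theorem near_jump_place (ainf binf : ℕ) (z : Book K M) {c : Action M} (hc : c ∈ z.admissible)
    (e : Event K) (u : ℕ) {B : ℝ} (hB : (K : ℝ) * (ainf + binf) + K + 2 * M + 2 ≤ B) :
    Near B z ((z.place c).jump ainf binf e u) := by
  rcases e with ⟨s, _ | i | i⟩
  -- States are arbitrary, so several orders may carry rank 1 at the best limit; the crude bound `M`
  -- on the number of executions is enough.
  · exact near_react_place ainf binf z hc s _ _ (card_filter_fin_le _)
      (Side.close_marketOrder _) hB
  · exact near_react_place ainf binf z hc s _ _ (Nat.zero_le _) (Side.close_limitOrder _ i) hB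
  · exact near_react_place ainf binf z hc s _ _ (Nat.zero_le _) (Side.close_cancelOrder _ i u) hB

end Book

end Growth

/-! ## Lyapunov functions -/

section Lyapunov

variable {K M : ℕ}

/-- Young's inequality: the defect is the square (δ|u| - v)² divided by δ. -/
theorem sq_add_le {δ : ℝ} (hδ : 0 < δ) {u v w : ℝ} (h : |w| ≤ |u| + v) :
    w ^ 2 ≤ (1 + δ) * u ^ 2 + (1 + 1 / δ) * v ^ 2 := by
  have h1 : w ^ 2 ≤ (|u| + v) ^ 2 := by rw [← sq_abs w]; gcongr
  have h2 : (1 + δ) * u ^ 2 + (1 + 1 / δ) * v ^ 2 - (|u| + v) ^ 2 = (δ * |u| - v) ^ 2 / δ := by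
    rw [← sq_abs u]; field_simp; ring
  have h3 : 0 ≤ (δ * |u| - v) ^ 2 / δ := by positivity
  linarith

namespace Book

/-- The sum of the squares of the positions of the market maker's orders. -/
noncomputable def posSq (z : Book K M) : ℝ := ∑ j, ((z.ask.pos j : ℝ) ^ 2 + (z.bid.pos j : ℝ) ^ 2)

/-- The sum of the squares of the ranks of the market maker's orders. -/
noncomputable def rankSq (z : Book K M) : ℝ :=
  ∑ j, ((z.ask.rank j : ℝ) ^ 2 + (z.bid.rank j : ℝ) ^ 2)

theorem posSq_nonneg (z : Book K M) : 0 ≤ z.posSq := Finset.sum_nonneg fun _ _ => by positivity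

theorem rankSq_nonneg (z : Book K M) : 0 ≤ z.rankSq := Finset.sum_nonneg fun _ _ => by positivity

/-- A quadratic function equivalent to `1 + |z|²`. With the right coefficients, one step of the
dynamics increases it by a factor as close to one as desired. -/
noncomputable def growth (L η : ℝ) (z : Book K M) : ℝ :=
  L + (z.pa ^ 2 + z.pb ^ 2 + (z.y : ℝ) ^ 2 + z.shares ^ 2) + η * (z.x ^ 2 + z.posSq + z.rankSq)

theorem le_growth {L η : ℝ} (hη : 0 ≤ η) (z : Book K M) : L ≤ z.growth L η := by
  have h1 := z.posSq_nonneg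
  have h2 := z.rankSq_nonneg
  have : 0 ≤ (z.pa ^ 2 + z.pb ^ 2 + (z.y : ℝ) ^ 2 + z.shares ^ 2)
    + η * (z.x ^ 2 + z.posSq + z.rankSq) := by positivity
  rw [growth]; linarith

theorem Near.posSq_le {B : ℝ} {z w : Book K M} (h : Near B z w) : w.posSq ≤ 2 * M * B ^ 2 := by
  have : w.posSq ≤ ∑ _j : Fin M, (B ^ 2 + B ^ 2) := by
    refine Finset.sum_le_sum fun j _ => add_le_add ?_ ?_
    · rw [← sq_abs]; exact pow_le_pow_left₀ (abs_nonneg _) (h.ask_pos j) 2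
    · rw [← sq_abs]; exact pow_le_pow_left₀ (abs_nonneg _) (h.bid_pos j) 2
  refine this.trans_eq ?_
  simp; ring

theorem Near.rankSq_le {B : ℝ} {z w : Book K M} (h : Near B z w) {δ : ℝ} (hδ : 0 < δ) :
    w.rankSq ≤ (1 + δ) * z.rankSq + 4 * M * (1 + 1 / δ) * (z.shares ^ 2 + B ^ 2) := by
  have h1 : (z.shares + B) ^ 2 ≤ 2 * (z.shares ^ 2 + B ^ 2) := by
    nlinarith [sq_nonneg (z.shares - B)]
  have h2 : (1 + 1 / δ) * (z.shares + B) ^ 2 ≤ (1 + 1 / δ) * (2 * (z.shares ^ 2 + B ^ 2)) := by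
    gcongr
  have : w.rankSq ≤ ∑ j : Fin M, ((1 + δ) * ((z.ask.rank j : ℝ) ^ 2 + (z.bid.rank j : ℝ) ^ 2)
      + 4 * (1 + 1 / δ) * (z.shares ^ 2 + B ^ 2)) := by
    refine Finset.sum_le_sum fun j _ => ?_
    have e1 := sq_add_le hδ ((h.ask_rank j).trans_eq (add_assoc _ _ _))
    have e2 := sq_add_le hδ ((h.bid_rank j).trans_eq (add_assoc _ _ _))
    linarith
  refine this.trans_eq ?_
  rw [Finset.sum_add_distrib, ← Finset.mul_sum]
  simp [rankSq]; ring

/-- Prices, inventory and shares have bounded increments, so Young's inequality costs a factor 1 + δ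
and a constant. Cash and ranks also pick up multiples of the squared prices and shares; a small `η`
lets another δ of the leading block absorb these, and a large `L` absorbs all constants. -/
theorem exists_growth_le (K M : ℕ) (B : ℝ) {ε : ℝ} (hε : 0 < ε) :
    ∃ L η : ℝ, 1 ≤ L ∧ 0 < η ∧ ∀ z w : Book K M, Near B z w →
      w.growth L η ≤ (1 + ε) * z.growth L η := by
  obtain ⟨δ, hδ, rfl⟩ : ∃ δ, 0 < δ ∧ ε = 2 * δ := ⟨ε / 2, by positivity, by ring⟩
  set C : ℝ := 1 + 1 / δ with hC
  have hC0 : 0 < C := by positivity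
  have hM : (0 : ℝ) ≤ M := Nat.cast_nonneg _
  -- The second and third bounds control, in this order, the prices entering through the cash and
  -- the shares entering through the ranks.
  set η : ℝ := min 1 (min (δ / (2 * C * B ^ 2 + 1)) (δ / (4 * M * C + 1))) with hη
  have hη0 : 0 < η := lt_min one_pos (lt_min (by positivity) (by positivity))
  have hη1 : η ≤ 1 := min_le_left _ _
  have hη2 : η * (2 * C * B ^ 2) ≤ δ := by
    have : η ≤ δ / (2 * C * B ^ 2 + 1) := (min_le_right _ _).trans (min_le_left _ _)
    rw [le_div_iff₀ (by positivity)] at this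
    linarith
  have hη3 : η * (4 * M * C) ≤ δ := by
    have : η ≤ δ / (4 * M * C + 1) := (min_le_right _ _).trans (min_le_right _ _)
    rw [le_div_iff₀ (by positivity)] at this
    linarith
  set D : ℝ := 4 * C * B ^ 2 + 2 * M * B ^ 2 + 4 * M * C * B ^ 2 with hD
  have hD0 : 0 ≤ D := by positivity
  -- `D` collects the additive constants, and `L = 1 + D / δ` makes `δ * L` exceed `D`.
  refine ⟨1 + D / δ, η, by linarith [div_nonneg hD0 hδ.le], hη0, fun z w h => ?_⟩
  have hL : δ * (1 + D / δ) = δ + D := by field_simp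
  have e1 := sq_add_le hδ h.pa
  have e2 := sq_add_le hδ h.pb
  have e3 := sq_add_le hδ h.y
  have e4 : w.shares ^ 2 ≤ (1 + δ) * z.shares ^ 2 + C * B ^ 2 :=
    sq_add_le hδ (by rw [abs_of_nonneg w.shares_nonneg, abs_of_nonneg z.shares_nonneg]
                     exact h.shares)
  have e5 := sq_add_le hδ h.x
  have e6 : (B * (|z.pa| + |z.pb|)) ^ 2 ≤ 2 * B ^ 2 * (z.pa ^ 2 + z.pb ^ 2) := by
    rw [mul_pow, ← sq_abs z.pa, ← sq_abs z.pb, mul_comm 2, mul_assoc]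
    gcongr
    nlinarith [sq_nonneg (|z.pa| - |z.pb|)]
  rw [← hC] at e1 e2 e3 e5
  have e7 : w.x ^ 2 ≤ (1 + δ) * z.x ^ 2 + 2 * C * B ^ 2 * (z.pa ^ 2 + z.pb ^ 2) := by
    have := mul_le_mul_of_nonneg_left e6 hC0.le
    linarith
  have e8 := h.posSq_le
  have e9 := h.rankSq_le hδ
  rw [← hC] at e9
  have f1 := mul_le_mul_of_nonneg_left e7 hη0.le
  have f2 := mul_le_mul_of_nonneg_left e8 hη0.le
  have f3 := mul_le_mul_of_nonneg_left e9 hη0.le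
  have g1 := mul_le_mul_of_nonneg_right hη2 (by positivity : 0 ≤ z.pa ^ 2 + z.pb ^ 2)
  have g2 := mul_le_mul_of_nonneg_right hη3 (by positivity : 0 ≤ z.shares ^ 2)
  have g3 := mul_le_mul_of_nonneg_right hη1 (by positivity : 0 ≤ 4 * M * C * B ^ 2)
  have g4 := mul_le_mul_of_nonneg_right hη1 (by positivity : 0 ≤ 2 * M * B ^ 2)
  have p1 : 0 ≤ δ * z.y ^ 2 := by positivity
  have p2 : 0 ≤ δ * (η * z.x ^ 2) := by positivity
  have p3 : 0 ≤ η * (1 + 2 * δ) * z.posSq := mul_nonneg (by positivity) z.posSq_nonneg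
  have p4 : 0 ≤ δ * (η * z.rankSq) := by have := z.rankSq_nonneg; positivity
  have p5 : 0 ≤ D / δ := by positivity
  simp only [growth]
  have key : (1 + 2 * δ) * (1 + D / δ) = 1 + D / δ + 2 * (δ + D) := by rw [← hL]; ring
  rw [mul_add (1 + 2 * δ), mul_add (1 + 2 * δ), key]
  linarith

/-- The only nontrivial term is the squared number of shares, handled by Cauchy–Schwarz over the `K`
limits. -/
theorem growth_le (K M : ℕ) {L η : ℝ} (hL : 1 ≤ L) (hη : 0 < η) :
    ∃ C : ℝ, 0 < C ∧ ∀ z : Book K M, z.growth L η ≤ C * (1 + z.normSq) := by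
  have hK : (0 : ℝ) ≤ K := Nat.cast_nonneg _
  refine ⟨L + η + 2 * K + 1, by positivity, fun z => ?_⟩
  set v : ℝ := ∑ i, ((z.ask.vol i : ℝ) ^ 2 + (z.bid.vol i : ℝ) ^ 2) with hv
  have hv0 : 0 ≤ v := Finset.sum_nonneg fun _ _ => by positivity
  have h1 : z.shares ^ 2 ≤ 2 * K * v := by
    have e1 : z.shares = ∑ i, ((z.ask.vol i : ℝ) + z.bid.vol i) := by
      simp [shares, size, Finset.sum_add_distrib]
    have e2 := sq_sum_le_card_mul_sum_sq (s := (Finset.univ : Finset (Fin K)))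
      (f := fun i => (z.ask.vol i : ℝ) + z.bid.vol i)
    rw [Finset.card_univ, Fintype.card_fin, ← e1] at e2
    have e3 : ∑ i, ((z.ask.vol i : ℝ) + z.bid.vol i) ^ 2 ≤ 2 * v := by
      rw [hv, Finset.mul_sum]
      exact Finset.sum_le_sum fun i _ => by
        nlinarith [sq_nonneg ((z.ask.vol i : ℝ) - z.bid.vol i)]
    exact (e2.trans (mul_le_mul_of_nonneg_left e3 hK)).trans_eq (by ring)
  have h2 : z.normSq = z.x ^ 2 + (z.y : ℝ) ^ 2 + z.pa ^ 2 + z.pb ^ 2 + v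
      + (z.posSq + z.rankSq) := by
    rw [normSq, posSq, rankSq, ← Finset.sum_add_distrib]
    congr 1
    exact Finset.sum_congr rfl fun _ _ => by ring
  have hp := z.posSq_nonneg
  have hr := z.rankSq_nonneg
  rw [h2, growth]
  have q1 : 0 ≤ (L + η + 2 * K) * (z.pa ^ 2 + z.pb ^ 2 + (z.y : ℝ) ^ 2) := by positivity
  have q2 : 0 ≤ (L + 2 * K + 1) * (z.x ^ 2 + (z.posSq + z.rankSq)) := by positivity
  have q3 : 0 ≤ (L + η + 1) * v := by positivity
  nlinarith

/-- Volumes are nonnegative, so the sum of their squares is at most the square of their sum. -/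
theorem normSq_le (K M : ℕ) {L η : ℝ} (hL : 1 ≤ L) (hη : 0 < η) :
    ∃ C : ℝ, 0 < C ∧ ∀ z : Book K M, 1 + z.normSq ≤ C * z.growth L η := by
  refine ⟨1 + 1 / η, by positivity, fun z => ?_⟩
  set v : ℝ := ∑ i, ((z.ask.vol i : ℝ) ^ 2 + (z.bid.vol i : ℝ) ^ 2) with hv
  have h1 : v ≤ z.shares ^ 2 := by
    have e1 := Finset.sum_sq_le_sq_sum_of_nonneg (s := (Finset.univ : Finset (Fin K)))
      (f := fun i => (z.ask.vol i : ℝ)) (fun _ _ => Nat.cast_nonneg _)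
    have e2 := Finset.sum_sq_le_sq_sum_of_nonneg (s := (Finset.univ : Finset (Fin K)))
      (f := fun i => (z.bid.vol i : ℝ)) (fun _ _ => Nat.cast_nonneg _)
    have p1 : 0 ≤ ∑ i, (z.ask.vol i : ℝ) := Finset.sum_nonneg fun _ _ => Nat.cast_nonneg _
    have p2 : 0 ≤ ∑ i, (z.bid.vol i : ℝ) := Finset.sum_nonneg fun _ _ => Nat.cast_nonneg _
    rw [hv, Finset.sum_add_distrib, shares, size]
    push_cast
    nlinarith
  have h2 : z.normSq = z.x ^ 2 + (z.y : ℝ) ^ 2 + z.pa ^ 2 + z.pb ^ 2 + v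
      + (z.posSq + z.rankSq) := by
    rw [normSq, posSq, rankSq, ← Finset.sum_add_distrib]
    congr 1
    exact Finset.sum_congr rfl fun _ _ => by ring
  have hp := z.posSq_nonneg
  have hr := z.rankSq_nonneg
  rw [h2, growth]
  set A := z.pa ^ 2 + z.pb ^ 2 + (z.y : ℝ) ^ 2 + z.shares ^ 2 with hA
  set X := z.x ^ 2 + z.posSq + z.rankSq with hX
  have q1 : 0 ≤ 1 / η * (L + A) := by positivity
  have q2 : 0 ≤ η * X := by positivity
  have q3 : (1 + 1 / η) * (L + A + η * X) = L + A + η * X + 1 / η * (L + A) + X := by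
    field_simp; ring
  rw [q3]
  linarith

theorem measurable_shares : Measurable (shares : Book K M → ℝ) :=
  measurable_of_fibers fun _ _ _ => by simp only [shares]; exact measurable_const

theorem measurable_growth (L η : ℝ) : Measurable (growth L η : Book K M → ℝ) := by
  refine measurable_of_fibers fun y a b => ?_
  simp only [growth, shares, posSq, rankSq]
  fun_prop

end Book

/-! ### Bounds on the intensities -/

theorem card_event (K : ℕ) : Fintype.card (Event K) = 4 * K + 2 := by
  have h1 : Fintype.card BookSide = 2 := Fintype.card_congr BookSide.equivBool
  have h2 : Fintype.card (Order K) = 1 + (K + K) := by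
    rw [Fintype.card_congr (Order.equivSum K)]; simp
  rw [Fintype.card_prod, h1, h2]; ring

namespace Model

variable (m : Model K M)

theorem LinearIntensities.exists_le {m : Model K M} (h : m.LinearIntensities) :
    ∃ C : ℝ, 0 ≤ C ∧ ∀ e a b, (m.lam e a b : ℝ) ≤ C * size a b := by
  obtain ⟨cL, cC, cM, h⟩ := h
  refine ⟨max (max |cL| |cC|) |cM|, by positivity, fun e a b => ?_⟩
  have hs : (0 : ℝ) ≤ size a b := Nat.cast_nonneg _
  obtain ⟨h1, h2, h3⟩ := h a b
  have key : ∀ c : ℝ, |c| ≤ max (max |cL| |cC|) |cM| →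
      c * size a b ≤ max (max |cL| |cC|) |cM| * size a b := fun c hc =>
    mul_le_mul_of_nonneg_right ((le_abs_self c).trans hc) hs
  rcases e with ⟨s, _ | i | i⟩
  · refine le_trans ?_ (h3.trans (key _ (le_max_right _ _)))
    cases s <;> simp
  · refine le_trans ?_ ((h1 s).trans (key _ ((le_max_left _ _).trans (le_max_left _ _))))
    exact Finset.single_le_sum (f := fun i => (m.lam (s, .limit i) a b : ℝ))
      (fun _ _ => NNReal.coe_nonneg _) (Finset.mem_univ i)
  · refine le_trans ?_ ((h2 s).trans (key _ ((le_max_right _ _).trans (le_max_left _ _))))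
    exact Finset.single_le_sum (f := fun i => (m.lam (s, .cancel i) a b : ℝ))
      (fun _ _ => NNReal.coe_nonneg _) (Finset.mem_univ i)

theorem Lam_nonneg : 0 ≤ m.Lam :=
  mul_nonneg (by positivity) (Real.iSup_nonneg fun _ => by positivity)

/-- Linear growth makes the supremum in `Lam` a genuine one, and `4 K + 2` counts the events. -/
theorem rate_le (h : m.LinearIntensities) (z : Book K M) : (m.rate z : ℝ) ≤ m.Lam * z.shares := by
  obtain ⟨C, hC, hle⟩ := h.exists_le
  have hb : BddAbove (Set.range fun q : Event K × (Fin K → ℕ) × (Fin K → ℕ) =>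
      (m.lam q.1 q.2.1 q.2.2 : ℝ) / size q.2.1 q.2.2) := by
    refine ⟨C, ?_⟩
    rintro _ ⟨q, rfl⟩
    exact div_le_of_le_mul₀ (Nat.cast_nonneg _) hC (hle _ _ _)
  have h1 : ∀ e, (m.lam e z.ask.vol z.bid.vol : ℝ) ≤
      (⨆ q : Event K × (Fin K → ℕ) × (Fin K → ℕ),
        (m.lam q.1 q.2.1 q.2.2 : ℝ) / size q.2.1 q.2.2) * z.shares := fun e => by
    -- In an empty frame the quotient is zero by convention and says nothing; there the linear bound
    -- itself forces the intensity to vanish.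
    rcases Nat.eq_zero_or_pos (size z.ask.vol z.bid.vol) with h0 | h0
    · have := hle e z.ask.vol z.bid.vol
      simp only [Book.shares, h0, Nat.cast_zero, mul_zero] at this ⊢
      exact this
    · have h0' : (0 : ℝ) < size z.ask.vol z.bid.vol := by exact_mod_cast h0
      rw [Book.shares, ← div_le_iff₀ h0']
      exact le_ciSup hb (e, z.ask.vol, z.bid.vol)
  have h2 := Finset.sum_le_card_nsmul Finset.univ _ _ fun e _ => h1 e
  rw [Finset.card_univ, card_event, nsmul_eq_mul] at h2
  simp only [rate, Lam]
  push_cast at h2 ⊢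
  linarith

end Model

end Lyapunov

/-! ## Weights that decrease along the transition kernel -/

namespace Model

variable {K M : ℕ} (m : Model K M)

/-- A constant that bounds the increments of the state in one step. -/
noncomputable def stepBound : ℝ := (K : ℝ) * (m.ainf + m.binf) + K + 2 * M + 2

theorem two_le_stepBound : 2 ≤ m.stepBound := by
  have : (0 : ℝ) ≤ (K : ℝ) * (m.ainf + m.binf) + K + 2 * M := by positivity
  rw [stepBound]; linarith

theorem lintegral_jumpTime (p : m.TState) {φ : ℝ → ℝ≥0∞} (hφ : Measurable φ) :
    ∫⁻ u, φ u ∂(m.jumpTime p) = ∫⁻ u in Set.Ioc (p.1 : ℝ) m.T,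
      ENNReal.ofReal (m.rate p.2 * Real.exp (-(m.rate p.2 * (u - p.1)))) * φ u := by
  have h1 : Measurable fun u : ℝ => if (p.1 : ℝ) < u then
      ENNReal.ofReal (m.rate p.2 * Real.exp (-(m.rate p.2 * (u - p.1)))) else 0 :=
    Measurable.ite (measurableSet_lt measurable_const measurable_id) (by fun_prop)
      measurable_const
  have h2 : ∀ u : ℝ, (if (p.1 : ℝ) < u then
      ENNReal.ofReal (m.rate p.2 * Real.exp (-(m.rate p.2 * (u - p.1)))) else 0) * φ u =
      (Set.Ioi (p.1 : ℝ)).indicator (fun u =>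
        ENNReal.ofReal (m.rate p.2 * Real.exp (-(m.rate p.2 * (u - p.1)))) * φ u) u := by
    intro u
    by_cases h : (p.1 : ℝ) < u <;> simp [h]
  have h3 : Set.Ioi (p.1 : ℝ) ∩ Set.Icc 0 m.T = Set.Ioc (p.1 : ℝ) m.T := by
    ext u
    have := p.1.2.1
    simp only [Set.mem_inter_iff, Set.mem_Icc, Set.mem_Ioi, Set.mem_Ioc]
    constructor
    · rintro ⟨h', _, h⟩; exact ⟨h', h⟩
    · rintro ⟨h', h⟩; exact ⟨h', this.trans h'.le, h⟩
  simp only [jumpTime, ← Subtype.coe_lt_coe]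
  have h4 : Measurable fun u : Set.Icc (0 : ℝ) m.T => if (p.1 : ℝ) < u then
      ENNReal.ofReal (m.rate p.2 * Real.exp (-(m.rate p.2 * ((u : ℝ) - p.1)))) else 0 :=
    h1.comp measurable_subtype_coe
  have h5 : Measurable fun u : Set.Icc (0 : ℝ) m.T => φ u := hφ.comp measurable_subtype_coe
  rw [lintegral_withDensity_eq_lintegral_mul _ h4 h5]
  simp only [Pi.mul_apply]
  rw [lintegral_subtype_comap measurableSet_Icc (fun u : ℝ => (if (p.1 : ℝ) < u then
      ENNReal.ofReal (m.rate p.2 * Real.exp (-(m.rate p.2 * (u - p.1)))) else 0) * φ u)]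
  simp only [h2]
  rw [setLIntegral_indicator measurableSet_Ioi, h3]

theorem ae_lt_jumpTime (p : m.TState) : ∀ᵐ u ∂(m.jumpTime p), p.1 < u := by
  have hs : MeasurableSet {u : ℝ | u ≤ p.1} := measurableSet_le measurable_id measurable_const
  have h := m.lintegral_jumpTime p (φ := {u : ℝ | u ≤ p.1}.indicator 1)
    (measurable_one.indicator hs)
  have h0 : ∀ u ∈ Set.Ioc (p.1 : ℝ) m.T,
      ENNReal.ofReal (m.rate p.2 * Real.exp (-(m.rate p.2 * (u - p.1)))) *
        ({u : ℝ | u ≤ p.1}.indicator 1 u : ℝ≥0∞) = 0 := fun u hu => by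
    simp [hu.1]
  have h1 : Measurable fun u : Set.Icc (0 : ℝ) m.T =>
      ({u : ℝ | u ≤ p.1}.indicator 1 (u : ℝ) : ℝ≥0∞) :=
    (measurable_one.indicator hs).comp measurable_subtype_coe
  rw [setLIntegral_congr_fun measurableSet_Ioc h0, lintegral_zero, lintegral_eq_zero_iff h1] at h
  filter_upwards [h] with u hu
  by_contra hn
  rw [not_lt] at hn
  have : (u : ℝ) ≤ p.1 := hn
  simp [this] at hu

/-- `jumpGoal` is a finite sum of Dirac masses with total mass at most one, so a bound at the
possible targets suffices. -/
theorem lintegral_jumpGoal_le {z : Book K M} {c : Action M} {φ : Book K M → ℝ≥0∞}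
    (hφ : Measurable φ) {C : ℝ≥0∞}
    (h : ∀ e u, φ ((z.place c).jump m.ainf m.binf e u) ≤ C) :
    ∫⁻ w, φ w ∂(m.jumpGoal z c) ≤ C := by
  have hs : MeasurableSet {w | C < φ w} := measurableSet_lt measurable_const hφ
  have h1 : ∀ᵐ w ∂(m.jumpGoal z c), φ w ≤ C := by
    rw [ae_iff]
    simp only [not_le, jumpGoal, Measure.coe_finsetSum, Finset.sum_apply, Measure.smul_apply,
      smul_eq_mul, Measure.dirac_apply' _ hs]
    refine Finset.sum_eq_zero fun e _ => ?_
    rw [Finset.sum_eq_zero, mul_zero]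
    intro u _
    rw [Set.indicator_of_notMem, mul_zero]
    simpa using h e u
  calc ∫⁻ w, φ w ∂(m.jumpGoal z c) ≤ ∫⁻ _, C ∂(m.jumpGoal z c) := lintegral_mono_ae h1
    _ = C * m.jumpGoal z c Set.univ := lintegral_const _
    _ ≤ C * 1 := by gcongr; exact m.jumpGoal_univ_le z c
    _ = C := mul_one C

/-- The weight `G(z) e^{ρ(t)(1 + |a| + |b|)}`. -/
noncomputable def weight (L η : ℝ) (ρ : ℝ → ℝ) (p : m.TState) : ℝ :=
  p.2.growth L η * Real.exp (ρ p.1 * (1 + p.2.shares))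

theorem measurable_weight (L η : ℝ) {ρ : ℝ → ℝ} (hρ : Measurable ρ) :
    Measurable (m.weight L η ρ) := by
  have h1 : Measurable fun p : m.TState => p.2.growth L η :=
    (Book.measurable_growth L η).comp measurable_snd
  have h2 : Measurable fun p : m.TState => p.2.shares :=
    Book.measurable_shares.comp measurable_snd
  have h3 : Measurable fun p : m.TState => ρ p.1 :=
    hρ.comp (measurable_subtype_coe.comp measurable_fst)
  unfold weight
  fun_prop

theorem growth_le_weight {L η : ℝ} (hL : 0 ≤ L) (hη : 0 ≤ η) {ρ : ℝ → ℝ} (p : m.TState)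
    (hρ : 0 ≤ ρ p.1) : p.2.growth L η ≤ m.weight L η ρ p := by
  have h1 : 0 ≤ p.2.growth L η := hL.trans (p.2.le_growth hη)
  refine le_mul_of_one_le_right h1 (Real.one_le_exp ?_)
  have := p.2.shares_nonneg
  positivity

/-- A jump at time u from S shares produces at most (1 + ε) G e^{ρ(u)(1 + S + B)}. The hypothesis on
the rate makes this, times the density of the jump time, at most minus the derivative of κ G e^{-l(u
- t) + ρ(u)(1 + S)}, whose integral is at most the initial value κ W. The cut-off `θ` is the horizon
in the existence part and the end of a slab in the uniqueness part; `κ` is free. -/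
theorem lintegral_weight_le {L η ε κ θ : ℝ} (hL : 0 ≤ L) (hη : 0 ≤ η) (hε : 0 ≤ ε) (hκ : 0 ≤ κ)
    {ρ ρ' : ℝ → ℝ} (hρ : ∀ u, HasDerivAt ρ (ρ' u) u) (hρ' : Continuous ρ')
    (hG : ∀ z w : Book K M, Book.Near m.stepBound z w → w.growth L η ≤ (1 + ε) * z.growth L η)
    (p : m.TState) {c : Action M} (hc : c ∈ p.2.admissible) (hpθ : p.1 ≤ θ)
    (hθT : θ ≤ m.T) (hpos : ∀ u ≤ θ, 0 ≤ ρ u)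
    (hrate : ∀ u : ℝ, p.1 ≤ u → u ≤ θ → (1 + ε) * m.rate p.2 * Real.exp (ρ u * m.stepBound) ≤
      κ * (m.rate p.2 - ρ' u * (1 + p.2.shares))) :
    ∫⁻ q, (if (q.1 : ℝ) ≤ θ then ENNReal.ofReal (m.weight L η ρ q) else 0) ∂(m.Q p c) ≤
      ENNReal.ofReal (κ * m.weight L η ρ p) := by
  set l : ℝ := ((m.rate p.2 : ℝ≥0) : ℝ) with hl
  set S : ℝ := p.2.shares with hS
  set G : ℝ := p.2.growth L η with hGdef
  have hG0 : 0 ≤ G := hL.trans (p.2.le_growth hη)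
  have hcρ : Continuous ρ := continuous_iff_continuousAt.2 fun u => (hρ u).continuousAt
  have hmeas : Measurable fun q : m.TState =>
      if (q.1 : ℝ) ≤ θ then ENNReal.ofReal (m.weight L η ρ q) else 0 :=
    Measurable.ite (measurableSet_le (measurable_subtype_coe.comp measurable_fst)
      measurable_const) (m.measurable_weight L η hcρ.measurable).ennreal_ofReal measurable_const
  -- This bounds the integral over target states for a given jump time; nonnegativity of `ρ` is
  -- needed to replace the new number of shares by its upper bound.
  set φ : ℝ → ℝ≥0∞ := (Set.Iic θ).indicator fun u =>
    ENNReal.ofReal ((1 + ε) * G * Real.exp (ρ u * (1 + S + m.stepBound))) with hφ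
  have hφm : Measurable φ := Measurable.indicator (by fun_prop) measurableSet_Iic
  have hinner : ∀ u : Set.Icc (0 : ℝ) m.T, ∫⁻ w, (if (u : ℝ) ≤ θ then
      ENNReal.ofReal (m.weight L η ρ (u, w)) else 0) ∂(m.jumpGoal p.2 c) ≤ φ u := fun u => by
    by_cases hu : (u : ℝ) ≤ θ
    · simp only [hu, if_true, hφ, Set.indicator_of_mem (Set.mem_Iic.2 hu)]
      refine m.lintegral_jumpGoal_le ?_ fun e i => ENNReal.ofReal_le_ofReal ?_
      · exact ((m.measurable_weight L η hcρ.measurable).comp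
          (measurable_const.prodMk measurable_id)).ennreal_ofReal
      · have hn := Book.near_jump_place m.ainf m.binf p.2 hc e i (B := m.stepBound) le_rfl
        have hw := hG _ _ hn
        refine mul_le_mul hw (Real.exp_le_exp.2 ?_) (Real.exp_pos _).le (by positivity)
        refine mul_le_mul_of_nonneg_left ?_ (hpos u hu)
        linarith [hn.shares]
    · simp [hu, hφ]
  rw [Q, lintegral_prod _ hmeas.aemeasurable]
  refine (lintegral_mono hinner).trans ?_
  rw [m.lintegral_jumpTime p hφm, ← hl]
  have hset : Set.Iic θ ∩ Set.Ioc (p.1 : ℝ) m.T = Set.Ioc (p.1 : ℝ) θ := by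
    ext u
    simp only [Set.mem_inter_iff, Set.mem_Iic, Set.mem_Ioc]
    constructor
    · rintro ⟨h1, h2, _⟩; exact ⟨h2, h1⟩
    · rintro ⟨h1, h2⟩; exact ⟨h2, h1, h2.trans hθT⟩
  have hind : ∀ u, ENNReal.ofReal (l * Real.exp (-(l * (u - p.1)))) * φ u =
      (Set.Iic θ).indicator (fun u => ENNReal.ofReal (l * Real.exp (-(l * (u - p.1)))) *
        ENNReal.ofReal ((1 + ε) * G * Real.exp (ρ u * (1 + S + m.stepBound)))) u := fun u => by
    by_cases hu : u ∈ Set.Iic θ <;> simp [hφ, hu]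
  simp only [hind]
  rw [setLIntegral_indicator measurableSet_Iic, hset]
  -- Probability of no jump up to `u` times the exponential factor of the weight, with the current
  -- shares frozen.
  set Φ : ℝ → ℝ := fun u => Real.exp (-(l * (u - p.1)) + ρ u * (1 + S)) with hΦ
  have hΦd : ∀ u, HasDerivAt (fun u => -(κ * G) * Φ u)
      (κ * G * ((l - ρ' u * (1 + S)) * Φ u)) u := fun u => by
    have h1 : HasDerivAt (fun u => -(l * (u - p.1)) + ρ u * (1 + S))
        (-(l * 1) + ρ' u * (1 + S)) u :=
      ((((hasDerivAt_id u).sub_const _).const_mul l).neg).add ((hρ u).mul_const _)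
    exact (h1.exp.const_mul (-(κ * G))).congr_deriv (by simp only [hΦ]; ring)
  have hΦc : Continuous fun u => κ * G * ((l - ρ' u * (1 + S)) * Φ u) := by
    simp only [hΦ]; fun_prop
  have hptw : ∀ u ∈ Set.Ioc (p.1 : ℝ) θ, l * Real.exp (-(l * (u - p.1))) *
      ((1 + ε) * G * Real.exp (ρ u * (1 + S + m.stepBound))) ≤
      κ * G * ((l - ρ' u * (1 + S)) * Φ u) := fun u hu => by
    have h1 := mul_le_mul_of_nonneg_left (hrate u hu.1.le hu.2)
      (mul_nonneg hG0 (Real.exp_pos (-(l * (u - p.1)) + ρ u * (1 + S))).le)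
    rw [mul_add (ρ u), Real.exp_add]
    simp only [hΦ]
    rw [Real.exp_add] at h1 ⊢
    linarith
  calc ∫⁻ u in Set.Ioc (p.1 : ℝ) θ, ENNReal.ofReal (l * Real.exp (-(l * (u - p.1)))) *
        ENNReal.ofReal ((1 + ε) * G * Real.exp (ρ u * (1 + S + m.stepBound)))
      ≤ ∫⁻ u in Set.Ioc (p.1 : ℝ) θ, ENNReal.ofReal (κ * G * ((l - ρ' u * (1 + S)) * Φ u)) := by
        refine setLIntegral_mono (by fun_prop) fun u hu => ?_
        rw [← ENNReal.ofReal_mul (by positivity)]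
        exact ENNReal.ofReal_le_ofReal (hptw u hu)
    _ = ENNReal.ofReal (∫ u in (p.1 : ℝ)..θ, κ * G * ((l - ρ' u * (1 + S)) * Φ u)) := by
        rw [intervalIntegral.integral_of_le hpθ, ofReal_integral_eq_lintegral_ofReal]
        · exact hΦc.integrableOn_Icc.mono_set Set.Ioc_subset_Icc_self
        · refine (ae_restrict_iff' measurableSet_Ioc).2 (Filter.Eventually.of_forall fun u hu => ?_)
          exact le_trans (by positivity) (hptw u hu)
    _ ≤ ENNReal.ofReal (κ * m.weight L η ρ p) := by
        refine ENNReal.ofReal_le_ofReal ?_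
        rw [intervalIntegral.integral_eq_sub_of_hasDerivAt (fun u _ => hΦd u)
          (hΦc.intervalIntegrable _ _)]
        have h1 : Φ p.1 = Real.exp (ρ p.1 * (1 + S)) := by simp [hΦ]
        have h2 : 0 ≤ κ * G * Φ θ := by positivity
        rw [h1, weight, ← hS, ← hGdef]
        linarith

end Model

/-- The bound on the dominating function is an extended nonnegative integral, so integrability comes
out instead of being assumed. -/
theorem integrable_and_abs_integral_le {α : Type*} [MeasurableSpace α] {μ : Measure α}
    {u h : α → ℝ} {C H : ℝ} (hu : AEStronglyMeasurable u μ) (hC : 0 ≤ C) (hH : 0 ≤ H)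
    (hle : ∀ᵐ x ∂μ, |u x| ≤ C * h x) (hh : ∫⁻ x, ENNReal.ofReal (h x) ∂μ ≤ ENNReal.ofReal H) :
    Integrable u μ ∧ |∫ x, u x ∂μ| ≤ C * H := by
  have h1 : ∫⁻ x, ‖u x‖ₑ ∂μ ≤ ENNReal.ofReal (C * H) := by
    calc ∫⁻ x, ‖u x‖ₑ ∂μ ≤ ∫⁻ x, ENNReal.ofReal C * ENNReal.ofReal (h x) ∂μ := by
          refine lintegral_mono_ae ?_
          filter_upwards [hle] with x hx
          rw [← ENNReal.ofReal_mul hC, Real.enorm_eq_ofReal_abs]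
          exact ENNReal.ofReal_le_ofReal hx
      _ = ENNReal.ofReal C * ∫⁻ x, ENNReal.ofReal (h x) ∂μ :=
          lintegral_const_mul' _ _ ENNReal.ofReal_ne_top
      _ ≤ ENNReal.ofReal C * ENNReal.ofReal H := by gcongr
      _ = ENNReal.ofReal (C * H) := (ENNReal.ofReal_mul hC).symm
  refine ⟨⟨hu, h1.trans_lt ENNReal.ofReal_lt_top⟩, ?_⟩
  have h2 := (enorm_integral_le_lintegral_enorm u).trans h1
  rw [Real.enorm_eq_ofReal_abs] at h2
  exact (ENNReal.ofReal_le_ofReal_iff (by positivity)).1 h2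

/-- With `x = ρ B`, this turns the rate condition of `Model.lintegral_weight_le` for κ = 1/(1 + ε)
into a linear differential equation for ρ. It rests on e^x ≤ 1 + 2x for x ≤ 1/2 and (1 + ε)² ≤ 1 +
3ε. -/
theorem mul_exp_le_of_le {l Λ S ε x : ℝ} (hl0 : 0 ≤ l) (hl : l ≤ Λ * S) (hΛ : 0 ≤ Λ)
    (hε0 : 0 < ε) (hε1 : ε ≤ 1) (hx0 : 0 ≤ x) (hx1 : x ≤ 1 / 2) :
    (1 + ε) * l * Real.exp x ≤ 1 / (1 + ε) * (l + Λ * (3 * ε + 8 * x) * (1 + S)) := by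
  have hexp : Real.exp x ≤ 1 + 2 * x := by
    have h1 := Real.add_one_le_exp (-x)
    have h2 : Real.exp x * Real.exp (-x) = 1 := by rw [← Real.exp_add]; simp
    have h3 := Real.exp_pos x
    nlinarith
  have h6 : (1 + ε) * (1 + ε) * Real.exp x ≤ 1 + (3 * ε + 8 * x) := by
    have h7 : (1 + ε) * (1 + ε) ≤ 1 + 3 * ε := by nlinarith
    calc (1 + ε) * (1 + ε) * Real.exp x ≤ (1 + 3 * ε) * (1 + 2 * x) := by gcongr
      _ ≤ _ := by nlinarith
  have h8 : l * (3 * ε + 8 * x) ≤ Λ * (1 + S) * (3 * ε + 8 * x) := by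
    gcongr
    nlinarith
  rw [one_div, inv_mul_eq_div, le_div_iff₀ (by positivity)]
  have h9 := mul_le_mul_of_nonneg_left h6 hl0
  linarith

/-! ### A Lyapunov weight dominated by the bounding function -/

namespace Model

variable {K M : ℕ} (m : Model K M)

/-- A weight that contracts along the transition kernel with factor `κ`, and that dominates the
rewards up to the constant `C`. -/
structure IsLyapunov (W : m.TState → ℝ) (κ C : ℝ) : Prop where
  measurable : Measurable W
  one_le : ∀ p, 1 ≤ W p
  nonneg : 0 ≤ κ
  lt_one : κ < 1
  lintegral_le : ∀ p, ∀ c ∈ p.2.admissible,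
    ∫⁻ q, ENNReal.ofReal (W q) ∂(m.Q p c) ≤ ENNReal.ofReal (κ * W p)
  const_nonneg : 0 ≤ C
  running_le : ∀ p, ∀ c ∈ p.2.admissible, |m.f (p.2.place c) c| ≤ C * W p
  terminal_le : ∀ p, ∀ c ∈ p.2.admissible, |m.g (p.2.place c)| ≤ C * W p

/-- The exponent solves -ρ' = Λ(3ε + 8Bρ) with ρ(T) = 0, which is exactly what `mul_exp_le_of_le`
requires. Being proportional to ε, it can be made as small as any given γ₀ demands. -/
theorem exists_isLyapunov (hlam : m.LinearIntensities) (hrew : m.QuadraticRewards)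
    {γ₀ : ℝ} (hγ₀ : 0 < γ₀) :
    ∃ W κ C, m.IsLyapunov W κ C ∧ ∃ D, 0 ≤ D ∧ ∀ p, W p ≤ D * m.bound γ₀ p := by
  have hΛ := m.Lam_nonneg
  have hB := m.two_le_stepBound
  set B := m.stepBound with hBdef
  set A := 8 * B * m.Lam with hA
  have hA0 : 0 ≤ A := by positivity
  set E := Real.exp (A * m.T) with hE
  have hE0 : 0 < E := Real.exp_pos _
  -- The second bound places the exponent below that of `bound`; the third keeps `ρ * B` below 1/2,
  -- the range of `mul_exp_le_of_le`.
  set ε : ℝ := min 1 (min (γ₀ * (4 * K + 2) / (3 * E)) (1 / E)) with hε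
  have hε0 : 0 < ε := lt_min one_pos (lt_min (by positivity) (by positivity))
  have hε1 : ε ≤ 1 := min_le_left _ _
  have hε2 : 3 * ε * E ≤ γ₀ * (4 * K + 2) := by
    have : ε ≤ γ₀ * (4 * K + 2) / (3 * E) := (min_le_right _ _).trans (min_le_left _ _)
    rw [le_div_iff₀ (by positivity)] at this
    linarith
  have hε3 : ε * E ≤ 1 := by
    have : ε ≤ 1 / E := (min_le_right _ _).trans (min_le_right _ _)
    rwa [le_div_iff₀ hE0] at this
  obtain ⟨L, η, hL, hη, hG⟩ := Book.exists_growth_le K M B hε0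
  obtain ⟨C₁, hC₁, hup⟩ := Book.growth_le K M hL hη
  obtain ⟨C₂, hC₂, hlow⟩ := Book.normSq_le K M hL hη
  obtain ⟨⟨c₅, hc₅, hf⟩, c₆, hc₆, hg⟩ := hrew
  set ε' := 3 * ε / (8 * B) with hε'
  have hε'0 : 0 < ε' := by positivity
  -- Solution of -ρ' = A(ρ + ε') vanishing at the horizon; the choices of `A` and `ε'` give A ε' =
  -- 3εΛ and A = 8BΛ.
  set ρ : ℝ → ℝ := fun u => ε' * (Real.exp (A * (m.T - u)) - 1) with hρ
  set ρ' : ℝ → ℝ := fun u => -(ε' * A * Real.exp (A * (m.T - u))) with hρ'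
  have hd : ∀ u, HasDerivAt ρ (ρ' u) u := fun u => by
    have h1 : HasDerivAt (fun u => A * (m.T - u)) (A * (-1)) u :=
      ((hasDerivAt_id u).const_sub m.T).const_mul A
    exact ((h1.exp.sub_const 1).const_mul ε').congr_deriv (by simp only [hρ']; ring)
  have hρ0 : ∀ u ≤ m.T, 0 ≤ ρ u := fun u hu => by
    have : 1 ≤ Real.exp (A * (m.T - u)) :=
      Real.one_le_exp (mul_nonneg hA0 (sub_nonneg.2 hu))
    exact mul_nonneg hε'0.le (by linarith)
  have hEu : ∀ u, 0 ≤ u → Real.exp (A * (m.T - u)) ≤ E := fun u hu =>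
    Real.exp_le_exp.2 (mul_le_mul_of_nonneg_left (by linarith) hA0)
  have hAε : A * ε' = 3 * ε * m.Lam := by rw [hA, hε']; field_simp
  have hρW : ∀ p : m.TState, 0 ≤ ρ p.1 := fun p => hρ0 _ p.1.2.2
  have hgW : ∀ p : m.TState, p.2.growth L η ≤ m.weight L η ρ p := fun p =>
    m.growth_le_weight (by linarith) hη.le p (hρW p)
  have hplace : ∀ p : m.TState, ∀ c ∈ p.2.admissible,
      1 + (p.2.place c).normSq ≤ C₂ * (1 + ε) * m.weight L η ρ p := fun p c hc => by
    have h1 := hG _ _ (Book.near_place p.2 hc (B := B) (by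
      rw [hBdef, stepBound]
      have : (0 : ℝ) ≤ (K : ℝ) * (m.ainf + m.binf) := by positivity
      linarith))
    calc 1 + (p.2.place c).normSq ≤ C₂ * (p.2.place c).growth L η := hlow _
      _ ≤ C₂ * ((1 + ε) * p.2.growth L η) := by gcongr
      _ ≤ C₂ * ((1 + ε) * m.weight L η ρ p) := by gcongr; exact hgW p
      _ = _ := by ring
  refine ⟨m.weight L η ρ, 1 / (1 + ε), (c₅ + c₆) * (C₂ * (1 + ε)), ⟨?_, fun p => ?_, by positivity,
    ?_, fun p c hc => ?_, by positivity, fun p c hc => ?_, fun p c hc => ?_⟩,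
    C₁, hC₁.le, fun p => ?_⟩
  · exact m.measurable_weight L η (by simp only [hρ]; fun_prop)
  · exact hL.trans ((p.2.le_growth hη.le).trans (hgW p))
  · rw [div_lt_one (by positivity)]; linarith
  · have h := m.lintegral_weight_le (θ := m.T) (ε := ε) (κ := 1 / (1 + ε)) (by linarith) hη.le
      hε0.le (by positivity) hd (by simp only [hρ']; fun_prop) hG p hc p.1.2.2 le_rfl hρ0 ?_
    · refine le_trans (le_of_eq (lintegral_congr fun q => ?_)) h
      rw [if_pos q.1.2.2]
    · intro u hu hu'
      have hu0 : 0 ≤ u := p.1.2.1.trans hu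
      have hx0 : 0 ≤ ρ u * B := mul_nonneg (hρ0 u hu') (by linarith)
      have hx1 : ρ u * B ≤ 1 / 2 := by
        have h1 : ρ u ≤ ε' * E := by
          simp only [hρ]; gcongr; linarith [hEu u hu0]
        have h2 : ε' * E * B = 3 / 8 * (ε * E) := by rw [hε']; field_simp
        have h3 : ρ u * B ≤ ε' * E * B := by gcongr
        linarith
      have h5 : m.rate p.2 - ρ' u * (1 + p.2.shares) =
          m.rate p.2 + m.Lam * (3 * ε + 8 * (ρ u * B)) * (1 + p.2.shares) := by
        have hder : ρ' u = -(A * ρ u + A * ε') := by simp only [hρ', hρ]; ring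
        rw [hder, hAε, hA]; ring
      rw [h5]
      exact mul_exp_le_of_le (NNReal.coe_nonneg _) (m.rate_le hlam p.2) hΛ
        hε0 hε1 hx0 hx1
  -- The reward is evaluated after the decision, and its growth bound needs admissibility there;
  -- `place` keeps the volumes, on which alone admissibility depends.
  · have hc' : c ∈ (p.2.place c).admissible := hc
    refine (hf _ _ hc').trans ?_
    have := hplace p c hc
    calc c₅ * (1 + (p.2.place c).normSq) ≤ c₅ * (C₂ * (1 + ε) * m.weight L η ρ p) := by gcongr
      _ ≤ (c₅ + c₆) * (C₂ * (1 + ε) * m.weight L η ρ p) := by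
        have h0 : 0 ≤ m.weight L η ρ p := by
          linarith [hgW p, p.2.le_growth (L := L) hη.le]
        gcongr; linarith
      _ = _ := by ring
  · refine (hg _).trans ?_
    have := hplace p c hc
    calc c₆ * (1 + (p.2.place c).normSq) ≤ c₆ * (C₂ * (1 + ε) * m.weight L η ρ p) := by gcongr
      _ ≤ (c₅ + c₆) * (C₂ * (1 + ε) * m.weight L η ρ p) := by
        have h0 : 0 ≤ m.weight L η ρ p := by
          linarith [hgW p, p.2.le_growth (L := L) hη.le]
        gcongr; linarith
      _ = _ := by ring
  · have hτ : 0 ≤ m.T - p.1 := sub_nonneg.2 p.1.2.2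
    have hS := p.2.shares_nonneg
    have h1 : ρ p.1 ≤ γ₀ * (4 * K + 2) * m.Lam * (m.T - p.1) := by
      set x := A * (m.T - p.1) with hx
      have hx0 : 0 ≤ x := mul_nonneg hA0 hτ
      -- This makes `ρ` at most linear in the time to the horizon, as the exponent of `bound` is.
      have e1 : Real.exp x - 1 ≤ x * Real.exp x := by
        have h1 := Real.add_one_le_exp (-x)
        have h2 : Real.exp x * Real.exp (-x) = 1 := by rw [← Real.exp_add]; simp
        have h3 := Real.exp_pos x
        nlinarith
      have e2 : x * Real.exp x ≤ x * E := by gcongr; exact hEu _ p.1.2.1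
      calc ρ p.1 = ε' * (Real.exp x - 1) := rfl
        _ ≤ ε' * (x * E) := by gcongr; linarith
        _ = (A * ε') * E * (m.T - p.1) := by rw [hx]; ring
        _ = (3 * ε * E) * m.Lam * (m.T - p.1) := by rw [hAε]; ring
        _ ≤ _ := by gcongr
    have h2 : 0 ≤ C₁ * (1 + p.2.normSq) := by
      linarith [hup p.2, p.2.le_growth (L := L) hη.le]
    rw [weight, bound, ← mul_assoc]
    refine mul_le_mul (hup p.2) (Real.exp_le_exp.2 ?_) (Real.exp_pos _).le h2
    calc ρ p.1 * (1 + p.2.shares)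
        ≤ γ₀ * (4 * K + 2) * m.Lam * (m.T - p.1) * (1 + p.2.shares) := by gcongr
      _ = _ := by rw [Book.shares]; ring

end Model

/-! ## The maximal reward operator -/

theorem Book.admissible_finite {K M : ℕ} (z : Book K M) : z.admissible.Finite := by
  have h : (Set.univ.pi fun _ : Fin M => Set.Icc (-((K : ℤ) + 1)) (K + 1)).Finite :=
    Set.Finite.pi fun _ => Set.finite_Icc _ _
  refine (h.prod h).subset fun c hc => ?_
  obtain ⟨h1, h2⟩ := z.abs_admissible_le hc
  exact ⟨fun j _ => abs_le.1 (h1 j), fun j _ => abs_le.1 (h2 j)⟩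

theorem Book.admissible_nonempty {K M : ℕ} (z : Book K M) : z.admissible.Nonempty :=
  ⟨(fun _ => -1, fun _ => -1), fun _ => Or.inl rfl, fun _ => Or.inl rfl⟩

theorem Book.measurableSet_admissible {K M : ℕ} (c : Action M) :
    MeasurableSet {z : Book K M | c ∈ z.admissible} := by
  refine measurableSet_setOfPred.2 (measurable_of_fibers fun y a b => ?_)
  exact (measurable_const :
    Measurable fun _ : ℝ × ℝ × ℝ => c ∈ (⟨0, y, a, b, 0, 0⟩ : Book K M).admissible)

namespace Model

variable {K M : ℕ} (m : Model K M)

theorem meanSojourn_nonneg {l τ : ℝ} (hl : 0 ≤ l) (hτ : 0 ≤ τ) : 0 ≤ meanSojourn l τ := by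
  unfold meanSojourn
  split_ifs with h
  · exact hτ
  · rw [← sub_div]
    refine div_nonneg (sub_nonneg.2 (Real.exp_le_one_iff.2 ?_)) hl
    rw [neg_nonpos]; positivity

theorem meanSojourn_le {l τ : ℝ} (hl : 0 ≤ l) : meanSojourn l τ ≤ τ := by
  unfold meanSojourn
  split_ifs with h
  · exact le_rfl
  · have hl' : 0 < l := lt_of_le_of_ne hl (Ne.symm h)
    rw [← sub_div, div_le_iff₀ hl']
    linarith [Real.add_one_le_exp (-(l * τ))]

theorem measurable_r (hf : ∀ a, Measurable fun z => m.f z a) (hg : Measurable m.g)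
    (c : Action M) : Measurable fun p : m.TState => m.r p c := by
  have h1 : Measurable fun p : m.TState => (m.rate p.2 : ℝ) :=
    (m.measurable_rate.comp measurable_snd).coe_nnreal_real
  have h2 : Measurable fun p : m.TState => (p.1 : ℝ) :=
    measurable_subtype_coe.comp measurable_fst
  have h3 : Measurable fun p : m.TState => p.2.place c :=
    (measurable_place c).comp measurable_snd
  have h4 : Measurable fun p : m.TState => meanSojourn (m.rate p.2) (m.T - p.1) := by
    unfold meanSojourn
    refine Measurable.ite (measurableSet_eq_fun h1 measurable_const) ?_ ?_ <;> fun_prop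
  have h5 : Measurable fun p : m.TState => m.f (p.2.place c) c := (hf c).comp h3
  have h6 : Measurable fun p : m.TState => m.g (p.2.place c) := hg.comp h3
  unfold r
  fun_prop

theorem Q_univ_le (p : m.TState) (c : Action M) : m.Q p c Set.univ ≤ 1 := by
  rw [Q, ← Set.univ_prod_univ, Measure.prod_prod]
  exact mul_le_one' (m.jumpTime_univ_le _) (m.jumpGoal_univ_le _ _)

/-- The transition kernel of the Markov decision process for a fixed action. -/
noncomputable def kernelQ (c : Action M) : Kernel m.TState m.TState where
  toFun p := m.Q p c
  measurable' := m.measurable_Q.comp (f := fun p : m.TState => (p, c))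
    (measurable_id.prodMk measurable_const)

instance (c : Action M) : IsFiniteKernel (m.kernelQ c) :=
  ⟨1, ENNReal.one_lt_top, fun p => m.Q_univ_le p c⟩

theorem measurable_actionValue (hf : ∀ a, Measurable fun z => m.f z a) (hg : Measurable m.g)
    {v : m.TState → ℝ} (hv : Measurable v) (c : Action M) :
    Measurable fun p : m.TState => m.actionValue v p c := by
  have h : Measurable fun p : m.TState => ∫ x, v x ∂(m.Q p c) :=
    (hv.stronglyMeasurable.integral_kernel (κ := m.kernelQ c)).measurable
  exact (m.measurable_r hf hg c).add h

theorem actionValue_le_bellman (v : m.TState → ℝ) (p : m.TState) {c : Action M}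
    (hc : c ∈ p.2.admissible) : m.actionValue v p c ≤ m.bellman v p := by
  have : Finite p.2.admissible := p.2.admissible_finite
  exact le_ciSup (f := fun c : p.2.admissible => m.actionValue v p c)
    (Set.finite_range _).bddAbove ⟨c, hc⟩

theorem bellman_le (v : m.TState → ℝ) (p : m.TState) {b : ℝ}
    (h : ∀ c ∈ p.2.admissible, m.actionValue v p c ≤ b) : m.bellman v p ≤ b := by
  have : Nonempty p.2.admissible := p.2.admissible_nonempty.to_subtype
  exact ciSup_le fun c => h c c.2

/-- No selection theorem is needed: the action space is countable and each admissible set is finite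
and nonempty, so the first optimal action in a fixed enumeration is well defined and measurable in
the state. -/
theorem exists_isMaximizer (hf : ∀ a, Measurable fun z => m.f z a) (hg : Measurable m.g)
    {v : m.TState → ℝ} (hv : Measurable v) : ∃ F : m.DecisionRule, m.IsMaximizer v F := by
  classical
  obtain ⟨e, he⟩ := exists_surjective_nat (Action M)
  let P : ℕ → m.TState → Prop := fun n p => e n ∈ p.2.admissible ∧
    ∀ c, c ∈ p.2.admissible → m.actionValue v p c ≤ m.actionValue v p (e n)
  have hadm : ∀ c : Action M, MeasurableSet {p : m.TState | c ∈ p.2.admissible} := fun c =>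
    measurable_snd (Book.measurableSet_admissible c)
  have hP : ∀ n, MeasurableSet {p | P n p} := fun n => by
    refine (hadm _).inter ?_
    have : {p : m.TState | ∀ c, c ∈ p.2.admissible →
        m.actionValue v p c ≤ m.actionValue v p (e n)} =
        ⋂ c, ({p : m.TState | c ∈ p.2.admissible}ᶜ ∪
          {p | m.actionValue v p c ≤ m.actionValue v p (e n)}) := by
      ext p; simp [imp_iff_not_or]
    change MeasurableSet {p : m.TState | ∀ c, c ∈ p.2.admissible →
        m.actionValue v p c ≤ m.actionValue v p (e n)}
    rw [this]
    exact MeasurableSet.iInter fun c => (hadm c).compl.union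
      (measurableSet_le (m.measurable_actionValue hf hg hv c)
        (m.measurable_actionValue hf hg hv (e n)))
  have hex : ∀ p, ∃ n, P n p := fun p => by
    obtain ⟨c, hc, hmax⟩ := p.2.admissible_finite.exists_maximalFor (m.actionValue v p) _
      p.2.admissible_nonempty
    obtain ⟨n, rfl⟩ := he c
    exact ⟨n, hc, fun c' hc' => (le_total _ _).elim id fun h => hmax hc' h⟩
  refine ⟨⟨fun p => e (Nat.find (hex p)),
    Measurable.find (f := fun n _ => e n) (fun n => measurable_const) hP hex,
    fun p => (Nat.find_spec (hex p)).1⟩, fun p => ?_⟩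
  have h := Nat.find_spec (hex p)
  exact le_antisymm (m.actionValue_le_bellman v p h.1) (m.bellman_le v p h.2)

theorem measurable_bellman (hf : ∀ a, Measurable fun z => m.f z a) (hg : Measurable m.g)
    {v : m.TState → ℝ} (hv : Measurable v) : Measurable (m.bellman v) := by
  obtain ⟨F, hF⟩ := m.exists_isMaximizer hf hg hv
  have h : Measurable fun q : m.TState × Action M => m.actionValue v q.1 q.2 :=
    measurable_from_prod_countable_left fun c => m.measurable_actionValue hf hg hv c
  have h2 : m.bellman v = fun p => m.actionValue v p (F.act p) := funext fun p => (hF p).symm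
  rw [h2]
  exact h.comp (measurable_id.prodMk F.measurable_act)

/-- The one-stage rewards cancel, and a supremum is 1-Lipschitz. -/
theorem abs_bellman_sub_le {v w : m.TState → ℝ} (p : m.TState) {D : ℝ}
    (h : ∀ c ∈ p.2.admissible, |∫ q, v q ∂(m.Q p c) - ∫ q, w q ∂(m.Q p c)| ≤ D) :
    |m.bellman v p - m.bellman w p| ≤ D := by
  rw [abs_sub_le_iff, sub_le_iff_le_add, sub_le_iff_le_add]
  refine ⟨m.bellman_le v p fun c hc => ?_, m.bellman_le w p fun c hc => ?_⟩
  · have h1 := m.actionValue_le_bellman w p hc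
    have h2 := (abs_sub_le_iff.1 (h c hc)).1
    unfold actionValue at *; linarith
  · have h1 := m.actionValue_le_bellman v p hc
    have h2 := (abs_sub_le_iff.1 (h c hc)).2
    unfold actionValue at *; linarith

/-! ### Contraction and existence of the fixed point -/

namespace IsLyapunov

variable {m} {W : m.TState → ℝ} {κ C : ℝ}

theorem weight_nonneg (hW : m.IsLyapunov W κ C) (p : m.TState) : 0 ≤ W p :=
  zero_le_one.trans (hW.one_le p)

theorem abs_r_le (hW : m.IsLyapunov W κ C) (p : m.TState) {c : Action M} (hc : c ∈ p.2.admissible) :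
    |m.r p c| ≤ C * (m.T + 1) * W p := by
  have hτ : 0 ≤ m.T - p.1 := sub_nonneg.2 p.1.2.2
  have hl : (0 : ℝ) ≤ m.rate p.2 := NNReal.coe_nonneg _
  have h1 := meanSojourn_nonneg hl hτ
  have h2 : meanSojourn (m.rate p.2) (m.T - p.1) ≤ m.T :=
    (meanSojourn_le hl).trans (by linarith [p.1.2.1])
  have h3 : Real.exp (-(m.rate p.2 * (m.T - p.1))) ≤ 1 := by
    rw [Real.exp_le_one_iff, neg_nonpos]; positivity
  have h4 := hW.weight_nonneg p
  have h5 := hW.const_nonneg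
  unfold r
  refine (abs_add_le _ _).trans ?_
  rw [abs_mul, abs_mul, abs_of_nonneg h1, abs_of_nonneg (Real.exp_pos _).le]
  calc _ ≤ C * W p * m.T + 1 * (C * W p) := by
        gcongr
        · exact hW.running_le p c hc
        · exact hW.terminal_le p c hc
    _ = _ := by ring

theorem integrable_Q (hW : m.IsLyapunov W κ C) {v : m.TState → ℝ} (hv : Measurable v)
    {D : ℝ} (hD : 0 ≤ D) (hle : ∀ p, |v p| ≤ D * W p) (p : m.TState) {c : Action M}
    (hc : c ∈ p.2.admissible) :
    Integrable v (m.Q p c) ∧ |∫ q, v q ∂(m.Q p c)| ≤ D * (κ * W p) :=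
  integrable_and_abs_integral_le hv.aestronglyMeasurable hD
    (mul_nonneg hW.nonneg (hW.weight_nonneg p)) (Filter.Eventually.of_forall hle)
    (hW.lintegral_le p c hc)

theorem abs_bellman_sub_le (hW : m.IsLyapunov W κ C) {v w : m.TState → ℝ} (hv : Measurable v)
    (hw : Measurable w) {D₁ D₂ D : ℝ} (hD₁ : 0 ≤ D₁) (hD₂ : 0 ≤ D₂) (hD : 0 ≤ D)
    (hvb : ∀ p, |v p| ≤ D₁ * W p) (hwb : ∀ p, |w p| ≤ D₂ * W p)
    (hle : ∀ p, |v p - w p| ≤ D * W p) (p : m.TState) :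
    |m.bellman v p - m.bellman w p| ≤ D * κ * W p := by
  refine m.abs_bellman_sub_le p fun c hc => ?_
  rw [← integral_sub (hW.integrable_Q hv hD₁ hvb p hc).1 (hW.integrable_Q hw hD₂ hwb p hc).1]
  exact (hW.integrable_Q (hv.sub hw) hD hle p hc).2.trans_eq (by ring)

/-- Banach iteration from zero for the norm weighted by `W`, carried out pointwise: successive
differences at `p` are at most `D * κ ^ n * W p`. -/
theorem exists_fixedPoint (hW : m.IsLyapunov W κ C) (hf : ∀ a, Measurable fun z => m.f z a)
    (hg : Measurable m.g) (hT : 0 ≤ m.T) :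
    ∃ v : m.TState → ℝ, Measurable v ∧ (∃ D, 0 ≤ D ∧ ∀ p, |v p| ≤ D * W p) ∧ m.bellman v = v := by
  have hκ := hW.nonneg
  have hκ1 := hW.lt_one
  set R := C * (m.T + 1) with hR
  have hR0 : 0 ≤ R := mul_nonneg hW.const_nonneg (by linarith)
  -- Radius of the invariant ball: `R` bounds the image of zero, and R + κD = D.
  set D := R / (1 - κ) with hD
  have hD0 : 0 ≤ D := div_nonneg hR0 (by linarith)
  have hDR : R + D * κ = D := by
    have : 1 - κ ≠ 0 := by linarith
    rw [hD]; field_simp; ring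
  let u : ℕ → m.TState → ℝ := fun n => m.bellman^[n] 0
  have hu : ∀ n, u (n + 1) = m.bellman (u n) := fun n => Function.iterate_succ_apply' _ _ _
  have hmeas : ∀ n, Measurable (u n) := fun n => by
    induction n with
    | zero => exact measurable_zero
    | succ n ih => rw [hu]; exact m.measurable_bellman hf hg ih
  have hzero : ∀ p, |m.bellman 0 p| ≤ R * W p := fun p => by
    obtain ⟨c, hc⟩ := p.2.admissible_nonempty
    have hav : ∀ c, m.actionValue 0 p c = m.r p c := fun c => by simp [actionValue]
    rw [abs_le]
    refine ⟨?_, m.bellman_le 0 p fun c hc => ?_⟩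
    · refine (abs_le.1 (hW.abs_r_le p hc)).1.trans ?_
      rw [← hav]
      exact m.actionValue_le_bellman 0 p hc
    · rw [hav]; exact (abs_le.1 (hW.abs_r_le p hc)).2
  have hbd : ∀ v : m.TState → ℝ, Measurable v → (∀ p, |v p| ≤ D * W p) →
      ∀ p, |m.bellman v p| ≤ D * W p := fun v hv hle p => by
    have h1 := hW.abs_bellman_sub_le hv measurable_zero hD0 le_rfl hD0 hle (by simp)
      (by simpa using hle) p
    have h2 := abs_sub_abs_le_abs_sub (m.bellman v p) (m.bellman 0 p)
    have h3 := hzero p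
    have h4 : R * W p + D * κ * W p = D * W p := by rw [← add_mul, hDR]
    have h5 : |m.bellman v p| ≤ D * κ * W p + R * W p := by
      simp only [Pi.zero_def] at *
      linarith
    linarith
  have hub : ∀ n p, |u n p| ≤ D * W p := fun n => by
    induction n with
    | zero => exact fun p => by simpa [u] using mul_nonneg hD0 (hW.weight_nonneg p)
    | succ n ih => rw [hu]; exact hbd _ (hmeas n) ih
  have hstep : ∀ n p, |u n p - u (n + 1) p| ≤ D * κ ^ n * W p := fun n => by
    induction n with
    | zero => exact fun p => by simpa [u] using hub 1 p
    | succ n ih =>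
      intro p
      rw [hu n, hu (n + 1)]
      refine (hW.abs_bellman_sub_le (hmeas n) (hmeas (n + 1)) hD0 hD0 (by positivity) (hub n)
        (hub (n + 1)) ih p).trans_eq ?_
      rw [pow_succ]; ring
  have hgeo : ∀ p n, dist (u n p) (u (n + 1) p) ≤ D * W p * κ ^ n := fun p n => by
    rw [Real.dist_eq]; exact (hstep n p).trans_eq (by ring)
  choose v hv using fun p => cauchySeq_tendsto_of_complete (cauchySeq_of_le_geometric κ _ hκ1
    (hgeo p))
  have hvm : Measurable v := measurable_of_tendsto_metrizable hmeas (tendsto_pi_nhds.2 hv)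
  have hvb : ∀ p, |v p| ≤ D * W p := fun p =>
    le_of_tendsto (hv p).abs (Filter.Eventually.of_forall fun n => hub n p)
  have hconv : ∀ n p, |u n p - v p| ≤ D / (1 - κ) * κ ^ n * W p := fun n p => by
    have := dist_le_of_le_geometric_of_tendsto κ _ hκ1 (hgeo p) (hv p) n
    rw [Real.dist_eq] at this
    exact this.trans_eq (by ring)
  refine ⟨v, hvm, ⟨D, hD0, hvb⟩, funext fun p => ?_⟩
  have hD1 : 0 ≤ D / (1 - κ) := div_nonneg hD0 (by linarith)
  have h1 : ∀ n, |u (n + 1) p - m.bellman v p| ≤ D / (1 - κ) * κ ^ n * κ * W p := fun n => by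
    rw [hu]
    exact hW.abs_bellman_sub_le (hmeas n) hvm hD0 hD0 (by positivity) (hub n) hvb (hconv n) p
  have h2 : Filter.Tendsto (fun n => u (n + 1) p) Filter.atTop (nhds (m.bellman v p)) := by
    rw [tendsto_iff_dist_tendsto_zero]
    refine squeeze_zero (fun _ => dist_nonneg) (fun n => (Real.dist_eq _ _).trans_le (h1 n)) ?_
    have := (((tendsto_pow_atTop_nhds_zero_of_lt_one hκ hκ1).const_mul (D / (1 - κ))).mul_const
      κ).mul_const (W p)
    simpa using this
  exact tendsto_nhds_unique h2 ((hv p).comp (Filter.tendsto_add_atTop_nat 1))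

end IsLyapunov

end Model

namespace Model

variable {K M : ℕ} (m : Model K M)

/-! ## Uniqueness of the fixed point -/

theorem ae_lt_Q (p : m.TState) (c : Action M) : ∀ᵐ q ∂(m.Q p c), p.1 < q.1 :=
  Measure.quasiMeasurePreserving_fst.ae (m.ae_lt_jumpTime p)

theorem bound_pos (γ₀ : ℝ) (p : m.TState) : 0 < m.bound γ₀ p := by
  refine mul_pos ?_ (Real.exp_pos _)
  have : 0 ≤ p.2.normSq := by
    have h1 : 0 ≤ ∑ i, ((p.2.ask.vol i : ℝ) ^ 2 + (p.2.bid.vol i : ℝ) ^ 2) :=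
      Finset.sum_nonneg fun _ _ => by positivity
    have h2 : 0 ≤ ∑ j, ((p.2.ask.pos j : ℝ) ^ 2 + (p.2.bid.pos j : ℝ) ^ 2
        + (p.2.ask.rank j : ℝ) ^ 2 + (p.2.bid.rank j : ℝ) ^ 2) :=
      Finset.sum_nonneg fun _ _ => by positivity
    unfold Book.normSq
    positivity
  linarith

theorem exists_le_of_mem_weightedSpace {γ₀ : ℝ} {v : m.TState → ℝ} (hv : v ∈ m.weightedSpace γ₀) :
    ∃ D, 0 ≤ D ∧ ∀ p, |v p| ≤ D * m.bound γ₀ p := by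
  obtain ⟨D, hD⟩ := hv.2
  refine ⟨max D 0, le_max_right _ _, fun p => ?_⟩
  rw [← div_le_iff₀ (m.bound_pos γ₀ p)]
  exact (hD ⟨p, rfl⟩).trans (le_max_left _ _)

theorem mem_weightedSpace {γ₀ : ℝ} {v : m.TState → ℝ} (hv : Measurable v) {D : ℝ}
    (h : ∀ p, |v p| ≤ D * m.bound γ₀ p) : v ∈ m.weightedSpace γ₀ := by
  refine ⟨hv, D, ?_⟩
  rintro _ ⟨p, rfl⟩
  exact (div_le_iff₀ (m.bound_pos γ₀ p)).2 (h p)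

/-- The factor T - t is replaced by T, which leaves an exponent constant in time. -/
theorem bound_le_weight {γ₀ : ℝ} (hγ₀ : 0 < γ₀) {L η C : ℝ}
    (hC : ∀ z : Book K M, 1 + z.normSq ≤ C * z.growth L η) (p : m.TState) :
    m.bound γ₀ p ≤ C * m.weight L η (fun _ => γ₀ * (4 * K + 2) * m.Lam * m.T) p := by
  have h1 : γ₀ * (4 * K + 2) * m.Lam * (1 + size p.2.ask.vol p.2.bid.vol) * (m.T - p.1) ≤
      γ₀ * (4 * K + 2) * m.Lam * m.T * (1 + p.2.shares) := by
    have h2 := m.Lam_nonneg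
    have h3 := p.1.2.1
    have h4 := p.2.shares_nonneg
    have h5 : m.T - p.1 ≤ m.T := by linarith
    calc _ = γ₀ * (4 * K + 2) * m.Lam * (1 + p.2.shares) * (m.T - p.1) := rfl
      _ ≤ γ₀ * (4 * K + 2) * m.Lam * (1 + p.2.shares) * m.T := by gcongr
      _ = _ := by ring
  have h0 : 0 ≤ C * p.2.growth L η := by
    have := m.bound_pos γ₀ p
    rw [bound] at this
    exact (pos_of_mul_pos_left this (Real.exp_pos _).le).le.trans (hC p.2)
  rw [weight, ← mul_assoc, bound]
  exact mul_le_mul (hC p.2) (Real.exp_le_exp.2 h1) (Real.exp_pos _).le h0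

/-- With a constant exponent there is no contraction, but the rate condition holds with equality for
a finite factor, and integrability needs no more. -/
theorem integrable_Q_of_le_weight {L η ε : ℝ} (hL : 0 ≤ L) (hη : 0 ≤ η) (hε : 0 ≤ ε)
    (hG : ∀ z w : Book K M, Book.Near m.stepBound z w → w.growth L η ≤ (1 + ε) * z.growth L η)
    {ρ₀ : ℝ} (hρ₀ : 0 ≤ ρ₀) {v : m.TState → ℝ} (hv : Measurable v) {D : ℝ} (hD : 0 ≤ D)
    (hle : ∀ p, |v p| ≤ D * m.weight L η (fun _ => ρ₀) p) (p : m.TState) {c : Action M}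
    (hc : c ∈ p.2.admissible) : Integrable v (m.Q p c) := by
  have h := m.lintegral_weight_le (θ := m.T) (κ := (1 + ε) * Real.exp (ρ₀ * m.stepBound)) hL hη hε
    (by positivity) (fun u => hasDerivAt_const u ρ₀) continuous_const hG p hc p.1.2.2 le_rfl
    (fun _ _ => hρ₀) fun u _ _ => le_of_eq (by ring)
  have hw : 0 ≤ m.weight L η (fun _ => ρ₀) p :=
    (hL.trans (p.2.le_growth hη)).trans (m.growth_le_weight hL hη p hρ₀)
  refine (integrable_and_abs_integral_le hv.aestronglyMeasurable hD
    (H := (1 + ε) * Real.exp (ρ₀ * m.stepBound) * m.weight L η (fun _ => ρ₀) p) (by positivity)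
    (Filter.Eventually.of_forall hle) ?_).1
  refine le_trans (le_of_eq (lintegral_congr fun q => ?_)) h
  rw [if_pos q.1.2.2]

/-- Two fixed points that agree after the time `θ` agree after the time `θ - 1 / N`, for a constant
`N` that does not depend on `θ`. -/
theorem eq_of_bellman_eq_of_lt {L η C ρ₀ N : ℝ} (hL : 0 ≤ L) (hη : 0 ≤ η) (hC : 0 ≤ C)
    (hlam : m.LinearIntensities)
    (hG : ∀ z w : Book K M, Book.Near m.stepBound z w → w.growth L η ≤ (1 + 1) * z.growth L η)
    (hρ₀ : 0 ≤ ρ₀) (hN : 0 < N)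
    (hNle : 4 * m.Lam * Real.exp ((ρ₀ + 1) * m.stepBound) ≤ N) {v w : m.TState → ℝ}
    (hv : Measurable v) (hw : Measurable w)
    (hvi : ∀ p, ∀ c ∈ p.2.admissible, Integrable v (m.Q p c))
    (hwi : ∀ p, ∀ c ∈ p.2.admissible, Integrable w (m.Q p c))
    (hvf : m.bellman v = v) (hwf : m.bellman w = w)
    (hle : ∀ p, |v p - w p| ≤ C * m.weight L η (fun _ => ρ₀) p) {θ : ℝ} (hθ : θ ≤ m.T)
    (heq : ∀ p : m.TState, θ < p.1 → v p = w p) (p : m.TState) (hp : θ - 1 / N < p.1) :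
    v p = w p := by
  -- The slope `N` supplies the decay that yields the factor 1/2, and a slab of length `1 / N`
  -- raises the exponent by at most one, so `N` can be chosen beforehand.
  set ρ : ℝ → ℝ := fun u => ρ₀ + N * (θ - u) with hρ
  have hd : ∀ u, HasDerivAt ρ (-N) u := fun u =>
    ((((hasDerivAt_id u).const_sub θ).const_mul N).const_add ρ₀).congr_deriv (by ring)
  have hρ0 : ∀ u ≤ θ, ρ₀ ≤ ρ u := fun u hu => by
    have : 0 ≤ N * (θ - u) := mul_nonneg hN.le (sub_nonneg.2 hu)
    simp only [hρ]; linarith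
  have hgr : ∀ q : m.TState, 0 ≤ q.2.growth L η := fun q => hL.trans (q.2.le_growth hη)
  have hw0 : ∀ q : m.TState, 0 ≤ m.weight L η ρ q := fun q =>
    mul_nonneg (hgr q) (Real.exp_pos _).le
  have hww : ∀ q : m.TState, (q.1 : ℝ) ≤ θ →
      m.weight L η (fun _ => ρ₀) q ≤ m.weight L η ρ q := fun q hq => by
    refine mul_le_mul_of_nonneg_left (Real.exp_le_exp.2 ?_) (hgr q)
    have := q.2.shares_nonneg
    exact mul_le_mul_of_nonneg_right (hρ0 _ hq) (by linarith)
  -- The difference is halved by each use of the fixed point equations. It vanishes after `θ`, so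
  -- only jumps up to `θ` count; jumps go forward in time and hence never leave the slab to the
  -- left.
  have key : ∀ n : ℕ, ∀ q : m.TState, θ - 1 / N < q.1 →
      |v q - w q| ≤ C * (1 / 2) ^ n * if (q.1 : ℝ) ≤ θ then m.weight L η ρ q else 0 := by
    intro n
    induction n with
    | zero =>
      intro q hq
      split_ifs with h
      · simpa using (hle q).trans (mul_le_mul_of_nonneg_left (hww q h) hC)
      · simp [heq q (not_le.1 h)]
    | succ n ih =>
      intro q hq
      split_ifs with h
      · have hCn : 0 ≤ C * (1 / 2 : ℝ) ^ n := by positivity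
        rw [← hvf, ← hwf]
        refine m.abs_bellman_sub_le q fun c hc => ?_
        rw [← integral_sub (hvi q c hc) (hwi q c hc)]
        have h1 := m.lintegral_weight_le (θ := θ) (ε := 1) (κ := 1 / 2) hL hη zero_le_one
          (by norm_num) hd continuous_const hG q hc h hθ (fun u hu => hρ₀.trans (hρ0 u hu))
          (fun u hu hu' => ?_)
        · refine (integrable_and_abs_integral_le (hv.sub hw).aestronglyMeasurable hCn
            (H := 1 / 2 * m.weight L η ρ q) (mul_nonneg (by norm_num) (hw0 q))
            (h := fun x : m.TState =>
              if (x.1 : ℝ) ≤ θ then m.weight L η ρ x else 0) ?_ ?_).2.trans_eq ?_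
          · filter_upwards [m.ae_lt_Q q c] with x hx
            exact ih x (hq.trans hx)
          · refine le_trans (le_of_eq (lintegral_congr fun x => ?_)) h1
            split_ifs <;> simp
          · rw [pow_succ]; ring
        · have hS := q.2.shares_nonneg
          have hB := m.two_le_stepBound
          have hΛ := m.Lam_nonneg
          have e1 : ρ u ≤ ρ₀ + 1 := by
            have : N * (θ - u) ≤ N * (1 / N) := by gcongr; linarith
            rw [mul_one_div_cancel hN.ne'] at this
            simp only [hρ]; linarith
          have e2 : Real.exp (ρ u * m.stepBound) ≤ Real.exp ((ρ₀ + 1) * m.stepBound) :=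
            Real.exp_le_exp.2 (mul_le_mul_of_nonneg_right e1 (by linarith))
          have e3 : (m.rate q.2 : ℝ) ≤ m.Lam * (1 + q.2.shares) := by
            have := m.rate_le hlam q.2
            linarith
          have e4 : (m.rate q.2 : ℝ) * Real.exp (ρ u * m.stepBound) ≤
              m.Lam * (1 + q.2.shares) * Real.exp ((ρ₀ + 1) * m.stepBound) := by gcongr
          have e5 := mul_le_mul_of_nonneg_right hNle (by linarith : 0 ≤ 1 + q.2.shares)
          have e6 : (0 : ℝ) ≤ m.rate q.2 := NNReal.coe_nonneg _
          linarith
      · simp [heq q (not_le.1 h)]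
  by_cases h : (p.1 : ℝ) ≤ θ
  · have h1 : ∀ n : ℕ, |v p - w p| ≤ C * (1 / 2) ^ n * m.weight L η ρ p := fun n => by
      simpa [h] using key n p hp
    have h2 : Filter.Tendsto (fun n : ℕ => C * (1 / 2 : ℝ) ^ n * m.weight L η ρ p) Filter.atTop
        (nhds 0) := by
      simpa using ((tendsto_pow_atTop_nhds_zero_of_lt_one (by norm_num : (0 : ℝ) ≤ 1 / 2)
        (by norm_num)).const_mul C).mul_const (m.weight L η ρ p)
    have h3 := ge_of_tendsto' h2 h1
    exact sub_eq_zero.1 (abs_nonpos_iff.1 h3)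
  · exact heq p (not_le.1 h)

/-- All slabs have the same length `1 / N`, so finitely many cover the time interval; the induction
starts from the void condition that the time exceeds the horizon. -/
theorem eq_of_bellman_eq (hlam : m.LinearIntensities) (hT : 0 ≤ m.T) {γ₀ : ℝ} (hγ₀ : 0 < γ₀)
    {v w : m.TState → ℝ} (hv : v ∈ m.weightedSpace γ₀) (hw : w ∈ m.weightedSpace γ₀)
    (hvf : m.bellman v = v) (hwf : m.bellman w = w) : v = w := by
  obtain ⟨L, η, hL, hη, hG⟩ := Book.exists_growth_le K M m.stepBound (one_pos (α := ℝ))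
  obtain ⟨C, hC, hlow⟩ := Book.normSq_le K M hL hη
  obtain ⟨D₁, hD₁, hvb⟩ := m.exists_le_of_mem_weightedSpace hv
  obtain ⟨D₂, hD₂, hwb⟩ := m.exists_le_of_mem_weightedSpace hw
  have hΛ := m.Lam_nonneg
  have hL0 : 0 ≤ L := by linarith
  set ρ₀ := γ₀ * (4 * K + 2) * m.Lam * m.T with hρ₀
  have hρ₀0 : 0 ≤ ρ₀ := by positivity
  have hb := m.bound_le_weight hγ₀ hlow
  have hv' : ∀ p, |v p| ≤ D₁ * C * m.weight L η (fun _ => ρ₀) p := fun p =>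
    (hvb p).trans ((mul_le_mul_of_nonneg_left (hb p) hD₁).trans_eq (mul_assoc _ _ _).symm)
  have hw' : ∀ p, |w p| ≤ D₂ * C * m.weight L η (fun _ => ρ₀) p := fun p =>
    (hwb p).trans ((mul_le_mul_of_nonneg_left (hb p) hD₂).trans_eq (mul_assoc _ _ _).symm)
  have hvi := fun p c (hc : c ∈ p.2.admissible) => m.integrable_Q_of_le_weight hL0 hη.le
    zero_le_one hG hρ₀0 hv.1 (by positivity) hv' p hc
  have hwi := fun p c (hc : c ∈ p.2.admissible) => m.integrable_Q_of_le_weight hL0 hη.le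
    zero_le_one hG hρ₀0 hw.1 (by positivity) hw' p hc
  -- The summand 1 keeps `N` positive even if all intensities vanish.
  set N := 4 * m.Lam * Real.exp ((ρ₀ + 1) * m.stepBound) + 1 with hN
  have hN0 : 0 < N := by positivity
  have key : ∀ k : ℕ, ∀ p : m.TState, m.T - k * (1 / N) < p.1 → v p = w p := by
    intro k
    induction k with
    | zero => intro p hp; exact absurd p.1.2.2 (not_le.2 (by simpa using hp))
    | succ k ih =>
      intro p hp
      refine m.eq_of_bellman_eq_of_lt (C := D₁ * C + D₂ * C) hL0 hη.le (by positivity) hlam hG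
        hρ₀0 hN0 (by linarith) hv.1 hw.1 hvi hwi hvf hwf (fun q => ?_)
        (θ := m.T - k * (1 / N)) (sub_le_self _ (by positivity)) ih p ?_
      · refine (abs_sub _ _).trans ?_
        linarith [hv' q, hw' q]
      · push_cast at hp; linarith
  funext p
  obtain ⟨k, hk⟩ := exists_nat_gt (m.T * N)
  refine key k p (lt_of_lt_of_le ?_ p.1.2.1)
  rw [mul_one_div, sub_neg, lt_div_iff₀ hN0]
  exact hk

end Model

namespace Model

variable {K M : ℕ} (m : Model K M)

/-! ## The chain of jump times and states -/

instance : MeasurableSingletonClass (Book K M) :=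
  ⟨fun z => by
    have h := (Book.measurableEquivProd K M).measurable
      (measurableSet_singleton (Book.measurableEquivProd K M z))
    convert h
    ext w
    simp⟩

instance (π : m.Strategy) (p : m.TState) : IsProbabilityMeasure (m.law π p) := by
  unfold law; infer_instance

/-- The history `(T₀, Z₀, …, Tₙ, Zₙ)` of a trajectory. -/
abbrev hist (n : ℕ) (ω : ℕ → m.XState) : m.Hist n := fun i => ω i

theorem measurable_hist (n : ℕ) : Measurable (m.hist n) :=
  measurable_pi_lambda _ fun _ => measurable_pi_apply _

/-- Defining property of the Ionescu-Tulcea measure; every one-step conditioning below goes through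
this disintegration. -/
theorem map_hist_law_compProd (π : m.Strategy) (p : m.TState) (n : ℕ) :
    ((m.law π p).map (m.hist n)) ⊗ₘ (m.kernel π n) =
      (m.law π p).map fun ω => (m.hist n ω, ω (n + 1)) := by
  have h := Kernel.partialTraj_compProd_eq_map_traj (X := fun _ => m.XState) (κ := m.kernel π)
    (Nat.zero_le n) (x₀ := fun _ => Sum.inl p)
  rw [← Kernel.traj_map_frestrictLe_apply] at h
  exact h

theorem measurable_hist_succ (n : ℕ) :
    Measurable fun ω : ℕ → m.XState => (m.hist n ω, ω (n + 1)) :=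
  (m.measurable_hist n).prodMk (measurable_pi_apply _)

theorem lintegral_law_succ (π : m.Strategy) (p : m.TState) (n : ℕ) {H : m.Hist n × m.XState → ℝ≥0∞}
    (hH : Measurable H) :
    ∫⁻ ω, H (m.hist n ω, ω (n + 1)) ∂(m.law π p) =
      ∫⁻ ω, ∫⁻ x, H (m.hist n ω, x) ∂(m.stepX (ω n) (π.act n (m.hist n ω))) ∂(m.law π p) := by
  rw [← lintegral_map hH (m.measurable_hist_succ n), ← m.map_hist_law_compProd,
    Measure.lintegral_compProd hH,
    lintegral_map hH.lintegral_kernel_prod_right' (m.measurable_hist n)]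
  rfl

theorem integral_law_succ (π : m.Strategy) (p : m.TState) (n : ℕ) {H : m.Hist n × m.XState → ℝ}
    (hH : Measurable H) (hi : Integrable (fun ω => H (m.hist n ω, ω (n + 1))) (m.law π p)) :
    ∫ ω, H (m.hist n ω, ω (n + 1)) ∂(m.law π p) =
      ∫ ω, ∫ x, H (m.hist n ω, x) ∂(m.stepX (ω n) (π.act n (m.hist n ω))) ∂(m.law π p) := by
  have hi' : Integrable H (((m.law π p).map (m.hist n)) ⊗ₘ (m.kernel π n)) := by
    rw [m.map_hist_law_compProd]
    exact (integrable_map_measure hH.aestronglyMeasurable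
      (m.measurable_hist_succ n).aemeasurable).2 hi
  rw [← integral_map (m.measurable_hist_succ n).aemeasurable hH.aestronglyMeasurable,
    ← m.map_hist_law_compProd, Measure.integral_compProd hi', integral_map
      (m.measurable_hist n).aemeasurable
      hH.stronglyMeasurable.integral_kernel_prod_right'.aestronglyMeasurable]
  rfl

/-- The complement has zero conditional probability given every history, hence zero probability. -/
theorem ae_law_succ (π : m.Strategy) (p : m.TState) (n : ℕ) {A : Set (m.Hist n × m.XState)}
    (hA : MeasurableSet A)
    (h : ∀ ω : ℕ → m.XState, ∀ᵐ x ∂(m.stepX (ω n) (π.act n (m.hist n ω))), (m.hist n ω, x) ∈ A) :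
    ∀ᵐ ω ∂(m.law π p), (m.hist n ω, ω (n + 1)) ∈ A := by
  have h1 := m.lintegral_law_succ π p n (H := Aᶜ.indicator 1) (measurable_one.indicator hA.compl)
  have h2 : ∀ ω : ℕ → m.XState, ∫⁻ x, Aᶜ.indicator 1 (m.hist n ω, x)
      ∂(m.stepX (ω n) (π.act n (m.hist n ω))) = 0 := fun ω => by
    refine (lintegral_congr_ae ?_).trans lintegral_zero
    filter_upwards [h ω] with x hx
    simp [hx]
  simp only [h2, lintegral_zero] at h1
  have h3 : Measurable fun ω : ℕ → m.XState =>
      (Aᶜ.indicator 1 (m.hist n ω, ω (n + 1)) : ℝ≥0∞) :=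
    (measurable_one.indicator hA.compl).comp (m.measurable_hist_succ n)
  rw [lintegral_eq_zero_iff h3] at h1
  filter_upwards [h1] with ω hω
  by_contra hn
  simp [hn] at hω

theorem ae_law_zero (π : m.Strategy) (p : m.TState) : ∀ᵐ ω ∂(m.law π p), ω 0 = Sum.inl p := by
  have h : (m.law π p).map (m.hist 0) = Measure.dirac fun _ => Sum.inl p := by
    have := Kernel.traj_map_frestrictLe_apply (X := fun _ => m.XState) (κ := m.kernel π) 0 0
      (fun _ => Sum.inl p)
    rw [Kernel.partialTraj_self, Kernel.id_apply] at this
    exact this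
  have h2 : (m.law π p).map (fun ω => ω 0) = Measure.dirac (Sum.inl p) := by
    have h3 : (fun ω : ℕ → m.XState => ω 0) =
      (fun x : m.Hist 0 => x ⟨0, Finset.mem_Iic.2 le_rfl⟩) ∘ m.hist 0 := rfl
    rw [h3, ← Measure.map_map (measurable_pi_apply _) (m.measurable_hist 0), h,
      Measure.map_dirac' (measurable_pi_apply _)]
  have hs : MeasurableSet ({Sum.inl p}ᶜ : Set m.XState) := by
    rw [← Set.image_singleton]
    exact (measurableSet_inl_image.2 (measurableSet_singleton p)).compl
  have h4 : (m.law π p).map (fun ω => ω 0) {Sum.inl p}ᶜ = 0 := by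
    rw [h2, Measure.dirac_apply' _ hs]; simp
  rw [Measure.map_apply (measurable_pi_apply 0) hs] at h4
  exact h4

/-! ### One-step integrals and the mean reward between two jumps -/

theorem lintegral_stepX_inl (p : m.TState) (c : Action M) {φ : m.XState → ℝ≥0∞}
    (hφ : Measurable φ) : ∫⁻ x, φ x ∂(m.stepX (Sum.inl p) c) = ∫⁻ q, φ (Sum.inl q) ∂(m.Q p c) +
      ENNReal.ofReal (Real.exp (-(m.rate p.2 * (m.T - p.1)))) * φ (Sum.inr ()) := by
  simp only [stepX, step]
  rw [lintegral_add_measure, lintegral_map hφ measurable_inl, lintegral_smul_measure,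
    lintegral_dirac' _ hφ, smul_eq_mul]

theorem integral_stepX_inl (p : m.TState) (c : Action M) {φ : m.XState → ℝ}
    (hφ : Measurable φ) (hi : Integrable (fun q => φ (Sum.inl q)) (m.Q p c)) :
    ∫ x, φ x ∂(m.stepX (Sum.inl p) c) = ∫ q, φ (Sum.inl q) ∂(m.Q p c) +
      Real.exp (-(m.rate p.2 * (m.T - p.1))) * φ (Sum.inr ()) := by
  simp only [stepX, step]
  rw [integral_add_measure, integral_map measurable_inl.aemeasurable hφ.aestronglyMeasurable,
    integral_smul_measure, integral_dirac' _ _ hφ.stronglyMeasurable,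
    ENNReal.toReal_ofReal (Real.exp_pos _).le, smul_eq_mul]
  · exact (integrable_map_measure hφ.aestronglyMeasurable measurable_inl.aemeasurable).2 hi
  · refine Integrable.smul_measure ?_ ENNReal.ofReal_ne_top
    exact integrable_dirac' hφ.stronglyMeasurable (by simp)

theorem integral_stepX_inr (u : Unit) (c : Action M) {φ : m.XState → ℝ} (hφ : Measurable φ) :
    ∫ x, φ x ∂(m.stepX (Sum.inr u) c) = φ (Sum.inr ()) := by
  simp only [stepX]
  exact integral_dirac' _ _ hφ.stronglyMeasurable

/-- The time of a jump, read as `T` at the cemetery. -/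
def time : m.XState → ℝ := Sum.elim (fun q => (q.1 : ℝ)) fun _ => m.T

/-- The indicator of the cemetery. -/
def dead : m.XState → ℝ := Sum.elim (fun _ => 0) fun _ => 1

/-- The running reward rate under the decision `c`, zero at the cemetery. -/
def running (c : Action M) : m.XState → ℝ := Sum.elim (fun q => m.f (q.2.place c) c) fun _ => 0

/-- The terminal reward under the decision `c`, zero at the cemetery. -/
def terminal (c : Action M) : m.XState → ℝ := Sum.elim (fun q => m.g (q.2.place c)) fun _ => 0

/-- The reward collected between two successive jumps (or the last jump and the horizon). -/
def cost (c : Action M) (x x' : m.XState) : ℝ :=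
  m.running c x * (m.time x' - m.time x) + m.terminal c x * m.dead x'

theorem measurable_time : Measurable m.time :=
  Measurable.sumElim (measurable_subtype_coe.comp measurable_fst) measurable_const

theorem measurable_dead : Measurable m.dead :=
  Measurable.sumElim measurable_const measurable_const

theorem measurable_cost (hf : ∀ a, Measurable fun z => m.f z a) (hg : Measurable m.g) :
    Measurable fun q : (m.XState × m.XState) × Action M => m.cost q.2 q.1.1 q.1.2 := by
  refine measurable_from_prod_countable_left fun c => ?_
  have h1 : Measurable (m.running c) := Measurable.sumElim
    ((hf c).comp ((measurable_place c).comp measurable_snd)) measurable_const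
  have h2 : Measurable (m.terminal c) := Measurable.sumElim
    (hg.comp ((measurable_place c).comp measurable_snd)) measurable_const
  have h3 := m.measurable_time
  have h4 := m.measurable_dead
  simp only [cost]
  fun_prop

/-- The mean of min(S, τ), for S exponential and τ = T - t, minus the contribution e^{-λτ} τ of the
event without jump; obtained from an explicit antiderivative. -/
theorem lintegral_Q_sub (p : m.TState) (c : Action M) :
    ∫⁻ q, ENNReal.ofReal (q.1 - p.1) ∂(m.Q p c) = ENNReal.ofReal
      (meanSojourn (m.rate p.2) (m.T - p.1) -
        Real.exp (-(m.rate p.2 * (m.T - p.1))) * (m.T - p.1)) := by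
  have hm : Measurable fun u : ℝ => ENNReal.ofReal (u - p.1) := by fun_prop
  have hm' : Measurable fun q : m.TState => ENNReal.ofReal (q.1 - p.1) :=
    hm.comp (measurable_subtype_coe.comp measurable_fst)
  rw [Q, lintegral_prod _ hm'.aemeasurable]
  simp only [lintegral_const]
  have hm'' : Measurable fun u : Set.Icc (0 : ℝ) m.T => ENNReal.ofReal (u - p.1) :=
    hm.comp measurable_subtype_coe
  rw [lintegral_mul_const _ hm'']
  -- For zero rate the kernel vanishes, and the right side is τ - τ.
  by_cases hl : m.rate p.2 = 0
  · simp [jumpGoal, hl, meanSojourn]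
  rw [m.jumpGoal_univ _ _ hl, mul_one, m.lintegral_jumpTime p hm]
  set l : ℝ := ((m.rate p.2 : ℝ≥0) : ℝ) with hldef
  have hl0 : 0 < l := by
    have : 0 < m.rate p.2 := pos_iff_ne_zero.2 hl
    exact_mod_cast this
  set t : ℝ := p.1.val with ht
  have htT : t ≤ m.T := p.1.2.2
  have hc : Continuous fun u : ℝ => l * Real.exp (-(l * (u - t))) * (u - t) := by fun_prop
  have h_integral : ∫ u in t..m.T, l * Real.exp (-(l * (u - t))) * (u - t) =
      meanSojourn l (m.T - t) - Real.exp (-(l * (m.T - t))) * (m.T - t) := by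
    rw [intervalIntegral.integral_eq_sub_of_hasDerivAt
      (f := fun u => - Real.exp (-(l * (u - t))) / l - Real.exp (-(l * (u - t))) * (u - t)) _
      (hc.intervalIntegrable _ _)]
    · rw [meanSojourn, if_neg hl0.ne']
      simp only [sub_self, mul_zero, neg_zero, Real.exp_zero]; ring
    · intro u _
      have h0 : HasDerivAt (fun u => u - t) 1 u := (hasDerivAt_id u).sub_const t
      have h1 : HasDerivAt (fun u => Real.exp (-(l * (u - t))))
        (Real.exp (-(l * (u - t))) * -(l * 1)) u := ((h0.const_mul l).neg).exp
      refine ((h1.neg.div_const l).sub (h1.mul h0)).congr_deriv ?_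
      field_simp; ring
  rw [← h_integral, intervalIntegral.integral_of_le htT, ofReal_integral_eq_lintegral_ofReal]
  · refine setLIntegral_congr_fun measurableSet_Ioc fun u hu => ?_
    rw [← ENNReal.ofReal_mul (by positivity)]
  · exact hc.integrableOn_Icc.mono_set Set.Ioc_subset_Icc_self
  · refine (ae_restrict_iff' measurableSet_Ioc).2 (Filter.Eventually.of_forall fun u hu => ?_)
    have : 0 ≤ u - t := sub_nonneg.2 hu.1.le
    positivity

instance (p : m.TState) (c : Action M) : IsFiniteMeasure (m.Q p c) :=
  ⟨(m.Q_univ_le p c).trans_lt ENNReal.one_lt_top⟩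

theorem exp_mul_le_meanSojourn {l τ : ℝ} (hl : 0 ≤ l) :
    Real.exp (-(l * τ)) * τ ≤ meanSojourn l τ := by
  unfold meanSojourn
  split_ifs with h
  · simp [h]
  · have hl' : 0 < l := lt_of_le_of_ne hl (Ne.symm h)
    rw [← sub_div, le_div_iff₀ hl']
    have h1 := Real.add_one_le_exp (l * τ)
    have h2 : Real.exp (l * τ) * Real.exp (-(l * τ)) = 1 := by rw [← Real.exp_add]; simp
    have h3 := mul_le_mul_of_nonneg_right h1 (Real.exp_pos (-(l * τ))).le
    linarith

/-- As `time` equals T at the cemetery, the elapsed time is min(S, T - t), with mean `meanSojourn`;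
the terminal reward is collected with the survival probability. -/
theorem integral_cost (p : m.TState) (c : Action M) :
    ∫ x, m.cost c (Sum.inl p) x ∂(m.stepX (Sum.inl p) c) = m.r p c := by
  have hm : Measurable fun q : m.TState => (q.1 : ℝ) - p.1 :=
    (measurable_subtype_coe.comp measurable_fst).sub_const _
  have h1 : Integrable (fun q : m.TState => (q.1 : ℝ) - p.1) (m.Q p c) := by
    refine Integrable.of_bound hm.aestronglyMeasurable m.T (Filter.Eventually.of_forall fun q => ?_)
    rw [Real.norm_eq_abs, abs_le]
    have := q.1.2.1; have := q.1.2.2; have := p.1.2.1; have := p.1.2.2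
    constructor <;> linarith
  have h2 : ∫ q, ((q.1 : ℝ) - p.1) ∂(m.Q p c) = meanSojourn (m.rate p.2) (m.T - p.1) -
        Real.exp (-(m.rate p.2 * (m.T - p.1))) * (m.T - p.1) := by
    rw [integral_eq_lintegral_of_nonneg_ae _ hm.aestronglyMeasurable, m.lintegral_Q_sub,
      ENNReal.toReal_ofReal]
    · exact sub_nonneg.2 (exp_mul_le_meanSojourn (NNReal.coe_nonneg _))
    · filter_upwards [m.ae_lt_Q p c] with q hq
      exact sub_nonneg.2 (Subtype.coe_le_coe.2 hq.le)
  have hmc : Measurable (m.cost c (Sum.inl p)) := by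
    have h3 := m.measurable_time
    have h4 := m.measurable_dead
    unfold cost
    fun_prop
  rw [m.integral_stepX_inl p c hmc]
  · simp only [cost, running, terminal, time, dead, Sum.elim_inl, Sum.elim_inr, mul_zero, add_zero,
      mul_one]
    rw [integral_const_mul, h2, r]
    ring
  · simp only [cost, running, terminal, time, dead, Sum.elim_inl, mul_zero, add_zero]
    exact h1.const_mul _

end Model

namespace Model

variable {K M : ℕ} (m : Model K M)

/-! ## Verification for the discrete-time problem -/

/-- A function on `[0,T] × E` extended by zero to the cemetery. -/
def ext {m : Model K M} (v : m.TState → ℝ) : m.XState → ℝ := Sum.elim v fun _ => 0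

theorem measurable_ext {v : m.TState → ℝ} (hv : Measurable v) : Measurable (ext v) :=
  hv.sumElim measurable_const

/-- The one-stage reward collected at the `n`-th jump under the strategy `π`. -/
noncomputable def reward (π : m.Strategy) (n : ℕ) (ω : ℕ → m.XState) : ℝ :=
  ext (fun q => m.r q (π.act n (m.hist n ω))) (ω n)

theorem measurable_act_hist (π : m.Strategy) (n : ℕ) :
    Measurable fun ω : ℕ → m.XState => π.act n (m.hist n ω) :=
  (π.measurable_act n).comp (m.measurable_hist n)

theorem measurable_reward (hf : ∀ a, Measurable fun z => m.f z a) (hg : Measurable m.g)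
    (π : m.Strategy) (n : ℕ) : Measurable (m.reward π n) := by
  have h : Measurable fun q : m.XState × Action M => ext (fun p => m.r p q.2) q.1 :=
    measurable_from_prod_countable_left fun c => m.measurable_ext (m.measurable_r hf hg c)
  exact h.comp (f := fun ω : ℕ → m.XState => (ω n, π.act n (m.hist n ω)))
    ((measurable_pi_apply n).prodMk (m.measurable_act_hist π n))

theorem reward_toStrategy (F : m.Policy) (n : ℕ) (ω : ℕ → m.XState) :
    m.reward F.toStrategy n ω = m.stageReward F n ω := by
  unfold reward stageReward ext
  rcases h : ω n with q | u
  · simp [Policy.toStrategy, hist, h]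
  · simp

namespace IsLyapunov

variable {m} {W : m.TState → ℝ} {κ C : ℝ}

/-- The kernel bound is uniform in the admissible action, so it iterates along the chain for any
history-dependent strategy; the cemetery contributes nothing. -/
theorem lintegral_law_le (hW : m.IsLyapunov W κ C) (π : m.Strategy) (p : m.TState) (n : ℕ) :
    ∫⁻ ω, ENNReal.ofReal (ext W (ω n)) ∂(m.law π p) ≤ ENNReal.ofReal (κ ^ n * W p) := by
  have hWm : Measurable fun x : m.XState => ENNReal.ofReal (ext W x) :=
    (m.measurable_ext hW.measurable).ennreal_ofReal
  induction n with
  | zero =>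
    rw [pow_zero, one_mul, lintegral_congr_ae (g := fun _ => ENNReal.ofReal (W p))]
    · simp
    · filter_upwards [m.ae_law_zero π p] with ω hω
      simp [hω, ext]
  | succ n ih =>
    rw [m.lintegral_law_succ π p n (H := fun q => ENNReal.ofReal (ext W q.2))
      (hWm.comp measurable_snd)]
    have h1 : ∀ ω : ℕ → m.XState, ∫⁻ x, ENNReal.ofReal (ext W x)
        ∂(m.stepX (ω n) (π.act n (m.hist n ω))) ≤
        ENNReal.ofReal κ * ENNReal.ofReal (ext W (ω n)) := fun ω => by
      rcases h : ω n with q | u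
      · rw [m.lintegral_stepX_inl _ _ hWm, ← ENNReal.ofReal_mul hW.nonneg]
        simpa [ext] using hW.lintegral_le q _ (π.admissible n (m.hist n ω) q h)
      · simp only [stepX]
        rw [lintegral_dirac' _ hWm]
        simp [ext]
    refine (lintegral_mono h1).trans ?_
    rw [lintegral_const_mul' _ _ ENNReal.ofReal_ne_top]
    refine (mul_le_mul_right ih _).trans_eq ?_
    rw [← ENNReal.ofReal_mul hW.nonneg, pow_succ]
    ring_nf

theorem integrable_law (hW : m.IsLyapunov W κ C) (π : m.Strategy) (p : m.TState) (n : ℕ)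
    {u : (ℕ → m.XState) → ℝ} (hu : Measurable u) {D : ℝ} (hD : 0 ≤ D)
    (hle : ∀ ω, |u ω| ≤ D * ext W (ω n)) :
    Integrable u (m.law π p) ∧ |∫ ω, u ω ∂(m.law π p)| ≤ D * (κ ^ n * W p) :=
  integrable_and_abs_integral_le hu.aestronglyMeasurable hD
    (mul_nonneg (pow_nonneg hW.nonneg n) (hW.weight_nonneg p)) (Filter.Eventually.of_forall hle)
    (hW.lintegral_law_le π p n)

theorem summable_geometric (hW : m.IsLyapunov W κ C) (D : ℝ) (p : m.TState) :
    Summable fun n : ℕ => D * (κ ^ n * W p) :=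
  ((summable_geometric_of_lt_one hW.nonneg hW.lt_one).mul_right (W p)).mul_left D

/-- Functionals dominated by the weight along the chain are summable in mean. -/
theorem summable_integral (hW : m.IsLyapunov W κ C) (π : m.Strategy) (p : m.TState)
    {u : ℕ → (ℕ → m.XState) → ℝ} (hu : ∀ n, Measurable (u n)) {D : ℝ} (hD : 0 ≤ D)
    (hle : ∀ n ω, |u n ω| ≤ D * ext W (ω n)) :
    Integrable (fun ω => ∑' n, u n ω) (m.law π p) ∧
      HasSum (fun n => ∫ ω, u n ω ∂(m.law π p)) (∫ ω, ∑' n, u n ω ∂(m.law π p)) ∧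
      ∫⁻ ω, ∑' n, ‖u n ω‖ₑ ∂(m.law π p) < ⊤ := by
  have h1 : ∀ n, Integrable (u n) (m.law π p) := fun n =>
    (hW.integrable_law π p n (hu n) hD (hle n)).1
  have h2 : Summable fun n => ∫ ω, ‖u n ω‖ ∂(m.law π p) := by
    refine (hW.summable_geometric D p).of_nonneg_of_le
      (fun n => integral_nonneg fun _ => norm_nonneg _) fun n => ?_
    refine (le_abs_self _).trans (hW.integrable_law π p n (hu n).norm hD fun ω => ?_).2
    rw [Real.norm_eq_abs, abs_abs]; exact hle n ω
  have h3 : ∫⁻ ω, ∑' n, ‖u n ω‖ₑ ∂(m.law π p) < ⊤ := by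
    rw [lintegral_tsum fun n => (hu n).enorm.aemeasurable]
    have h4 : ∀ n, ∫⁻ ω, ‖u n ω‖ₑ ∂(m.law π p) =
        ENNReal.ofReal (∫ ω, ‖u n ω‖ ∂(m.law π p)) := fun n =>
      (ofReal_integral_norm_eq_lintegral_enorm (h1 n)).symm
    simp only [h4]
    exact h2.tsum_ofReal_lt_top
  refine ⟨⟨?_, ?_⟩, hasSum_integral_of_summable_integral_norm h1 h2, h3⟩
  · exact (Measurable.tsum hu).aestronglyMeasurable
  · refine lt_of_le_of_lt (lintegral_mono fun ω => ?_) h3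
    exact enorm_tsum_le_tsum_enorm

theorem abs_reward_le (hW : m.IsLyapunov W κ C) (π : m.Strategy) (n : ℕ) (ω : ℕ → m.XState) :
    |m.reward π n ω| ≤ C * (m.T + 1) * ext W (ω n) := by
  unfold reward ext
  rcases h : ω n with q | u
  · exact hW.abs_r_le q (π.admissible n (m.hist n ω) q h)
  · simp

/-- Conditioning on the history turns the next value of `v` into its integral against `Q`: this is
the increment used in the telescoping. -/
theorem integral_reward_add (hW : m.IsLyapunov W κ C) (hf : ∀ a, Measurable fun z => m.f z a)
    (hg : Measurable m.g) (hT : 0 ≤ m.T) {v : m.TState → ℝ} (hv : Measurable v) {D : ℝ}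
    (hD : 0 ≤ D) (hle : ∀ p, |v p| ≤ D * W p) (π : m.Strategy) (p : m.TState) (n : ℕ) :
    Integrable (fun ω : ℕ → m.XState => ext (fun q => m.actionValue v q (π.act n (m.hist n ω)))
      (ω n)) (m.law π p) ∧
    ∫ ω, m.reward π n ω ∂(m.law π p) + ∫ ω, ext v (ω (n + 1)) ∂(m.law π p) =
      ∫ ω, ext (fun q => m.actionValue v q (π.act n (m.hist n ω))) (ω n) ∂(m.law π p) := by
  have hR : 0 ≤ C * (m.T + 1) := mul_nonneg hW.const_nonneg (by linarith)
  have hextle : ∀ x, |ext v x| ≤ D * ext W x := by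
    rintro (q | u)
    · exact hle q
    · simp [ext]
  have hextm := m.measurable_ext hv
  have h1 := (hW.integrable_law π p n (m.measurable_reward hf hg π n) hR
    (hW.abs_reward_le π n)).1
  have h2 := (hW.integrable_law π p (n + 1)
    (hextm.comp (measurable_pi_apply (n + 1)) :
      Measurable fun ω : ℕ → m.XState => ext v (ω (n + 1)))
    hD fun ω => hextle _).1
  have h3 : ∀ ω : ℕ → m.XState, ∫ x, ext v x ∂(m.stepX (ω n) (π.act n (m.hist n ω))) =
      ext (fun q => ∫ x, v x ∂(m.Q q (π.act n (m.hist n ω)))) (ω n) := fun ω => by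
    rcases h : ω n with q | u
    · have := m.integral_stepX_inl q (π.act n (m.hist n ω)) hextm
        (hW.integrable_Q hv hD hle q (π.admissible n (m.hist n ω) q h)).1
      simpa [ext] using this
    · rw [m.integral_stepX_inr _ _ hextm]; rfl
  have h4 := m.integral_law_succ π p n (H := fun q => ext v q.2) (hextm.comp measurable_snd) h2
  simp only [h3] at h4
  have hm : Measurable fun ω : ℕ → m.XState =>
      ext (fun q => ∫ x, v x ∂(m.Q q (π.act n (m.hist n ω)))) (ω n) := by
    have h : Measurable fun q : m.XState × Action M => ext (fun p => ∫ x, v x ∂(m.Q p q.2)) q.1 :=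
      measurable_from_prod_countable_left fun c => m.measurable_ext
        (hv.stronglyMeasurable.integral_kernel (κ := m.kernelQ c)).measurable
    exact h.comp (f := fun ω : ℕ → m.XState => (ω n, π.act n (m.hist n ω)))
      ((measurable_pi_apply n).prodMk (m.measurable_act_hist π n))
  have h5 := (hW.integrable_law π p n hm (mul_nonneg hD hW.nonneg) fun ω => by
    rcases h : ω n with q | u
    · exact (hW.integrable_Q hv hD hle q (π.admissible n (m.hist n ω) q h)).2.trans_eq
        (mul_assoc _ _ _).symm
    · simp [ext]).1
  have h6 : ∀ ω : ℕ → m.XState, ext (fun q => m.actionValue v q (π.act n (m.hist n ω))) (ω n) =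
      m.reward π n ω + ext (fun q => ∫ x, v x ∂(m.Q q (π.act n (m.hist n ω)))) (ω n) := fun ω => by
    unfold reward ext
    rcases ω n with q | u
    · rfl
    · simp
  simp only [h6]
  exact ⟨h1.add h5, by rw [h4, integral_add h1 h5]⟩

/-- The expected total reward of a strategy is at most `v`, for a fixed point `v` of the maximal
reward operator. -/
theorem tsum_integral_reward_le (hW : m.IsLyapunov W κ C) (hf : ∀ a, Measurable fun z => m.f z a)
    (hg : Measurable m.g) (hT : 0 ≤ m.T) {v : m.TState → ℝ} (hv : Measurable v) {D : ℝ}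
    (hD : 0 ≤ D) (hle : ∀ p, |v p| ≤ D * W p) (hfix : m.bellman v = v) (π : m.Strategy)
    (p : m.TState) :
    ∫ ω, ∑' n, m.reward π n ω ∂(m.law π p) ≤ v p ∧
    ((∀ n ω q, ω n = Sum.inl q → m.actionValue v q (π.act n (m.hist n ω)) = v q) →
      ∫ ω, ∑' n, m.reward π n ω ∂(m.law π p) = v p) := by
  have hR : 0 ≤ C * (m.T + 1) := mul_nonneg hW.const_nonneg (by linarith)
  have hextle : ∀ x, |ext v x| ≤ D * ext W x := by
    rintro (q | u)
    · exact hle q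
    · simp [ext]
  have hvi := fun n => hW.integrable_law π p n
    ((m.measurable_ext hv).comp (measurable_pi_apply n) :
      Measurable fun ω : ℕ → m.XState => ext v (ω n)) hD fun ω => hextle _
  have hsum := (hW.summable_integral π p (m.measurable_reward hf hg π) hR
    (hW.abs_reward_le π)).2.1.tendsto_sum_nat
  have h0 : ∫ ω, ext v (ω 0) ∂(m.law π p) = v p := by
    rw [integral_congr_ae (g := fun _ => v p)]
    · simp
    · filter_upwards [m.ae_law_zero π p] with ω hω
      simp [hω, ext]
  have hlim : Filter.Tendsto (fun n => ∫ ω, ext v (ω n) ∂(m.law π p)) Filter.atTop (nhds 0) := by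
    refine squeeze_zero_norm (fun n => (hvi n).2) ?_
    exact (hW.summable_geometric D p).tendsto_atTop_zero
  have hstep := fun n => hW.integral_reward_add hf hg hT hv hD hle π p n
  -- The partial sums of expected rewards are compared with this sequence; the remainder E v(Tₙ, Zₙ)
  -- is dominated by the decaying weight.
  have hlim2 : Filter.Tendsto (fun n => v p - ∫ ω, ext v (ω n) ∂(m.law π p)) Filter.atTop
      (nhds (v p)) := by simpa using hlim.const_sub (v p)
  constructor
  · refine le_of_tendsto_of_tendsto' hsum hlim2 fun n => ?_
    induction n with
    | zero => simp [h0]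
    | succ n ih =>
      rw [Finset.sum_range_succ]
      have h1 := (hstep n).2
      have h2 : ∫ ω, ext (fun q => m.actionValue v q (π.act n (m.hist n ω))) (ω n) ∂(m.law π p) ≤
          ∫ ω, ext v (ω n) ∂(m.law π p) := by
        refine integral_mono (hstep n).1 (hvi n).1 fun ω => ?_
        dsimp only [ext]
        rcases h : ω n with q | u
        · simp only [Sum.elim_inl]
          conv_rhs => rw [← hfix]
          exact m.actionValue_le_bellman v q (π.admissible n (m.hist n ω) q h)
        · simp
      linarith
  · intro hmax
    refine tendsto_nhds_unique hsum (hlim2.congr fun n => ?_)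
    induction n with
    | zero => simp [h0]
    | succ n ih =>
      rw [Finset.sum_range_succ, ← ih]
      have h1 := (hstep n).2
      have h2 : ∫ ω, ext (fun q => m.actionValue v q (π.act n (m.hist n ω))) (ω n) ∂(m.law π p) =
          ∫ ω, ext v (ω n) ∂(m.law π p) := by
        congr 1
        funext ω
        dsimp only [ext]
        rcases h : ω n with q | u
        · exact hmax n ω q h
        · simp
      linarith

end IsLyapunov

end Model

namespace Model

variable {K M : ℕ} (m : Model K M)

/-! ## The market making problem in continuous time -/

/-- The reward collected between the `n`-th and the next jump under the strategy `π`. -/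
noncomputable def stageGain (π : m.Strategy) (n : ℕ) (ω : ℕ → m.XState) : ℝ :=
  m.cost (π.act n (m.hist n ω)) (ω n) (ω (n + 1))

theorem measurable_stageGain (hf : ∀ a, Measurable fun z => m.f z a) (hg : Measurable m.g)
    (π : m.Strategy) (n : ℕ) : Measurable (m.stageGain π n) :=
  (m.measurable_cost hf hg).comp
    (f := fun ω : ℕ → m.XState => ((ω n, ω (n + 1)), π.act n (m.hist n ω)))
    (((measurable_pi_apply n).prodMk (measurable_pi_apply (n + 1))).prodMk
      (m.measurable_act_hist π n))

theorem time_mem (hT : 0 ≤ m.T) (x : m.XState) : m.time x ∈ Set.Icc 0 m.T := by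
  rcases x with q | u
  · exact q.1.2
  · exact ⟨hT, le_rfl⟩

theorem IsLyapunov.abs_stageGain_le {m : Model K M} {W : m.TState → ℝ} {κ C : ℝ}
    (hW : m.IsLyapunov W κ C) (hT : 0 ≤ m.T) (π : m.Strategy) (n : ℕ) (ω : ℕ → m.XState) :
    |m.stageGain π n ω| ≤ C * (m.T + 1) * ext W (ω n) := by
  have h1 := m.time_mem hT (ω n)
  have h2 := m.time_mem hT (ω (n + 1))
  have h3 : |m.time (ω (n + 1)) - m.time (ω n)| ≤ m.T := by
    rw [abs_le]; constructor <;> linarith [h1.1, h1.2, h2.1, h2.2]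
  have h4 : |m.dead (ω (n + 1))| ≤ 1 := by
    rcases ω (n + 1) with q | u <;> simp [dead]
  unfold stageGain cost
  refine (abs_add_le _ _).trans ?_
  rw [abs_mul, abs_mul]
  rcases h : ω n with q | u
  · rw [h] at h3
    have hc := π.admissible n (m.hist n ω) q h
    have h5 := hW.const_nonneg
    have h6 := hW.weight_nonneg q
    calc _ ≤ C * W q * m.T + C * W q * 1 := by
          gcongr
          · exact hW.running_le q _ hc
          · exact hW.terminal_le q _ hc
      _ = _ := by simp only [ext, Sum.elim_inl]; ring
  · simp [running, terminal, ext]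

/-- Given the history, the mean of the reward up to the next jump is `r`, by `integral_cost`; at the
cemetery both sides vanish. -/
theorem IsLyapunov.integral_stageGain {m : Model K M} {W : m.TState → ℝ} {κ C : ℝ}
    (hW : m.IsLyapunov W κ C) (hf : ∀ a, Measurable fun z => m.f z a) (hg : Measurable m.g)
    (hT : 0 ≤ m.T) (π : m.Strategy) (p : m.TState) (n : ℕ) :
    ∫ ω, m.stageGain π n ω ∂(m.law π p) = ∫ ω, m.reward π n ω ∂(m.law π p) := by
  have hR : 0 ≤ C * (m.T + 1) := mul_nonneg hW.const_nonneg (by linarith)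
  have hi := (hW.integrable_law π p n (m.measurable_stageGain hf hg π n) hR
    (hW.abs_stageGain_le hT π n)).1
  have hm : Measurable fun q : m.Hist n × m.XState =>
      m.cost (π.act n q.1) (q.1 ⟨n, Finset.mem_Iic.2 le_rfl⟩) q.2 :=
    (m.measurable_cost hf hg).comp
      (f := fun q : m.Hist n × m.XState =>
        ((q.1 ⟨n, Finset.mem_Iic.2 le_rfl⟩, q.2), π.act n q.1))
      ((((measurable_pi_apply _).comp measurable_fst).prodMk measurable_snd).prodMk
        ((π.measurable_act n).comp measurable_fst))
  have h := m.integral_law_succ π p n hm hi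
  refine h.trans (integral_congr_ae (Filter.Eventually.of_forall fun ω => ?_))
  change ∫ x, m.cost (π.act n (m.hist n ω)) (ω n) x ∂(m.stepX (ω n) (π.act n (m.hist n ω))) = _
  unfold reward ext
  rcases h : ω n with q | u
  · exact m.integral_cost q _
  · simp [cost, running, terminal]

/-- The regular trajectories: started at `p`, absorbed in the cemetery after finitely many steps,
with increasing jump times before. -/
structure Regular (p : m.TState) (ω : ℕ → m.XState) : Prop where
  start : ω 0 = Sum.inl p
  absorbed : ∀ n u, ω n = Sum.inr u → ω (n + 1) = Sum.inr ()
  lt : ∀ n q q', ω n = Sum.inl q → ω (n + 1) = Sum.inl q' → q.1 < q'.1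
  finite : ∃ n, ω n = Sum.inr ()

theorem time_le_time {x x' : m.XState} (h1 : ∀ u, x = Sum.inr u → x' = Sum.inr ())
    (h2 : ∀ q q', x = Sum.inl q → x' = Sum.inl q' → q.1 < q'.1) : m.time x ≤ m.time x' := by
  rcases x with q | u
  · rcases x' with q' | u'
    · exact Subtype.coe_le_coe.2 (h2 q q' rfl rfl).le
    · exact q.1.2.2
  · rw [h1 u rfl]

theorem IsLyapunov.ae_regular {m : Model K M} {W : m.TState → ℝ} {κ C : ℝ}
    (hW : m.IsLyapunov W κ C) (π : m.Strategy) (p : m.TState) :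
    ∀ᵐ ω ∂(m.law π p), m.Regular p ω := by
  -- Absorption and monotonicity of the jump times are expressed through `dead` and `time`, which
  -- makes the events visibly measurable.
  have hdead : ∀ n, ∀ᵐ ω ∂(m.law π p), m.dead (ω n) ≤ m.dead (ω (n + 1)) := fun n => by
    refine m.ae_law_succ π p n (A := {q | m.dead (q.1 ⟨n, Finset.mem_Iic.2 le_rfl⟩) ≤ m.dead q.2})
      (measurableSet_le (m.measurable_dead.comp ((measurable_pi_apply _).comp measurable_fst))
        (m.measurable_dead.comp measurable_snd)) fun ω => ?_
    change ∀ᵐ x ∂(m.stepX (ω n) (π.act n (m.hist n ω))), m.dead (ω n) ≤ m.dead x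
    rcases h : ω n with q | u
    · refine Filter.Eventually.of_forall fun x => ?_
      rcases x with q' | u' <;> simp [dead]
    · simp only [stepX]
      rw [ae_dirac_iff (measurableSet_le measurable_const m.measurable_dead)]
  have hlt : ∀ n, ∀ᵐ ω ∂(m.law π p),
      m.dead (ω n) = 1 ∨ m.dead (ω (n + 1)) = 1 ∨ m.time (ω n) < m.time (ω (n + 1)) := fun n => by
    have hm1 : Measurable fun q : m.Hist n × m.XState =>
        q.1 ⟨n, Finset.mem_Iic.2 le_rfl⟩ := (measurable_pi_apply _).comp measurable_fst
    refine m.ae_law_succ π p n (A := {q | m.dead (q.1 ⟨n, Finset.mem_Iic.2 le_rfl⟩) = 1 ∨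
      m.dead q.2 = 1 ∨ m.time (q.1 ⟨n, Finset.mem_Iic.2 le_rfl⟩) < m.time q.2}) ?_ fun ω => ?_
    · exact (measurableSet_eq_fun (m.measurable_dead.comp hm1) measurable_const).union
        ((measurableSet_eq_fun (m.measurable_dead.comp measurable_snd) measurable_const).union
        (measurableSet_lt (m.measurable_time.comp hm1) (m.measurable_time.comp measurable_snd)))
    · change ∀ᵐ x ∂(m.stepX (ω n) (π.act n (m.hist n ω))),
        m.dead (ω n) = 1 ∨ m.dead x = 1 ∨ m.time (ω n) < m.time x
      rcases h : ω n with q | u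
      · simp only [stepX, step, ae_add_measure_iff]
        refine ⟨?_, Measure.ae_smul_measure ?_ _⟩
        · have hs : MeasurableSet {x : m.XState | m.dead (Sum.inl q) = 1 ∨ m.dead x = 1 ∨
              m.time (Sum.inl q) < m.time x} :=
            (MeasurableSet.const _).union ((measurableSet_eq_fun m.measurable_dead
              measurable_const).union (measurableSet_lt measurable_const m.measurable_time))
          rw [ae_map_iff measurable_inl.aemeasurable hs]
          filter_upwards [m.ae_lt_Q q (π.act n (m.hist n ω))] with x hx
          exact Or.inr (Or.inr (Subtype.coe_lt_coe.2 hx))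
        · have hs : MeasurableSet {x : m.XState | m.dead (Sum.inl q) = 1 ∨ m.dead x = 1 ∨
              m.time (Sum.inl q) < m.time x} :=
            (MeasurableSet.const _).union ((measurableSet_eq_fun m.measurable_dead
              measurable_const).union (measurableSet_lt measurable_const m.measurable_time))
          rw [ae_dirac_iff hs]
          exact Or.inr (Or.inl rfl)
      · exact Filter.Eventually.of_forall fun x => Or.inl rfl
  -- Non-explosion: the sum of the weights along the chain has finite mean, and each live state
  -- contributes at least one.
  have hfin : ∀ᵐ ω ∂(m.law π p), ∃ n, m.dead (ω n) = 1 := by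
    have hs := (hW.summable_integral π p (u := fun n ω => ext W (ω n))
      (fun n => (m.measurable_ext hW.measurable).comp (measurable_pi_apply n)) zero_le_one
      fun n ω => by
        rw [one_mul]
        rcases ω n with q | u
        · exact (abs_of_nonneg (hW.weight_nonneg q)).le
        · simp [ext]).2.2
    have hlt : ∀ᵐ ω ∂(m.law π p), ∑' n, ‖ext W (ω n)‖ₑ < ⊤ := by
      refine ae_lt_top ?_ hs.ne
      exact Measurable.tsum fun n =>
        ((m.measurable_ext hW.measurable).comp (measurable_pi_apply n)).enorm
    filter_upwards [hlt] with ω hω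
    by_contra hn
    push Not at hn
    have h1 : ∀ n, (1 : ℝ≥0∞) ≤ ‖ext W (ω n)‖ₑ := fun n => by
      have hne := hn n
      rcases hx : ω n with q | u
      · rw [Real.enorm_eq_ofReal_abs, ← ENNReal.ofReal_one]
        exact ENNReal.ofReal_le_ofReal ((hW.one_le q).trans (le_abs_self _))
      · rw [hx] at hne
        exact absurd rfl hne
    have h2 : (∑' _ : ℕ, (1 : ℝ≥0∞)) ≤ ∑' n, ‖ext W (ω n)‖ₑ := ENNReal.tsum_le_tsum h1
    rw [ENNReal.tsum_const_eq_top_of_ne_zero one_ne_zero, top_le_iff] at h2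
    exact hω.ne h2
  have hd : ∀ x : m.XState, m.dead x = 1 → x = Sum.inr () := by
    rintro (q | u) h
    · simp [dead] at h
    · rfl
  filter_upwards [m.ae_law_zero π p, ae_all_iff.2 hdead, ae_all_iff.2 hlt, hfin] with ω h0 h1 h2 h3
  refine ⟨h0, fun n u hu => hd _ ?_, fun n q q' hq hq' => ?_, h3.imp fun n hn => hd _ hn⟩
  · have := h1 n
    rw [hu] at this
    rcases h : ω (n + 1) with q | u'
    · rw [h] at this
      simp only [dead, Sum.elim_inr, Sum.elim_inl] at this
      linarith
    · rfl
  · have := h2 n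
    rw [hq, hq'] at this
    simpa [dead, time] using this

/-! ### Pathwise decomposition of the gain -/

namespace Regular

variable {m} {p : m.TState} {ω : ℕ → m.XState}

theorem time_mono (h : m.Regular p ω) : Monotone fun n => m.time (ω n) :=
  monotone_nat_of_le_succ fun n => m.time_le_time (h.absorbed n) (h.lt n)

theorem dead_of_le (h : m.Regular p ω) {n k : ℕ} (hnk : n ≤ k) (hn : ω n = Sum.inr ()) :
    ω k = Sum.inr () := by
  induction k, hnk using Nat.le_induction with
  | base => exact hn
  | succ k _ ih => exact h.absorbed k () ih

/-- The index `n` belongs to the set defining `jumpCount`; a smaller one does not, since its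
successor is a live state whose jump time is at most that of `q`, hence at most `s`. -/
theorem jumpCount_eq (h : m.Regular p ω) {n : ℕ} {q : m.TState} (hq : ω n = Sum.inl q) {s : ℝ}
    (hs : q.1 ≤ s) (hs' : ∀ q' : m.TState, ω (n + 1) = Sum.inl q' → s < q'.1) :
    m.jumpCount ω s = n := by
  refine le_antisymm (Nat.sInf_le hs') ?_
  refine le_csInf ⟨n, hs'⟩ fun k hk => ?_
  by_contra hlt
  rw [not_le] at hlt
  rcases hk1 : ω (k + 1) with q' | u
  · have h1 := hk q' hk1
    have h2 := h.time_mono (Nat.succ_le_of_lt hlt)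
    simp only [hk1, hq, time, Sum.elim_inl] at h2
    linarith
  · have := h.dead_of_le (Nat.succ_le_of_lt hlt) hk1
    rw [hq] at this
    exact Sum.inl_ne_inr this

/-- State and decision are constant between jumps, so the time integral splits into finitely many
constant pieces; only the last live state meets the horizon and collects the terminal reward. -/
theorem gain_eq (h : m.Regular p ω) (π : m.Strategy) :
    m.gain π p ω = ∑' n, m.stageGain π n ω := by
  classical
  set N := Nat.find h.finite with hN
  have hNd : ω N = Sum.inr () := Nat.find_spec h.finite
  have halive : ∀ n < N, ∃ q, ω n = Sum.inl q := fun n hn => by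
    rcases hx : ω n with q | u
    · exact ⟨q, rfl⟩
    · exact absurd hx (Nat.find_min h.finite hn)
  have hN0 : N ≠ 0 := fun h0 => by
    rw [h0, h.start] at hNd
    exact Sum.inl_ne_inr hNd
  obtain ⟨k, hk⟩ := Nat.exists_eq_succ_of_ne_zero hN0
  set φ : ℝ → ℝ := fun s => m.evalAt π ω s fun z => m.f z (m.control π ω s) with hφ
  have heval : ∀ n q, ω n = Sum.inl q → ∀ s, m.jumpCount ω s = n →
      φ s = m.f (q.2.place (π.act n (m.hist n ω))) (π.act n (m.hist n ω)) ∧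
      m.evalAt π ω s m.g = m.g (q.2.place (π.act n (m.hist n ω))) := fun n q hq s hs => by
    subst hs
    simp only [hφ, evalAt, control, hq]
    exact ⟨trivial, trivial⟩
  have hconst : ∀ n < N, ∀ᵐ s, s ∈ Set.uIoc (m.time (ω n)) (m.time (ω (n + 1))) →
      m.running (π.act n (m.hist n ω)) (ω n) = φ s := fun n hn => by
    obtain ⟨q, hq⟩ := halive n hn
    -- At its right endpoint an interval already belongs to the next jump, so the equality holds
    -- only almost everywhere.
    have hne : ∀ᵐ s : ℝ, s ≠ m.time (ω (n + 1)) := by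
      simp [ae_iff]
    filter_upwards [hne] with s hs hmem
    have hle := h.time_mono (Nat.le_succ n)
    rw [Set.uIoc_of_le hle] at hmem
    have hlt : s < m.time (ω (n + 1)) := lt_of_le_of_ne hmem.2 hs
    have hjc := h.jumpCount_eq hq (s := s) (by
      have := hmem.1.le
      simpa [hq, time] using this) fun q' hq' => by simpa [hq', time] using hlt
    rw [(heval n q hq s hjc).1, hq]
    rfl
  have h_integral : ∀ n < N, IntervalIntegrable φ volume (m.time (ω n)) (m.time (ω (n + 1))) :=
    fun n hn => (intervalIntegrable_const (c := m.running (π.act n (m.hist n ω)) (ω n))).congr_ae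
      ((ae_restrict_iff' measurableSet_uIoc).2 (hconst n hn))
  have hval : ∀ n < N, ∫ s in m.time (ω n)..m.time (ω (n + 1)), φ s =
      m.running (π.act n (m.hist n ω)) (ω n) * (m.time (ω (n + 1)) - m.time (ω n)) :=
    fun n hn => by
      rw [← intervalIntegral.integral_congr_ae (hconst n hn), intervalIntegral.integral_const,
        smul_eq_mul, mul_comm]
  have hrun : ∫ s in (p.1 : ℝ)..m.T, φ s = ∑ n ∈ Finset.range N,
      m.running (π.act n (m.hist n ω)) (ω n) * (m.time (ω (n + 1)) - m.time (ω n)) := by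
    have h1 := intervalIntegral.sum_integral_adjacent_intervals
      (a := fun n => m.time (ω n)) (n := N) (f := φ) (μ := volume) h_integral
    have h2 : m.time (ω 0) = p.1 := by rw [h.start]; rfl
    have h3 : m.time (ω N) = m.T := by rw [hNd]; rfl
    rw [h2, h3] at h1
    rw [← h1]
    exact Finset.sum_congr rfl fun n hn => hval n (Finset.mem_range.1 hn)
  have hterm : m.evalAt π ω m.T m.g = ∑ n ∈ Finset.range N,
      m.terminal (π.act n (m.hist n ω)) (ω n) * m.dead (ω (n + 1)) := by
    obtain ⟨q, hq⟩ := halive k (by omega)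
    have hk1 : ω (k + 1) = Sum.inr () := by rw [← Nat.succ_eq_add_one, ← hk]; exact hNd
    have hjc := h.jumpCount_eq hq (s := m.T) q.1.2.2 fun q' hq' => by
      rw [hk1] at hq'; exact absurd hq'.symm Sum.inl_ne_inr
    rw [(heval k q hq m.T hjc).2, hk, Nat.succ_eq_add_one, Finset.sum_range_succ,
      Finset.sum_eq_zero, zero_add, hk1, hq]
    · simp [terminal, dead]
    · intro n hn
      obtain ⟨q', hq'⟩ := halive (n + 1) (by have := Finset.mem_range.1 hn; omega)
      rw [hq']
      simp [dead]
  -- Past `N` the terms vanish because the rewards are zero at the cemetery, although `dead` equals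
  -- one there.
  rw [tsum_eq_sum (s := Finset.range N)]
  · simp only [gain, stageGain, cost, Finset.sum_add_distrib]
    rw [← hrun, ← hterm]
  · intro n hn
    have := h.dead_of_le (not_lt.1 fun hlt => hn (Finset.mem_range.2 hlt)) hNd
    simp [stageGain, cost, this, running, terminal]

end Regular

/-- The gain agrees almost surely with the series of stage gains, which supplies its measurability.
That series and the series of rewards have the same means term by term, and both may be integrated
termwise. -/
theorem IsLyapunov.integrable_gain {m : Model K M} {W : m.TState → ℝ} {κ C : ℝ}
    (hW : m.IsLyapunov W κ C) (hf : ∀ a, Measurable fun z => m.f z a) (hg : Measurable m.g)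
    (hT : 0 ≤ m.T) (π : m.Strategy) (p : m.TState) :
    Integrable (m.gain π p) (m.law π p) ∧
      m.expectedGain π p = ∫ ω, ∑' n, m.reward π n ω ∂(m.law π p) := by
  have hR : 0 ≤ C * (m.T + 1) := mul_nonneg hW.const_nonneg (by linarith)
  obtain ⟨h1, h2, -⟩ := hW.summable_integral π p (m.measurable_stageGain hf hg π) hR
    (hW.abs_stageGain_le hT π)
  have h3 := (hW.summable_integral π p (m.measurable_reward hf hg π) hR (hW.abs_reward_le π)).2.1
  have h4 : m.gain π p =ᵐ[m.law π p] fun ω => ∑' n, m.stageGain π n ω := by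
    filter_upwards [hW.ae_regular π p] with ω hω
    exact hω.gain_eq π
  refine ⟨h1.congr h4.symm, ?_⟩
  rw [expectedGain, integral_congr_ae h4]
  simp only [hW.integral_stageGain hf hg hT π p] at h2
  exact h2.unique h3

end Model

end LOB

/-! ### The main theorem -/

theorem theorem3p1 {K M : ℕ} (m : LOB.Model K M) (hT : 0 < m.T)
    (hainf : 0 < m.ainf) (hbinf : 0 < m.binf)
    (hlam : m.LinearIntensities)
    (hf : ∀ a, Measurable fun z => m.f z a) (hg : Measurable m.g)
    (hrew : m.QuadraticRewards) (γ₀ : ℝ) (hγ₀ : 0 < γ₀) :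
    ∃ v ∈ m.weightedSpace γ₀,
      -- `v` is the unique fixed point of the maximal reward operator
      m.bellman v = v ∧
      (∀ w ∈ m.weightedSpace γ₀, m.bellman w = w → w = v) ∧
      -- `v` is the value function of the Markov decision process, which is well defined
      (∀ (F : m.Policy) (p : m.TState),
        ∫⁻ ω, ∑' n, ‖m.stageReward F n ω‖ₑ ∂(m.law F.toStrategy p) < ⊤) ∧
      (∀ p, BddAbove (Set.range fun F : m.Policy => m.mdpReward F p)) ∧
      v = m.Vinf ∧
      -- `v` is the value function of the market making problem, which is well defined
      (∀ (π : m.Strategy) (p : m.TState), MeasureTheory.Integrable (m.gain π p) (m.law π p)) ∧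
      (∀ p, BddAbove (Set.range fun π : m.Strategy => m.expectedGain π p)) ∧
      v = m.V ∧
      -- maximizers exist, and each of them gives an optimal stationary policy
      (∃ F : m.DecisionRule, m.IsMaximizer v F) ∧
      (∀ F : m.DecisionRule, m.IsMaximizer v F → ∀ p,
        m.mdpReward (fun _ => F) p = m.Vinf p ∧
        m.expectedGain (LOB.Model.Policy.toStrategy fun _ => F) p = m.V p) := by
  obtain ⟨W, κ, C, hW, D, hD, hWb⟩ := m.exists_isLyapunov hlam hrew hγ₀
  obtain ⟨v, hv, ⟨D', hD', hvW⟩, hfix⟩ := hW.exists_fixedPoint hf hg hT.le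
  have hmem : v ∈ m.weightedSpace γ₀ := m.mem_weightedSpace hv (D := D' * D) fun p =>
    (hvW p).trans ((mul_le_mul_of_nonneg_left (hWb p) hD').trans_eq (mul_assoc _ _ _).symm)
  have hR : 0 ≤ C * (m.T + 1) := mul_nonneg hW.const_nonneg (by linarith)
  have hverif := hW.tsum_integral_reward_le hf hg hT.le hv hD' hvW hfix
  have hgain := hW.integrable_gain hf hg hT.le
  have hmdp : ∀ (F : m.Policy) p, m.mdpReward F p =
      ∫ ω, ∑' n, m.reward F.toStrategy n ω ∂(m.law F.toStrategy p) := fun F p => by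
    simp only [LOB.Model.mdpReward, m.reward_toStrategy]
  have hopt : ∀ F : m.DecisionRule, m.IsMaximizer v F → ∀ p,
      m.mdpReward (fun _ => F) p = v p ∧
      m.expectedGain (LOB.Model.Policy.toStrategy fun _ => F) p = v p := fun F hF p => by
    -- The equality case of verification asks for optimality at every live state of every
    -- trajectory, which a maximizer provides without exceptional set.
    have h := (hverif (LOB.Model.Policy.toStrategy fun _ => F) p).2 fun n ω q hq => by
      have : (LOB.Model.Policy.toStrategy fun _ => F).act n (m.hist n ω) = F.act q := by
        simp [LOB.Model.Policy.toStrategy, LOB.Model.hist, hq]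
      rw [this, hF q, hfix]
    exact ⟨(hmdp _ p).trans h, (hgain _ p).2.trans h⟩
  have hmdple : ∀ p, ∀ F : m.Policy, m.mdpReward F p ≤ v p := fun p F =>
    (hmdp F p).trans_le (hverif _ p).1
  have hgainle : ∀ p, ∀ π : m.Strategy, m.expectedGain π p ≤ v p := fun p π =>
    (hgain π p).2.trans_le (hverif π p).1
  have hbdd : ∀ p, BddAbove (Set.range fun F : m.Policy => m.mdpReward F p) := fun p =>
    ⟨v p, Set.forall_mem_range.2 (hmdple p)⟩
  have hbdd' : ∀ p, BddAbove (Set.range fun π : m.Strategy => m.expectedGain π p) := fun p =>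
    ⟨v p, Set.forall_mem_range.2 (hgainle p)⟩
  obtain ⟨F, hF⟩ := m.exists_isMaximizer hf hg hv
  -- Every value is at most `v` and the stationary policy of `F` attains it; the same policy, viewed
  -- as a strategy, settles the continuous-time supremum.
  have hVinf : v = m.Vinf := funext fun p => by
    have : Nonempty m.Policy := ⟨fun _ => F⟩
    exact le_antisymm ((hopt F hF p).1.symm.trans_le (le_ciSup (hbdd p) fun _ => F))
      (ciSup_le (hmdple p))
  have hV : v = m.V := funext fun p => by
    have : Nonempty m.Strategy := ⟨LOB.Model.Policy.toStrategy fun _ => F⟩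
    exact le_antisymm ((hopt F hF p).2.symm.trans_le (le_ciSup (hbdd' p) _))
      (ciSup_le (hgainle p))
  refine ⟨v, hmem, hfix, fun w hw hwf => m.eq_of_bellman_eq hlam hT.le hγ₀ hw hmem hwf hfix,
    fun G p => ?_, hbdd, hVinf, fun π p => (hgain π p).1, hbdd', hV, ⟨F, hF⟩, fun G hG p => ?_⟩
  · have h := (hW.summable_integral G.toStrategy p (m.measurable_reward hf hg G.toStrategy) hR
      (hW.abs_reward_le G.toStrategy)).2.2
    simpa only [m.reward_toStrategy] using h
  · rw [← hVinf, ← hV]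
    exact hopt G hG p
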